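/- Notation. For $x,y\in\mathbb C^3$ let $[x\cdot y]=x_0y_0-x_1y_1-x_2y_2$. Let $X=\{x\in\mathbb R^3:[x\cdot x]=-1\}$ with the measure $d\sigma=\frac{dx_1dx_2}{2|x_0|}$, let $C^+=\{\xi\in\mathbb R^3\setminus\{0\}:[\xi\cdot\xi]=0,\ \xi_0\ge 0\}$, and let $\mathcal T^{\pm}$ be the set of $z=x+iy\in\mathbb C^3$ with $[z\cdot z]=-1$, $[y\cdot y]>0$ and $\pm y_0>0$. For real or complex $\lambda\ne\mu$ put $z(\lambda,\mu)=\frac{1}{\lambda-\mu}(1+\lambda\mu,\,1-\lambda\mu,\,\lambda+\mu)$; this identifies $\mathcal T^+$ (resp. $\mathcal T^-$) with the tube $\tau^{-,+}=\{\operatorname{Im}\lambda<0<\operatorname{Im}\mu\}$ (resp. $\tau^{+,-}=\{\operatorname{Im}\mu<0<\operatorname{Im}\lambda\}$). The space $H^2_{\rm reg}(\mathcal T^\pm)$ consists of the holomorphic functions $F$ on $\mathcal T^\pm$, or equivalently of their boundary values $f$ on $X$, such that $(\lambda-\mu)^{-1}F(z(\lambda,\mu))$ lies in the Hardy space $H^2$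 of the corresponding tube, with mean-square boundary value $(\lambda-\mu)^{-1}f(z(\lambda,\mu))$ on $\mathbb R^2$, where $f\in L^2(X,d\sigma)$, and such that these functions are bounded, on the tube and almost everywhere on $\mathbb R^2$, by ${\rm cst}\,(1+|\lambda|)^{-1}(1+|\mu|)^{-1}$. The Lorentzian Fourier–Helgason transforms of $f$ are $$\tilde f_{\pm,\nu}(\xi)=\int_X[x\cdot\xi]_\pm^{-\frac12-i\nu}f(x)\,d\sigma(x),\qquad \xi\in C^+,\ \nu\in\mathbb R,$$ where $t_\pm^s=t^s$ for $t>0$ and $t_\pm^s=e^{\pm i\pi s}|t|^s$ for $t<0$. For a piecewise $C^1$ loop $\gamma$ on $C^+$ that is homotopic on $C^+$ to the circle $\alpha\mapsto(1,\cos\alpha,\sin\alpha)$, $-\pi\le\alpha\le\pi$, let $d\mu_\gamma$ be the restriction to $\gamma$ of the one-form $\frac{\xi_1d\xi_2-\xi_2d\xi_1}{2\xi_0}$. Complex powers of $[z\cdot\xi]$ are taken on the principal branch. Theorem. Let $f$ belong to $H^2_{\rm reg}(\mathcal T^-)$ (resp. $H^2_{\rm reg}(\mathcal T^+)$), and let $F$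 be the holomorphic function on $\mathcal T^-$ (resp. $\mathcal T^+$) whose boundary value is $f$. Then the integrals defining $\tilde f_{+,\nu}$ and $\tilde f_{-,\nu}$ converge absolutely, and $\tilde f_{-,\nu}$ (resp. $\tilde f_{+,\nu}$) vanishes identically, so that $\tilde f_{+,\nu}$ (resp. $\tilde f_{-,\nu}$) is the only transform of $f$ to be considered. For every $z\in\mathcal T^-$ (resp. $z\in\mathcal T^+$) and every such loop $\gamma$, $$F(z)=\frac1{2\pi^2}\int_0^\infty\frac{\nu\tanh\pi\nu}{e^{\pm\pi\nu}\cosh\pi\nu}\,d\nu\int_\gamma[z\cdot\xi]^{-\frac12+i\nu}\,\tilde f_{\pm,\nu}(\xi)\,d\mu_\gamma(\xi),$$ with the upper signs for $\mathcal T^-$ and the lower signs for $\mathcal T^+$, and the double integral converges absolutely. -/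

import Mathlib

open MeasureTheory Filter Topology Set

noncomputable section

namespace OneSheeted

/-! ### Minkowskian geometry -/

/-- The bilinear form `[x·y] = x₀y₀ - x₁y₁ - x₂y₂`, on `ℝ³` and on `ℂ³`. -/
def mink {K : Type*} [CommRing K] (x y : Fin 3 → K) : K :=
  x 0 * y 0 - x 1 * y 1 - x 2 * y 2

/-- A real vector seen in `ℂ³`. -/
def toC (x : Fin 3 → ℝ) : Fin 3 → ℂ := fun i => (x i : ℂ)

/-- The imaginary part `y` of `z = x + iy`. -/
def imPart (z : Fin 3 → ℂ) : Fin 3 → ℝ := fun i => (z i).im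

/-- The future light-cone `C⁺ = {ξ ≠ 0 : ξ² = 0, ξ₀ ≥ 0}`. -/
def futureCone : Set (Fin 3 → ℝ) := {ξ | mink ξ ξ = 0 ∧ 0 ≤ ξ 0 ∧ ξ ≠ 0}

/-- The Lorentz tuboid `𝒯⁺` (for `δ = 1`) or `𝒯⁻` (for `δ = -1`): the points `z = x + iy` of the
complex quadric `z² = -1` with `y² > 0` and `δ y₀ > 0`. -/
def tuboid (δ : ℝ) : Set (Fin 3 → ℂ) :=
  {z | mink z z = -1 ∧ 0 < mink (imPart z) (imPart z) ∧ 0 < δ * imPart z 0}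

/-- The invariant measure `dσ(x) = dx₁ dx₂ / (2 |x₀|)` on the real one-sheeted hyperboloid
`X = {x² = -1}`, as a measure on `ℝ³` carried by `X`: the sum of the contributions of the two
sheets `x₀ = ± √(x₁² + x₂² - 1)`, each a graph over `{x₁² + x₂² > 1}`. -/
def sigma : Measure (Fin 3 → ℝ) :=
  let D : Set (ℝ × ℝ) := {q | 1 < q.1 ^ 2 + q.2 ^ 2}
  let h : ℝ × ℝ → ℝ := fun q => Real.sqrt (q.1 ^ 2 + q.2 ^ 2 - 1)
  let m : Measure (ℝ × ℝ) :=
    (volume.restrict D).withDensity (fun q => ENNReal.ofReal (1 / (2 * h q)))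
  m.map (fun q => ![h q, q.1, q.2]) + m.map (fun q => ![-h q, q.1, q.2])

/-- The parametrization of the (real or complex) quadric by `(λ, μ)`, `λ ≠ μ`. -/
def param {K : Type*} [Field K] (l m : K) : Fin 3 → K :=
  ![(1 + l * m) / (l - m), (1 - l * m) / (l - m), (l + m) / (l - m)]

/-! ### Hardy spaces -/

/-- The tube `τ^{a,b}` over a quadrant, for signs `a`, `b`. -/
def tube (a b : ℝ) : Set (ℂ × ℂ) := {p | 0 < a * p.1.im ∧ 0 < b * p.2.im}

/-- The Hardy space `H²(τ^{a,b})`, for signs `a`, `b`. -/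
structure MemHardyTube (a b : ℝ) (G : ℂ × ℂ → ℂ) : Prop where
  differentiableOn : DifferentiableOn ℂ G (tube a b)
  bounded : ∃ M : NNReal, ∀ s t : ℝ, 0 < s → 0 < t →
    ∫⁻ p : ℝ × ℝ, ‖G ((p.1 : ℂ) + (a * s : ℝ) * Complex.I,
      (p.2 : ℂ) + (b * t : ℝ) * Complex.I)‖ₑ ^ 2 ≤ M

/-- Holomorphy on a subset `T` of `ℂ³` that is open in the complex quadric: locally, `F` is the
restriction to `T` of a holomorphic function of three variables. -/
def HolomorphicOnQuadric (F : (Fin 3 → ℂ) → ℂ) (T : Set (Fin 3 → ℂ)) : Prop :=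
  ∀ z ∈ T, ∃ U : Set (Fin 3 → ℂ), IsOpen U ∧ z ∈ U ∧
    ∃ G : (Fin 3 → ℂ) → ℂ, DifferentiableOn ℂ G U ∧ EqOn F G (U ∩ T)

/-- `(λ - μ)⁻¹ F̂(λ, μ)`, where `F̂(λ, μ) = F(z(λ, μ))`. -/
def reduced (F : (Fin 3 → ℂ) → ℂ) (p : ℂ × ℂ) : ℂ := F (param p.1 p.2) / (p.1 - p.2)

/-- `(λ - μ)⁻¹ f̂(λ, μ)`, where `f̂(λ, μ) = f(x(λ, μ))`, for real `λ, μ`. -/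
def reducedReal (f : (Fin 3 → ℝ) → ℂ) (p : ℝ × ℝ) : ℂ :=
  f (param p.1 p.2) / ((p.1 - p.2 : ℝ) : ℂ)

/-- `f` is the boundary value on `X` of `F`, and `F` belongs to the Hardy space `H²(𝒯^δ)`
(`δ = ± 1`). The tuboid `𝒯^δ` corresponds to the tube `τ^{-δ,δ}`; as is usual in Hardy spaces
the boundary value is taken in the mean-square sense, for an arbitrary approach to `ℝ²` from
inside the tube. -/
structure MemHardy (δ : ℝ) (F : (Fin 3 → ℂ) → ℂ) (f : (Fin 3 → ℝ) → ℂ) : Prop where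
  holomorphic : HolomorphicOnQuadric F (tuboid δ)
  memLp : MemLp f 2 sigma
  hardy : MemHardyTube (-δ) δ (reduced F)
  boundary : Tendsto
    (fun η : ℝ × ℝ => eLpNorm (fun p : ℝ × ℝ =>
      reduced F ((p.1 : ℂ) + (-δ * η.1 : ℝ) * Complex.I,
        (p.2 : ℂ) + (δ * η.2 : ℝ) * Complex.I) - reducedReal f p) 2 volume)
    (𝓝[>] 0 ×ˢ 𝓝[>] 0) (𝓝 0)

/-- `F` belongs to `H²_reg(𝒯^δ)` and `f` is its boundary value: in addition,
`(λ - μ)⁻¹ F̂` (and its boundary value) is bounded by `cst (1 + |λ|)⁻¹ (1 + |μ|)⁻¹`. -/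
structure MemHardyReg (δ : ℝ) (F : (Fin 3 → ℂ) → ℂ) (f : (Fin 3 → ℝ) → ℂ) : Prop
    extends MemHardy δ F f where
  regular : ∃ c : ℝ,
    (∀ p ∈ tube (-δ) δ, ‖reduced F p‖ ≤ c * (1 + ‖p.1‖)⁻¹ * (1 + ‖p.2‖)⁻¹) ∧
    (∀ᵐ p : ℝ × ℝ, ‖reducedReal f p‖ ≤ c * (1 + |p.1|)⁻¹ * (1 + |p.2|)⁻¹)

/-! ### The Lorentzian Fourier-Helgason transform -/

/-- The boundary values `t_±^s` (`ε = ± 1`) on the real line of the principal branch of `t ↦ t^s`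
from the upper, resp. lower half-plane: `t_±^s = Y(t) |t|^s + e^{± iπs} Y(-t) |t|^s`. -/
def bvPow (ε t : ℝ) (s : ℂ) : ℂ :=
  if 0 < t then ((|t| : ℝ) : ℂ) ^ s
  else if t < 0 then Complex.exp ((ε * Real.pi : ℝ) * Complex.I * s) * ((|t| : ℝ) : ℂ) ^ s
  else 0

/-- The integrand `[x_±·ξ]^{-1/2-iν} f(x)` of the Fourier-Helgason transform. -/
def fhIntegrand (ε : ℝ) (f : (Fin 3 → ℝ) → ℂ) (ν : ℝ) (ξ x : Fin 3 → ℝ) : ℂ :=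
  bvPow ε (mink x ξ) (-1 / 2 - Complex.I * ν) * f x

/-- The Lorentzian Fourier-Helgason transform `f̃_{±,ν}(ξ)` (`ε = ± 1`). -/
def fh (ε : ℝ) (f : (Fin 3 → ℝ) → ℂ) (ν : ℝ) (ξ : Fin 3 → ℝ) : ℂ :=
  ∫ x, fhIntegrand ε f ν ξ x ∂sigma

/-! ### Integration over cycles of the cone -/

/-- The one-form `i_Ξ ω = (ξ₁ dξ₂ - ξ₂ dξ₁) / (2 ξ₀)`, contraction of the Euler vector field
`Ξ(ξ) = ξ` with the Leray form `ω = dξ₀∧dξ₁∧dξ₂ / d(ξ²) = dξ₁∧dξ₂ / (2 ξ₀)` of `C⁺`.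
On the circle `ξ(α) = (1, cos α, sin α)` it is `dα / 2`. -/
def coneForm (ξ : Fin 3 → ℝ) : (Fin 3 → ℝ) →L[ℝ] ℝ :=
  (1 / (2 * ξ 0)) • (ξ 1 • ContinuousLinearMap.proj (R := ℝ) (φ := fun _ : Fin 3 => ℝ) 2
    - ξ 2 • ContinuousLinearMap.proj (R := ℝ) (φ := fun _ : Fin 3 => ℝ) 1)

/-- The circle `γ₀`, run through by `α = 2πt - π`, `t ∈ [0, 1]`. -/
def baseCircle (t : ℝ) : Fin 3 → ℝ :=
  ![1, Real.cos (2 * Real.pi * t - Real.pi), Real.sin (2 * Real.pi * t - Real.pi)]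

/-- `γ` is a piecewise `C¹` loop on `C⁺` that is homotopic, through loops on `C⁺`, to `γ₀`. -/
structure IsCycle {p : Fin 3 → ℝ} (γ : Path p p) : Prop where
  piecewise_C1 : ∃ (n : ℕ) (t : ℕ → ℝ), StrictMono t ∧ t 0 = 0 ∧ t n = 1 ∧
    ∀ i < n, ContDiffOn ℝ 1 γ.extend (Icc (t i) (t (i + 1)))
  homotopic : ∃ H : C(unitInterval × unitInterval, Fin 3 → ℝ),
    (∀ q, H q ∈ futureCone) ∧ (∀ t, H (0, t) = γ t) ∧ (∀ t, H (1, t) = baseCircle t) ∧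
    (∀ s, H (s, 0) = H (s, 1))

/-- The one-form `[z·ξ]^{-1/2+iν} f̃_{±,ν}(ξ) i_Ξ ω(ξ)` whose integral over `γ` is the inner
integral of the inversion formula. -/
def inversionForm (ε : ℝ) (f : (Fin 3 → ℝ) → ℂ) (z : Fin 3 → ℂ) (ν : ℝ) (ξ : Fin 3 → ℝ) :
    (Fin 3 → ℝ) →L[ℝ] ℂ :=
  (coneForm ξ).smulRight (mink z (toC ξ) ^ (-1 / 2 + Complex.I * ν : ℂ) * fh ε f ν ξ)

/-- The weight `ν tanh(πν) / (e^{±πν} cosh(πν))`. -/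
def weight (ε ν : ℝ) : ℝ :=
  ν * Real.tanh (Real.pi * ν) / (Real.exp (ε * (Real.pi * ν)) * Real.cosh (Real.pi * ν))

end OneSheeted

end

/-!
Inversion of the Lorentzian Fourier–Helgason transform on the one-sheeted hyperboloid.

In the coordinates `(λ, μ)` the invariant measure is `dλ dμ / (λ - μ)²` (`sigma_eq_map`), so that with
`g = (λ - μ)⁻¹ f` the transform is `∫ [x·ξ]_±^{-1/2-iν} (λ - μ)⁻¹ g dλ dμ`. For
`ξ = ((a² + b²)/2, (a² - b²)/2, ab)` one has `[x·ξ] = (aλ - b)(aμ - b)/(λ - μ)`, and the integrand has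
singularities of order `1/2` only, on the lines `aλ = b`, `aμ = b`, `λ = μ`; it has an explicit
integrable majorant (`integrable_majorant`). The symmetry `z ↦ -z`, which exchanges `λ` and `μ`, reduces
the statement for `𝒯⁺` to that for `𝒯⁻`; what remains is about a function `G`, holomorphic for
`Im μ < 0 < Im λ`, and its boundary value `g` (`BoundaryPair`).

* On `𝒯⁻` the imaginary part of `[z·ξ]` is negative, so `t_-^s` is the boundary value of a function
  holomorphic on the tube of `G`. Cauchy's theorem in `λ` makes `f̃_{-,ν}` vanish
  (`BoundaryPair.integral_chartKernel_neg_one`).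

* For the inversion formula the real point of `f̃_{+,ν}` is moved to a point `z'` of `𝒯⁺`, by the
  complex rotation `tan φ ↦ tan (φ ∓ i artanh τ)` of `λ` and `μ`. All integrals over `ν`, `ξ` and the
  real points can then be exchanged, and the integral over the cycle is one over the base circle: its
  integrand is homogeneous of degree `-1`, and the angle increases by `2π` along every cycle
  (`IsCycle.curveIntegral_eq`).

* The integral over `ν` and `ξ` of the two plane waves is `integral_weight_angularKernel`. For `z` and
  `y = -z'` in `𝒯⁻`, the product `[z·ξ]^{-1/2+iν} [y·ξ]^{-1/2-iν} / cosh (πν)` is a Fourier transform in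
  `σ` of `1 / [(e^{-σ/2} y + e^{σ/2} z)·ξ]` (`fourier_inv_exp`), and the circle integral of `1 / [W·ξ]` is
  `2πi / √(-[W·W])` (`exists_integral_inv_mink`). Thus one has to integrate the Fourier transform of
  `(2 cosh σ - 2 [z·y])^{-1/2}` against `ν tanh (πν)`, which gives `1 / (1 - [z·y])`
  (`integral_tanh_mul_fourier`).

* The kernel `1 / (1 + [z·z'])` is a product of Cauchy kernels in `λ` and `μ`, and the Cauchy formula
  `BoundaryPair.cauchy` returns the value of `G` at a point that tends to `z` as `τ → 0⁺`
  (`BoundaryPair.tendsto_integral_regDen`). The bounds of the transforms do not depend on `τ`, so that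
  the limit can be taken under the integral over `ν` and the cycle (`BoundaryPair.inversion`).
-/

noncomputable section

namespace OneSheeted

open scoped FourierTransform

/-! ### Null sets of the plane and the coordinates `(λ, μ)` on the hyperboloid -/

/-- A property of pairs that fails, for each first coordinate, for at most one second coordinate
holds almost everywhere in the plane. -/
lemma ae_prod_of_subsingleton {P : ℝ × ℝ → Prop} (hm : MeasurableSet {p | P p})
    (h : ∀ x y z, ¬ P (x, y) → ¬ P (x, z) → y = z) : ∀ᵐ p : ℝ × ℝ, P p := by
  have : volume {p : ℝ × ℝ | P p}ᶜ = 0 := by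
    rw [Measure.volume_eq_prod, Measure.measure_prod_null hm.compl]
    refine Eventually.of_forall fun x => ?_
    refine Set.Subsingleton.measure_zero (fun y hy z hz => ?_) _
    exact h x y z hy hz
  exact this

lemma ae_fst_ne_snd : ∀ᵐ p : ℝ × ℝ, p.1 ≠ p.2 :=
  ae_prod_of_subsingleton (P := fun p => p.1 ≠ p.2)
    (measurableSet_eq_fun measurable_fst measurable_snd).compl
    (fun x y z h1 h2 => by simp only [not_not, ne_eq] at h1 h2; rw [← h1, ← h2])

lemma ae_one_add_mul_ne : ∀ᵐ p : ℝ × ℝ, 1 + p.1 * p.2 ≠ 0 :=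
  ae_prod_of_subsingleton (P := fun p => 1 + p.1 * p.2 ≠ 0)
    (measurableSet_eq_fun (by fun_prop) measurable_const).compl
    (fun x y z h1 h2 => by
      simp only [not_not, ne_eq] at h1 h2
      have hx : x ≠ 0 := by rintro rfl; simp at h1
      have : x * (y - z) = 0 := by linarith
      rcases mul_eq_zero.1 this with h | h
      · exact absurd h hx
      · linarith)

lemma param_zero {K : Type*} [Field K] (l m : K) : param l m 0 = (1 + l * m) / (l - m) := rfl
lemma param_one {K : Type*} [Field K] (l m : K) : param l m 1 = (1 - l * m) / (l - m) := rfl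
lemma param_two {K : Type*} [Field K] (l m : K) : param l m 2 = (l + m) / (l - m) := rfl

lemma measurable_param : Measurable fun p : ℝ × ℝ => param p.1 p.2 := by
  refine measurable_pi_iff.2 fun i => ?_
  fin_cases i
  · exact (measurable_const.add (measurable_fst.mul measurable_snd)).div
      (measurable_fst.sub measurable_snd)
  · exact (measurable_const.sub (measurable_fst.mul measurable_snd)).div
      (measurable_fst.sub measurable_snd)
  · exact (measurable_fst.add measurable_snd).div (measurable_fst.sub measurable_snd)

/-- The invariant measure of the hyperboloid in the coordinates `(λ, μ)`:
`dλ dμ / (λ - μ)²`. -/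
def chartMeasure : Measure (ℝ × ℝ) :=
  volume.withDensity fun p => ENNReal.ofReal (1 / (p.1 - p.2) ^ 2)

/-- The coordinates `(x₁, x₂)` of the point with parameters `(λ, μ)`. -/
def chartXY (p : ℝ × ℝ) : ℝ × ℝ := ((1 - p.1 * p.2) / (p.1 - p.2), (p.1 + p.2) / (p.1 - p.2))

/-- The part of the parameter plane where `δ x₀ > 0`. -/
def sheet (δ : ℝ) : Set (ℝ × ℝ) := {p | 0 < δ * ((1 + p.1 * p.2) / (p.1 - p.2))}

lemma measurableSet_sheet (δ : ℝ) : MeasurableSet (sheet δ) := by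
  unfold sheet
  exact measurableSet_lt measurable_const (measurable_const.mul
    ((measurable_const.add (measurable_fst.mul measurable_snd)).div
      (measurable_fst.sub measurable_snd)))

lemma sheet_ne {δ : ℝ} {p : ℝ × ℝ} (hp : p ∈ sheet δ) : p.1 - p.2 ≠ 0 := by
  intro h
  simp [sheet, h] at hp

lemma sqrt_chartXY {δ : ℝ} (hδ : δ = 1 ∨ δ = -1) {p : ℝ × ℝ} (hp : p ∈ sheet δ) :
    Real.sqrt ((chartXY p).1 ^ 2 + (chartXY p).2 ^ 2 - 1)
      = δ * ((1 + p.1 * p.2) / (p.1 - p.2)) := by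
  have hd := sheet_ne hp
  have h2 : δ ^ 2 = 1 := by rcases hδ with rfl | rfl <;> norm_num
  rw [← Real.sqrt_sq (le_of_lt hp), mul_pow, h2]
  congr 1
  simp only [chartXY]
  field_simp
  ring

/-- The derivative of `chartXY`. -/
def chartXYDeriv (p : ℝ × ℝ) : ℝ × ℝ →L[ℝ] ℝ × ℝ :=
  (Matrix.toLin (.finTwoProd ℝ) (.finTwoProd ℝ)
    !![(p.2 ^ 2 - 1) / (p.1 - p.2) ^ 2, (1 - p.1 ^ 2) / (p.1 - p.2) ^ 2;
      -2 * p.2 / (p.1 - p.2) ^ 2, 2 * p.1 / (p.1 - p.2) ^ 2]).toContinuousLinearMap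

lemma hasFDerivAt_chartXY {p : ℝ × ℝ} (hp : p.1 - p.2 ≠ 0) :
    HasFDerivAt chartXY (chartXYDeriv p) p := by
  unfold chartXYDeriv
  rw [Matrix.toLin_finTwoProd_toContinuousLinearMap]
  have hf : HasFDerivAt (fun q : ℝ × ℝ => q.1) (ContinuousLinearMap.fst ℝ ℝ ℝ) p := hasFDerivAt_fst
  have hs : HasFDerivAt (fun q : ℝ × ℝ => q.2) (ContinuousLinearMap.snd ℝ ℝ ℝ) p := hasFDerivAt_snd
  have hinv : HasFDerivAt (fun q : ℝ × ℝ => (q.1 - q.2)⁻¹)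
      ((-((p.1 - p.2) ^ 2)⁻¹) •
        (ContinuousLinearMap.fst ℝ ℝ ℝ - ContinuousLinearMap.snd ℝ ℝ ℝ)) p :=
    (hasDerivAt_inv hp).comp_hasFDerivAt p (hf.sub hs)
  have h1 := ((hf.mul hs).const_sub 1).mul hinv
  have h2 := (hf.add hs).mul hinv
  refine (h1.prodMk h2).congr_fderiv ?_
  ext <;> simp <;> field_simp <;> ring

lemma abs_det_chartXYDeriv {δ : ℝ} (hδ : δ = 1 ∨ δ = -1) {p : ℝ × ℝ} (hp : p ∈ sheet δ) :
    |(chartXYDeriv p).det| = 1 / (p.1 - p.2) ^ 2 * (2 * (δ * ((1 + p.1 * p.2) / (p.1 - p.2)))) := by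
  have hd := sheet_ne hp
  have hp' : 0 < δ * ((1 + p.1 * p.2) / (p.1 - p.2)) := hp
  have h1 : (chartXYDeriv p).det = -(δ * (1 / (p.1 - p.2) ^ 2 *
      (2 * (δ * ((1 + p.1 * p.2) / (p.1 - p.2)))))) := by
    have h2 : δ * δ = 1 := by rcases hδ with rfl | rfl <;> norm_num
    unfold chartXYDeriv
    simp only [LinearMap.det_toContinuousLinearMap, LinearMap.det_toLin, Matrix.det_fin_two_of]
    have : δ * (1 / (p.1 - p.2) ^ 2 * (2 * (δ * ((1 + p.1 * p.2) / (p.1 - p.2)))))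
      = (δ * δ) * (1 / (p.1 - p.2) ^ 2 * (2 * (((1 + p.1 * p.2) / (p.1 - p.2))))) := by ring
    rw [this, h2]
    field_simp
    ring
  rw [h1, abs_neg, abs_mul]
  have : |δ| = 1 := by rcases hδ with rfl | rfl <;> norm_num
  rw [this, one_mul, abs_of_pos]
  positivity

lemma injOn_chartXY {δ : ℝ} (hδ : δ = 1 ∨ δ = -1) : InjOn chartXY (sheet δ) := by
  intro p hp q hq h
  have hpd := sheet_ne hp
  have hqd := sheet_ne hq
  have h0 : (1 + p.1 * p.2) / (p.1 - p.2) = (1 + q.1 * q.2) / (q.1 - q.2) := by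
    have e1 := sqrt_chartXY hδ hp
    rw [h, sqrt_chartXY hδ hq] at e1
    rcases hδ with rfl | rfl <;> linarith
  have h1 : (1 - p.1 * p.2) / (p.1 - p.2) = (1 - q.1 * q.2) / (q.1 - q.2) := congrArg Prod.fst h
  have h2 : (p.1 + p.2) / (p.1 - p.2) = (q.1 + q.2) / (q.1 - q.2) := congrArg Prod.snd h
  have e0 : 2 / (p.1 - p.2) = 2 / (q.1 - q.2) := by
    have := congrArg₂ (· + ·) h0 h1
    simp only [← add_div] at this
    ring_nf at this ⊢
    linarith
  have e1 : p.1 - p.2 = q.1 - q.2 := by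
    field_simp at e0
    linarith
  rw [e1] at h2
  have e2 : p.1 + p.2 = q.1 + q.2 := by
    field_simp at h2
    linarith
  ext <;> linarith

lemma image_chartXY {δ : ℝ} (hδ : δ = 1 ∨ δ = -1) :
    chartXY '' (sheet δ) =ᵐ[volume] ({q | 1 < q.1 ^ 2 + q.2 ^ 2} : Set (ℝ × ℝ)) := by
  have hsub : chartXY '' (sheet δ) ⊆ ({q | 1 < q.1 ^ 2 + q.2 ^ 2} : Set (ℝ × ℝ)) := by
    rintro _ ⟨p, hp, rfl⟩
    have := sqrt_chartXY hδ hp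
    have hp' : 0 < δ * ((1 + p.1 * p.2) / (p.1 - p.2)) := hp
    rw [← this, Real.sqrt_pos] at hp'
    simp only [mem_ofPred_eq]
    linarith
  have hne : ∀ᵐ q : ℝ × ℝ, q.2 ^ 2 - 1 ≠ 0 := by
    have : ∀ c : ℝ, ∀ᵐ q : ℝ × ℝ, q.2 ≠ c := fun c =>
      ae_prod_of_subsingleton (P := fun p => p.2 ≠ c)
        (measurableSet_eq_fun measurable_snd measurable_const).compl
        (fun x y z h1 h2 => by simp only [not_not, ne_eq] at h1 h2; rw [h1, h2])
    filter_upwards [this 1, this (-1)] with q h1 h2 h3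
    have : (q.2 - 1) * (q.2 + 1) = 0 := by linarith
    rcases mul_eq_zero.1 this with h | h
    · exact h1 (by linarith)
    · exact h2 (by linarith)
  refine Filter.Eventually.set_eq ?_
  filter_upwards [hne] with q hq
  refine ⟨fun h => hsub h, fun h => ?_⟩
  change 1 < q.1 ^ 2 + q.2 ^ 2 at h
  set w := δ * Real.sqrt (q.1 ^ 2 + q.2 ^ 2 - 1) with hw
  have h2 : δ * δ = 1 := by rcases hδ with rfl | rfl <;> norm_num
  have hw2 : w ^ 2 = q.1 ^ 2 + q.2 ^ 2 - 1 := by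
    rw [hw, mul_pow, Real.sq_sqrt (by linarith), pow_two, h2, one_mul]
  have hwq : w + q.1 ≠ 0 := by
    intro h0
    apply hq
    have : w = -q.1 := by linarith
    rw [this] at hw2
    linarith
  have hx0 : (1 + (q.2 + 1) / (w + q.1) * ((q.2 - 1) / (w + q.1))) /
      ((q.2 + 1) / (w + q.1) - (q.2 - 1) / (w + q.1)) = w := by
    have : (q.2 + 1) / (w + q.1) - (q.2 - 1) / (w + q.1) = 2 / (w + q.1) := by
      field_simp; ring
    rw [this]
    field_simp
    linear_combination -hw2
  -- `λ = (x₂ + 1) / (x₀ + x₁)` and `μ = (x₂ - 1) / (x₀ + x₁)`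
  refine ⟨((q.2 + 1) / (w + q.1), (q.2 - 1) / (w + q.1)), ?_, ?_⟩
  · simp only [sheet, mem_ofPred_eq]
    rw [hx0, hw, ← mul_assoc, h2, one_mul, Real.sqrt_pos]
    linarith
  · have hd : (q.2 + 1) / (w + q.1) - (q.2 - 1) / (w + q.1) = 2 / (w + q.1) := by
      field_simp; ring
    simp only [chartXY]
    ext
    · simp only [hd]
      field_simp
      linear_combination hw2
    · simp only [hd]
      field_simp
      ring

/-- The change of variables from `(x₁, x₂)` to `(λ, μ)` on one sheet of the hyperboloid: the Jacobian
is `2 |x₀| / (λ - μ)²`. -/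
lemma lintegral_sheet {δ : ℝ} (hδ : δ = 1 ∨ δ = -1) (w : (Fin 3 → ℝ) → ENNReal) :
    ∫⁻ q in ({q | 1 < q.1 ^ 2 + q.2 ^ 2} : Set (ℝ × ℝ)),
      ENNReal.ofReal (1 / (2 * Real.sqrt (q.1 ^ 2 + q.2 ^ 2 - 1))) *
        w ![δ * Real.sqrt (q.1 ^ 2 + q.2 ^ 2 - 1), q.1, q.2]
    = ∫⁻ p in sheet δ, ENNReal.ofReal (1 / (p.1 - p.2) ^ 2) * w (param p.1 p.2) := by
  rw [← setLIntegral_congr (image_chartXY hδ),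
    lintegral_image_eq_lintegral_abs_det_fderiv_mul volume (measurableSet_sheet δ)
      (fun p hp => (hasFDerivAt_chartXY (sheet_ne hp)).hasFDerivWithinAt) (injOn_chartXY hδ)]
  refine setLIntegral_congr_fun (measurableSet_sheet δ) fun p hp => ?_
  have hp' : 0 < δ * ((1 + p.1 * p.2) / (p.1 - p.2)) := hp
  have h2 : δ * δ = 1 := by rcases hδ with rfl | rfl <;> norm_num
  simp only [sqrt_chartXY hδ hp, abs_det_chartXYDeriv hδ hp]
  rw [← mul_assoc, ← ENNReal.ofReal_mul (by positivity), ← mul_assoc δ δ, h2, one_mul, mul_assoc,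
    mul_one_div_cancel (by positivity), mul_one]
  rfl

/-- The invariant measure of the hyperboloid, read in the coordinates `(λ, μ)`. -/
theorem sigma_eq_map : sigma = chartMeasure.map (fun p => param p.1 p.2) := by
  ext s hs
  have hh : Measurable fun q : ℝ × ℝ => Real.sqrt (q.1 ^ 2 + q.2 ^ 2 - 1) := by fun_prop
  have hT : ∀ δ : ℝ, Measurable fun q : ℝ × ℝ =>
      (![δ * Real.sqrt (q.1 ^ 2 + q.2 ^ 2 - 1), q.1, q.2] : Fin 3 → ℝ) := by
    intro δ
    refine measurable_pi_iff.2 fun i => ?_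
    fin_cases i
    · exact hh.const_mul δ
    · exact measurable_fst
    · exact measurable_snd
  have hdens : Measurable fun q : ℝ × ℝ =>
      ENNReal.ofReal (1 / (2 * Real.sqrt (q.1 ^ 2 + q.2 ^ 2 - 1))) :=
    (measurable_const.div (hh.const_mul 2)).ennreal_ofReal
  have hdens' : Measurable fun p : ℝ × ℝ => ENNReal.ofReal (1 / (p.1 - p.2) ^ 2) :=
    (measurable_const.div ((measurable_fst.sub measurable_snd).pow_const 2)).ennreal_ofReal
  have hone : ∀ δ : ℝ, δ = 1 ∨ δ = -1 →
      (((volume.restrict ({q | 1 < q.1 ^ 2 + q.2 ^ 2} : Set (ℝ × ℝ))).withDensity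
        (fun q => ENNReal.ofReal (1 / (2 * Real.sqrt (q.1 ^ 2 + q.2 ^ 2 - 1))))).map
        (fun q => (![δ * Real.sqrt (q.1 ^ 2 + q.2 ^ 2 - 1), q.1, q.2] : Fin 3 → ℝ))) s
      = ∫⁻ p in sheet δ, ENNReal.ofReal (1 / (p.1 - p.2) ^ 2) *
          s.indicator 1 (param p.1 p.2) := by
    intro δ hδ
    rw [Measure.map_apply (hT δ) hs, withDensity_apply _ (hT δ hs), ← lintegral_sheet hδ,
      ← lintegral_indicator (hT δ hs)]
    refine lintegral_congr fun q => ?_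
    by_cases h : (![δ * Real.sqrt (q.1 ^ 2 + q.2 ^ 2 - 1), q.1, q.2] : Fin 3 → ℝ) ∈ s
    · rw [indicator_of_mem (by exact h), indicator_of_mem h]; simp
    · rw [indicator_of_notMem (by exact h), indicator_of_notMem h]; simp
  have h1 := hone 1 (Or.inl rfl)
  have h2 := hone (-1) (Or.inr rfl)
  simp only [one_mul, neg_mul] at h1 h2
  simp only [sigma, Measure.add_apply]
  rw [h1, h2, Measure.map_apply measurable_param hs, chartMeasure,
    withDensity_apply _ (measurable_param hs), ← lintegral_union (measurableSet_sheet _)]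
  · rw [← lintegral_indicator (measurable_param hs)]
    have hu : (sheet 1 ∪ sheet (-1) : Set (ℝ × ℝ)) =ᵐ[volume] univ := by
      refine Filter.Eventually.set_eq ?_
      filter_upwards [ae_fst_ne_snd, ae_one_add_mul_ne] with p hp hp'
      simp only [mem_univ, iff_true, mem_union, sheet, mem_ofPred_eq, one_mul]
      have : (1 + p.1 * p.2) / (p.1 - p.2) ≠ 0 := div_ne_zero hp' (sub_ne_zero.2 hp)
      rcases lt_or_gt_of_ne this with h | h
      · right; linarith
      · left; exact h
    rw [setLIntegral_congr hu, Measure.restrict_univ]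
    refine lintegral_congr fun q => ?_
    by_cases h : param q.1 q.2 ∈ s
    · rw [indicator_of_mem h, indicator_of_mem (by exact h)]; simp
    · rw [indicator_of_notMem h, indicator_of_notMem (by exact h)]; simp
  · rw [Set.disjoint_left]
    intro p hp hp'
    simp only [sheet, mem_ofPred_eq] at hp hp'
    linarith

/-! ### Cauchy's theorem and formula on horizontal lines -/

lemma integrable_one_add_abs_inv_sq : Integrable fun x : ℝ => ((1 + |x|)⁻¹) ^ 2 := by
  have h := integrable_one_add_norm (μ := (volume : Measure ℝ)) (E := ℝ) (r := 2) (by simp)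
  refine h.congr (Eventually.of_forall fun x => ?_)
  simp only [Real.norm_eq_abs]
  rw [Real.rpow_neg (by positivity), inv_pow]
  norm_cast

/-- Cauchy's theorem on a horizontal line, for functions that are holomorphic above it and decay
faster than `1 / |z|`. No integrability is asked for: the integral of a function that is not
integrable is zero by convention. -/
lemma integral_line_eq_zero {h : ℂ → ℂ} {a η C R₀ : ℝ} (haη : a < η)
    (hd : DifferentiableOn ℂ h {z | a < z.im})
    (hb : ∀ z : ℂ, η ≤ z.im → R₀ ≤ ‖z‖ → ‖h z‖ ≤ C * ‖z‖ ^ (-(3 / 2) : ℝ)) :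
    ∫ x : ℝ, h (x + (η : ℂ) * Complex.I) = 0 := by
  by_cases hint : Integrable fun x : ℝ => h (x + (η : ℂ) * Complex.I)
  swap
  · exact integral_undef hint
  have hlim := intervalIntegral_tendsto_integral hint tendsto_neg_atTop_atBot tendsto_id
  refine tendsto_nhds_unique hlim ?_
  -- The other three sides of the rectangle `[-R, R] × [η, R]` contribute `O(R^{-1/2})`.
  have hside : ∀ᶠ R : ℝ in atTop, ‖∫ x in (-R)..(id R), h (x + (η : ℂ) * Complex.I)‖
      ≤ 6 * |C| * R ^ (-(1 / 2) : ℝ) := by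
    filter_upwards [eventually_ge_atTop (max R₀ (|η| + 1))] with R hR
    have hR0 : R₀ ≤ R := le_trans (le_max_left _ _) hR
    have hRη : |η| + 1 ≤ R := le_trans (le_max_right _ _) hR
    have hRpos : 0 < R := by linarith [abs_nonneg η]
    have hηR : η ≤ R := by linarith [le_abs_self η]
    have hlen : |R - η| ≤ 2 * R := by
      rw [abs_of_nonneg (by linarith)]
      linarith [neg_abs_le η]
    have hbound : ∀ ζ : ℂ, η ≤ ζ.im → R ≤ ‖ζ‖ → ‖h ζ‖ ≤ |C| * R ^ (-(3 / 2) : ℝ) := by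
      intro ζ h1 h2
      refine (hb ζ h1 (hR0.trans h2)).trans ?_
      refine mul_le_mul (le_abs_self C) ?_ (by positivity) (abs_nonneg _)
      exact Real.rpow_le_rpow_of_nonpos hRpos h2 (by norm_num)
    have hrect := Complex.integral_boundary_rect_eq_zero_of_differentiableOn h ⟨-R, η⟩ ⟨R, R⟩ (by
      refine hd.mono fun ζ hζ => ?_
      rw [Complex.mem_reProdIm] at hζ
      have := hζ.2
      simp only [uIcc_of_le hηR] at this
      exact lt_of_lt_of_le haη this.1)
    simp only at hrect
    have htop : ‖∫ x : ℝ in (-R)..R, h (x + (R : ℂ) * Complex.I)‖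
        ≤ |C| * R ^ (-(3 / 2) : ℝ) * |R - -R| := by
      refine intervalIntegral.norm_integral_le_of_norm_le_const fun x _ => hbound _ ?_ ?_
      · simpa using hηR
      · have := Complex.abs_im_le_norm ((x : ℂ) + R * Complex.I)
        simpa [abs_of_pos hRpos] using this
    have hvert : ∀ r : ℝ, |r| = R → ‖∫ y : ℝ in η..R, h ((r : ℂ) + y * Complex.I)‖
        ≤ |C| * R ^ (-(3 / 2) : ℝ) * |R - η| := by
      intro r hr
      refine intervalIntegral.norm_integral_le_of_norm_le_const fun y hy => hbound _ ?_ ?_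
      · rw [uIoc_of_le hηR] at hy
        simpa using hy.1.le
      · have := Complex.abs_re_le_norm ((r : ℂ) + y * Complex.I)
        simpa [hr] using this
    have hr1 := hvert R (abs_of_pos hRpos)
    have hr2 := hvert (-R) (by rw [abs_neg, abs_of_pos hRpos])
    have hmul : R ^ (-(3 / 2) : ℝ) * R = R ^ (-(1 / 2) : ℝ) := by
      rw [← Real.rpow_add_one hRpos.ne']; norm_num
    have hR2 : |R - -R| = 2 * R := by rw [abs_of_pos (by linarith)]; ring
    have heq : ∫ x in (-R)..R, h (x + (η : ℂ) * Complex.I)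
        = (∫ x : ℝ in (-R)..R, h (x + (R : ℂ) * Complex.I))
          - Complex.I • (∫ y : ℝ in η..R, h ((R : ℝ) + y * Complex.I))
          + Complex.I • (∫ y : ℝ in η..R, h (((-R : ℝ) : ℂ) + y * Complex.I)) := by
      linear_combination hrect
    rw [id, heq]
    refine (norm_add_le _ _).trans ((add_le_add_left (norm_sub_le _ _) _).trans ?_)
    rw [norm_smul, norm_smul, Complex.norm_I, one_mul, one_mul]
    have hK : 0 ≤ |C| * R ^ (-(3 / 2) : ℝ) := by positivity
    rw [hR2] at htop
    have hl := mul_le_mul_of_nonneg_left hlen hK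
    have : |C| * R ^ (-(3 / 2) : ℝ) * (2 * R) = 2 * |C| * R ^ (-(1 / 2) : ℝ) := by
      rw [← hmul]; ring
    rw [this] at hl htop
    linarith
  refine squeeze_zero_norm' hside ?_
  have := (tendsto_rpow_neg_atTop (show (0 : ℝ) < 1 / 2 by norm_num)).const_mul (6 * |C|)
  simpa using this

lemma integral_inv_sq_add_sq (u : ℝ) {v : ℝ} (hv : 0 < v) :
    ∫ x : ℝ, ((x - u) ^ 2 + v ^ 2)⁻¹ = Real.pi / v := by
  rw [integral_sub_right_eq_self (fun x : ℝ => (x ^ 2 + v ^ 2)⁻¹) u]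
  have h := Measure.integral_comp_mul_left (fun x : ℝ => (1 + x ^ 2)⁻¹) v⁻¹
  rw [integral_univ_inv_one_add_sq] at h
  have h2 : ∀ x : ℝ, (x ^ 2 + v ^ 2)⁻¹ = (v ^ 2)⁻¹ * (1 + (v⁻¹ * x) ^ 2)⁻¹ := by
    intro x; field_simp; ring
  simp_rw [h2]
  rw [integral_const_mul, h, inv_inv, abs_of_pos hv, smul_eq_mul]
  field_simp

/-- A point off a horizontal strip stays away from its lines, proportionally to `1 + |x|`. -/
lemma exists_lower_bound_line (w : ℂ) {v : ℝ} (hv : 0 < v) :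
    ∃ κ > 0, ∀ x y : ℝ, v ≤ |y - w.im| → κ * (1 + |x|) ≤ ‖(x : ℂ) + y * Complex.I - w‖ := by
  refine ⟨((1 + |w.re|) / v + 1)⁻¹, by positivity, fun x y hy => ?_⟩
  have h1 := Complex.abs_re_le_norm ((x : ℂ) + y * Complex.I - w)
  have h2 := Complex.abs_im_le_norm ((x : ℂ) + y * Complex.I - w)
  simp only [Complex.sub_re, Complex.add_re, Complex.ofReal_re, Complex.mul_re, Complex.I_re,
    mul_zero, Complex.ofReal_im, Complex.I_im, mul_one, sub_self, add_zero, Complex.sub_im,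
    Complex.add_im, Complex.mul_im, zero_add] at h1 h2
  set N := ‖(x : ℂ) + y * Complex.I - w‖
  rw [inv_mul_le_iff₀ (by positivity)]
  have h3 : |x| ≤ |w.re| + |x - w.re| := by
    calc |x| = |w.re + (x - w.re)| := by ring_nf
      _ ≤ _ := abs_add_le _ _
  have h4 : 1 + |w.re| ≤ (1 + |w.re|) / v * N := by
    rw [div_mul_eq_mul_div, le_div_iff₀ hv]
    exact mul_le_mul_of_nonneg_left (hy.trans h2) (by positivity)
  linarith

/-- Cauchy's formula on a horizontal line of the upper half-plane. -/
lemma integral_line_cauchy {h : ℂ → ℂ} {η C : ℝ} {w : ℂ} (hη : 0 < η) (hw : η < w.im)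
    (hd : DifferentiableOn ℂ h {z | 0 < z.im})
    (hb : ∀ z : ℂ, 0 < z.im → ‖h z‖ ≤ C * (1 + ‖z‖)⁻¹) :
    ∫ x : ℝ, h (x + (η : ℂ) * Complex.I) / (x + (η : ℂ) * Complex.I - w)
      = 2 * Real.pi * Complex.I * h w := by
  -- The reflection of `w` in the line; subtracting a multiple of `1 / (z - c)` from `h` makes the
  -- quotient by `z - w` holomorphic, and keeps its decay of order `|z|⁻²`.
  set c : ℂ := ⟨w.re, 2 * η - w.im⟩ with hc
  set v : ℝ := w.im - η with hv
  have hvpos : 0 < v := by simp only [hv]; linarith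
  have hwc : w - c = 2 * v * Complex.I := by
    apply Complex.ext <;> simp [hc, hv]; ring
  set H : ℂ → ℂ := fun z => h z - h w * (w - c) / (z - c) with hH
  have hw0 : 0 < w.im := hη.trans hw
  set a : ℝ := max 0 (2 * η - w.im) with ha
  have haη : a < η := max_lt hη (by linarith)
  have hopen : IsOpen {z : ℂ | a < z.im} := isOpen_lt continuous_const Complex.continuous_im
  have hne : ∀ z : ℂ, a < z.im → z - c ≠ 0 := by
    intro z hz h0
    have : z = c := sub_eq_zero.1 h0
    rw [this] at hz
    exact absurd (le_max_right 0 (2 * η - w.im)) (not_le.2 hz)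
  have hwc0 : w - c ≠ 0 := hne w (haη.trans hw)
  have hHw : H w = 0 := by
    simp only [hH]
    rw [mul_div_assoc, div_self hwc0, mul_one, sub_self]
  have hHd : DifferentiableOn ℂ H {z | a < z.im} := by
    refine (hd.mono fun z hz =>
      lt_of_le_of_lt (b := a) (le_max_left _ _) hz).sub ?_
    exact (differentiableOn_const _).div (differentiableOn_id.sub_const c) fun z hz => hne z hz
  have hφd : DifferentiableOn ℂ (dslope H w) {z | a < z.im} :=
    (Complex.differentiableOn_dslope (hopen.mem_nhds (haη.trans hw))).2 hHd
  have hφ : ∀ z, z ≠ w → dslope H w z = h z / (z - w) - h w * (w - c) / ((z - c) * (z - w)) := by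
    intro z hz
    rw [dslope_of_ne _ hz, slope_def_field, hHw]
    simp only [hH, sub_zero, sub_div, div_div]
  have hzero : ∫ x : ℝ, dslope H w (x + (η : ℂ) * Complex.I) = 0 := by
    refine integral_line_eq_zero (C := 2 * |C| + 4 * ‖h w * (w - c)‖)
      (R₀ := 2 * (‖w‖ + ‖c‖) + 1) haη hφd fun z hz hR => ?_
    have hzpos : 0 < z.im := hη.trans_le hz
    have hz1 : 1 ≤ ‖z‖ := by linarith [norm_nonneg w, norm_nonneg c]
    have hz0 : 0 < ‖z‖ := by linarith
    have e1 : ‖z‖ / 2 ≤ ‖z - w‖ := by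
      linarith [norm_sub_norm_le z w, norm_nonneg w, norm_nonneg c]
    have e2 : ‖z‖ / 2 ≤ ‖z - c‖ := by
      linarith [norm_sub_norm_le z c, norm_nonneg w, norm_nonneg c]
    have hzw : z ≠ w := by
      rintro rfl
      rw [sub_self, norm_zero] at e1
      linarith
    rw [hφ z hzw]
    have hsq : ‖z‖ ^ (-2 : ℝ) ≤ ‖z‖ ^ (-(3 / 2) : ℝ) :=
      Real.rpow_le_rpow_of_exponent_le hz1 (by norm_num)
    have hsq' : ‖z‖ ^ (-2 : ℝ) = (‖z‖ * ‖z‖)⁻¹ := by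
      rw [Real.rpow_neg hz0.le, ← pow_two]; norm_cast
    have b1 : ‖h z / (z - w)‖ ≤ 2 * |C| * (‖z‖ * ‖z‖)⁻¹ := by
      rw [norm_div, div_le_iff₀ (by linarith)]
      have h1 : ‖h z‖ ≤ |C| * ‖z‖⁻¹ := by
        refine (hb z hzpos).trans (mul_le_mul (le_abs_self C) ?_ (by positivity) (abs_nonneg _))
        exact inv_anti₀ hz0 (by linarith)
      calc ‖h z‖ ≤ |C| * ‖z‖⁻¹ := h1
        _ = 2 * |C| * (‖z‖ * ‖z‖)⁻¹ * (‖z‖ / 2) := by field_simp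
        _ ≤ _ := mul_le_mul_of_nonneg_left e1 (by positivity)
    have b2 : ‖h w * (w - c) / ((z - c) * (z - w))‖
        ≤ 4 * ‖h w * (w - c)‖ * (‖z‖ * ‖z‖)⁻¹ := by
      rw [norm_div, norm_mul (z - c), div_le_iff₀ (mul_pos (by linarith) (by linarith))]
      calc ‖h w * (w - c)‖
          = 4 * ‖h w * (w - c)‖ * (‖z‖ * ‖z‖)⁻¹ * (‖z‖ / 2 * (‖z‖ / 2)) := by field_simp; norm_num
        _ ≤ _ := mul_le_mul_of_nonneg_left (mul_le_mul e2 e1 (by positivity) (by positivity))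
            (by positivity)
    calc _ ≤ _ := norm_sub_le _ _
      _ ≤ (2 * |C| + 4 * ‖h w * (w - c)‖) * ‖z‖ ^ (-2 : ℝ) := by rw [hsq']; linarith
      _ ≤ _ := mul_le_mul_of_nonneg_left hsq (by positivity)
  have hline : ∀ x : ℝ, (x : ℂ) + (η : ℂ) * Complex.I ≠ w := by
    intro x hx
    have := congrArg Complex.im hx
    simp at this
    linarith
  have hprod : ∀ x : ℝ, ((x : ℂ) + (η : ℂ) * Complex.I - c) * (x + (η : ℂ) * Complex.I - w)
      = (((x - w.re) ^ 2 + v ^ 2 : ℝ) : ℂ) := by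
    intro x
    apply Complex.ext
    · rw [Complex.ofReal_re]; simp [hc, hv]; ring
    · rw [Complex.ofReal_im]; simp [hc]; ring
  have hq : ∀ x : ℝ, dslope H w (x + (η : ℂ) * Complex.I)
      = h (x + (η : ℂ) * Complex.I) / (x + (η : ℂ) * Complex.I - w)
        - h w * (w - c) * ((((x - w.re) ^ 2 + v ^ 2)⁻¹ : ℝ) : ℂ) := by
    intro x
    rw [hφ _ (hline x), hprod, Complex.ofReal_inv, div_eq_mul_inv (h w * (w - c))]
  have hcont : Continuous fun x : ℝ => h (x + (η : ℂ) * Complex.I) := by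
    have hinc : ∀ x : ℝ, ((x : ℂ) + (η : ℂ) * Complex.I) ∈ {z : ℂ | 0 < z.im} := fun x => by
      simpa using hη
    exact hd.continuousOn.comp_continuous (by fun_prop) hinc
  have hi1 : Integrable fun x : ℝ =>
      h (x + (η : ℂ) * Complex.I) / (x + (η : ℂ) * Complex.I - w) := by
    obtain ⟨κ, hκ, hκb⟩ := exists_lower_bound_line w hvpos
    refine (integrable_one_add_abs_inv_sq.const_mul (|C| * κ⁻¹)).mono' ?_
      (Eventually.of_forall fun x => ?_)
    · refine (hcont.div (by fun_prop) fun x => ?_).aestronglyMeasurable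
      exact sub_ne_zero.2 (hline x)
    · have hk := hκb x η (by rw [abs_sub_comm, ← hv, abs_of_pos hvpos])
      have hx : |x| ≤ ‖(x : ℂ) + (η : ℂ) * Complex.I‖ := by
        simpa using Complex.abs_re_le_norm ((x : ℂ) + (η : ℂ) * Complex.I)
      have h1 : ‖h (x + (η : ℂ) * Complex.I)‖ ≤ |C| * (1 + |x|)⁻¹ := by
        refine (hb _ (by simpa using hη)).trans
          (mul_le_mul (le_abs_self C) ?_ (by positivity) (abs_nonneg _))
        exact inv_anti₀ (by positivity) (by linarith)
      rw [norm_div, div_le_iff₀ (lt_of_lt_of_le (by positivity) hk)]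
      calc _ ≤ |C| * (1 + |x|)⁻¹ := h1
        _ = |C| * κ⁻¹ * ((1 + |x|)⁻¹) ^ 2 * (κ * (1 + |x|)) := by field_simp
        _ ≤ _ := mul_le_mul_of_nonneg_left hk (by positivity)
  have hi2 : Integrable fun x : ℝ => (((x - w.re) ^ 2 + v ^ 2)⁻¹ : ℝ) := by
    by_contra hcon
    have h1 := integral_inv_sq_add_sq w.re hvpos
    rw [integral_undef hcon] at h1
    have := div_pos Real.pi_pos hvpos
    linarith
  have hi3 : Integrable fun x : ℝ =>
      h w * (w - c) * ((((x - w.re) ^ 2 + v ^ 2)⁻¹ : ℝ) : ℂ) := hi2.ofReal.const_mul _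
  simp_rw [hq] at hzero
  rw [integral_sub hi1 hi3, sub_eq_zero, integral_const_mul,
    integral_complex_ofReal, integral_inv_sq_add_sq w.re hvpos] at hzero
  rw [hzero, hwc]
  have : (v : ℂ) ≠ 0 := by exact_mod_cast hvpos.ne'
  push_cast
  field_simp

/-- Cauchy's formula on a horizontal line of the lower half-plane. -/
lemma integral_line_cauchy_lower {h : ℂ → ℂ} {η C : ℝ} {w : ℂ} (hη : 0 < η) (hw : w.im < -η)
    (hd : DifferentiableOn ℂ h {z | z.im < 0})
    (hb : ∀ z : ℂ, z.im < 0 → ‖h z‖ ≤ C * (1 + ‖z‖)⁻¹) :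
    ∫ x : ℝ, h (x - (η : ℂ) * Complex.I) / (x - (η : ℂ) * Complex.I - w)
      = -(2 * Real.pi * Complex.I * h w) := by
  have key := integral_line_cauchy (h := fun z => h (-z)) (C := C) (w := -w) hη
    (by simp; linarith) (hd.comp differentiableOn_id.neg fun z hz => by
      simpa using hz) (fun z hz => by simpa using hb (-z) (by simpa using hz))
  simp only [neg_neg] at key
  rw [← key, ← integral_neg_eq_self, ← integral_neg]
  refine integral_congr_ae (Eventually.of_forall fun x => ?_)
  simp only [Complex.ofReal_neg]
  rw [← div_neg]
  congr 1
  · congr 1; ring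
  · ring

/-! ### An integrable majorant of the Fourier–Helgason kernel -/

/-- The one-variable building block `|a λ - b|^{-3/4} (1 + λ²)^{-5/8}`. With `λ = tan φ` and
`(a, b) = r (cos θ, sin θ)` the measure
`coneFactor a b λ dλ` is `r^{-3/4} |sin (φ - θ)|^{-3/4} dφ`. -/
def coneFactor (a b x : ℝ) : ℝ := |a * x - b| ^ (-(3 / 4) : ℝ) * (1 + x ^ 2) ^ (-(5 / 8) : ℝ)

lemma coneFactor_nonneg (a b x : ℝ) : 0 ≤ coneFactor a b x := by unfold coneFactor; positivity

@[fun_prop]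
lemma measurable_coneFactor (a b : ℝ) : Measurable (coneFactor a b) := by
  unfold coneFactor; fun_prop

/-- A bound uniform in `s`: where `|x - s| ≤ 1` the second factor is dropped, elsewhere the first. -/
lemma exists_lintegral_coneFactor_one_le :
    ∃ C : ENNReal, C ≠ ⊤ ∧ ∀ s : ℝ, ∫⁻ x, ENNReal.ofReal (coneFactor 1 s x) ≤ C := by
  set u : ℝ → ENNReal := fun x =>
    (Icc (-1 : ℝ) 1).indicator (fun x => ENNReal.ofReal (|x| ^ (-(3 / 4) : ℝ))) x with hu
  refine ⟨(∫⁻ x, u x) + ∫⁻ x : ℝ, ENNReal.ofReal ((1 + x ^ 2) ^ (-(5 / 8) : ℝ)), ?_, fun s => ?_⟩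
  · refine ENNReal.add_ne_top.2 ⟨?_, ?_⟩
    · have h1 : IntervalIntegrable (fun x : ℝ => x ^ (-(3 / 4) : ℝ)) volume 0 1 :=
        intervalIntegral.intervalIntegrable_rpow' (by norm_num)
      have h2 : IntervalIntegrable (fun x : ℝ => |x| ^ (-(3 / 4) : ℝ)) volume 0 1 := by
        refine h1.congr_ae ?_
        refine (ae_restrict_iff' measurableSet_uIoc).2 (Eventually.of_forall fun x hx => ?_)
        rw [uIoc_of_le zero_le_one] at hx
        simp only [abs_of_pos hx.1]
      have h3 : IntervalIntegrable (fun x : ℝ => |x| ^ (-(3 / 4) : ℝ)) volume (-1) 0 := by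
        have := (IntervalIntegrable.iff_comp_neg (f := fun x : ℝ => |x| ^ (-(3 / 4) : ℝ))
          (a := 0) (b := 1)).1 h2
        simpa using this.symm
      have h4 := (h3.trans h2)
      rw [intervalIntegrable_iff_integrableOn_Icc_of_le (by norm_num)] at h4
      rw [hu, lintegral_indicator measurableSet_Icc]
      exact h4.lintegral_lt_top.ne
    · have h2 := (integrable_rpow_neg_one_add_norm_sq (μ := (volume : Measure ℝ)) (E := ℝ)
        (r := 5 / 4) (by norm_num))
      have h3 : Integrable fun x : ℝ => (1 + x ^ 2) ^ (-(5 / 8) : ℝ) := by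
        refine h2.congr (Eventually.of_forall fun x => ?_)
        simp only [Real.norm_eq_abs, sq_abs]
        norm_num
      exact h3.lintegral_lt_top.ne
  · have hum : Measurable u := by
      refine Measurable.indicator ?_ measurableSet_Icc
      fun_prop
    have hshift : ∫⁻ x, u x = ∫⁻ x, u (x - s) := (lintegral_sub_right_eq_self u s).symm
    rw [hshift, ← lintegral_add_left (by fun_prop)]
    refine lintegral_mono fun x => ?_
    simp only [coneFactor, one_mul, hu]
    by_cases h : x - s ∈ Icc (-1 : ℝ) 1
    · rw [indicator_of_mem h]
      refine le_add_right (ENNReal.ofReal_le_ofReal ?_)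
      refine mul_le_of_le_one_right (by positivity) ?_
      exact Real.rpow_le_one_of_one_le_of_nonpos (by nlinarith [sq_nonneg x]) (by norm_num)
    · refine le_add_left (ENNReal.ofReal_le_ofReal ?_)
      refine mul_le_of_le_one_left (by positivity) ?_
      refine Real.rpow_le_one_of_one_le_of_nonpos ?_ (by norm_num)
      by_contra hlt
      push Not at hlt
      exact h (by rw [mem_Icc]; exact abs_le.1 hlt.le)

lemma coneFactor_smul (a b x r : ℝ) :
    coneFactor (r * a) (r * b) x = |r| ^ (-(3 / 4) : ℝ) * coneFactor a b x := by
  unfold coneFactor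
  rw [show r * a * x - r * b = r * (a * x - b) by ring, abs_mul,
    Real.mul_rpow (abs_nonneg _) (abs_nonneg _), mul_assoc]

/-- Inversion `x ↦ 1 / x` exchanges the roles of `a` and `b`. -/
lemma lintegral_coneFactor_comm (a b : ℝ) :
    ∫⁻ x, ENNReal.ofReal (coneFactor a b x) = ∫⁻ x, ENNReal.ofReal (coneFactor b a x) := by
  have hs : MeasurableSet ({0}ᶜ : Set ℝ) := (measurableSet_singleton 0).compl
  have himg : (fun x : ℝ => x⁻¹) '' ({0}ᶜ : Set ℝ) = {0}ᶜ := by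
    ext x
    constructor
    · rintro ⟨y, hy, rfl⟩; simpa using hy
    · intro hx; exact ⟨x⁻¹, by simpa using hx, inv_inv x⟩
  have hae : ({0}ᶜ : Set ℝ) =ᵐ[volume] univ := by
    rw [ae_eq_univ, compl_compl]; simp
  have h := lintegral_image_eq_lintegral_abs_deriv_mul (f := fun x : ℝ => x⁻¹)
    (f' := fun x => -(x ^ 2)⁻¹) hs
    (fun x hx => (hasDerivAt_inv hx).hasDerivWithinAt)
    (inv_injective.injOn) (fun x => ENNReal.ofReal (coneFactor a b x))
  rw [himg, setLIntegral_congr hae, Measure.restrict_univ] at h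
  have h' : ∫⁻ x, ENNReal.ofReal (coneFactor b a x)
      = ∫⁻ x in ({0}ᶜ : Set ℝ), ENNReal.ofReal (coneFactor b a x) := by
    rw [setLIntegral_congr hae, Measure.restrict_univ]
  rw [h, h']
  refine setLIntegral_congr_fun hs fun x hx => ?_
  have hx0 : x ≠ 0 := hx
  have hxa : 0 < |x| := abs_pos.2 hx0
  rw [← ENNReal.ofReal_mul (abs_nonneg _)]
  congr 1
  unfold coneFactor
  have e1 : |a * x⁻¹ - b| = |b * x - a| / |x| := by
    rw [← abs_div, abs_sub_comm (a * x⁻¹)]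
    congr 1
    field_simp
  have e2 : 1 + x⁻¹ ^ 2 = (1 + x ^ 2) / |x| ^ 2 := by
    rw [sq_abs]; field_simp; ring
  have e3 : |-(x ^ 2)⁻¹| = |x| ^ (-2 : ℝ) := by
    rw [abs_neg, abs_inv, abs_pow, Real.rpow_neg hxa.le]; norm_cast
  rw [e1, e2, e3, Real.div_rpow (abs_nonneg _) hxa.le, Real.div_rpow (by positivity) (by positivity),
    ← Real.rpow_natCast |x|, ← Real.rpow_mul hxa.le]
  have e4 : |x| ^ (-2 : ℝ) * ((|x| ^ (-(3 / 4) : ℝ))⁻¹ *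
      (|x| ^ (((2 : ℕ) : ℝ) * -(5 / 8)))⁻¹) = 1 := by
    rw [← Real.rpow_neg hxa.le, ← Real.rpow_neg hxa.le, ← Real.rpow_add hxa, ← Real.rpow_add hxa]
    norm_num
  linear_combination (|b * x - a| ^ (-(3 / 4) : ℝ) * (1 + x ^ 2) ^ (-(5 / 8) : ℝ)) * e4

/-- By homogeneity and inversion the case of a general `(a, b)` reduces to `a = 1`. -/
lemma exists_lintegral_coneFactor_le :
    ∃ C : ENNReal, C ≠ ⊤ ∧ ∀ a b : ℝ, 0 < a ^ 2 + b ^ 2 →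
      ∫⁻ x, ENNReal.ofReal (coneFactor a b x)
        ≤ C * ENNReal.ofReal ((a ^ 2 + b ^ 2) ^ (-(3 / 8) : ℝ)) := by
  obtain ⟨C, hC, hb⟩ := exists_lintegral_coneFactor_one_le
  refine ⟨C * ENNReal.ofReal (2 ^ (3 / 8 : ℝ)), ENNReal.mul_ne_top hC ENNReal.ofReal_ne_top, ?_⟩
  have main : ∀ a b : ℝ, b ^ 2 ≤ a ^ 2 → 0 < a ^ 2 + b ^ 2 →
      ∫⁻ x, ENNReal.ofReal (coneFactor a b x)
        ≤ C * ENNReal.ofReal (2 ^ (3 / 8 : ℝ)) *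
          ENNReal.ofReal ((a ^ 2 + b ^ 2) ^ (-(3 / 8) : ℝ)) := by
    intro a b hab hpos
    have ha : a ≠ 0 := by rintro rfl; nlinarith
    have hpa : 0 < a ^ 2 := by positivity
    have h1 : ∀ x, coneFactor a b x = |a| ^ (-(3 / 4) : ℝ) * coneFactor 1 (b / a) x := by
      intro x
      rw [← coneFactor_smul, mul_one, mul_div_cancel₀ _ ha]
    simp_rw [h1, ENNReal.ofReal_mul (show 0 ≤ |a| ^ (-(3 / 4) : ℝ) by positivity)]
    rw [lintegral_const_mul _ (by fun_prop), mul_comm, mul_assoc C]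
    refine mul_le_mul' (hb _) ?_
    rw [← ENNReal.ofReal_mul (by positivity)]
    refine ENNReal.ofReal_le_ofReal ?_
    have h2 : |a| ^ (-(3 / 4) : ℝ) = (a ^ 2) ^ (-(3 / 8) : ℝ) := by
      rw [← sq_abs, ← Real.rpow_natCast, ← Real.rpow_mul (abs_nonneg a)]; norm_num
    have h3 : (2 : ℝ) ^ (3 / 8 : ℝ) = ((2 : ℝ)⁻¹) ^ (-(3 / 8) : ℝ) := by
      rw [Real.inv_rpow (by norm_num), Real.rpow_neg (by norm_num), inv_inv]
    rw [h2, h3, ← Real.mul_rpow (by norm_num) (by positivity)]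
    exact Real.rpow_le_rpow_of_nonpos (by positivity) (by linarith) (by norm_num)
  intro a b hpos
  rcases le_total (b ^ 2) (a ^ 2) with h | h
  · exact main a b h hpos
  · rw [lintegral_coneFactor_comm, add_comm (a ^ 2)]
    exact main b a h (by linarith)

/-- The majorant of the Fourier–Helgason kernel against a function of `H²_reg`, when
`ξ = ((a² + b²)/2, (a² - b²)/2, ab)`. -/
def majorant (a b : ℝ) (p : ℝ × ℝ) : ℝ :=
  |a * p.1 - b| ^ (-(1 / 2) : ℝ) * |a * p.2 - b| ^ (-(1 / 2) : ℝ) *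
    |p.1 - p.2| ^ (-(1 / 2) : ℝ) * ((1 + |p.1|)⁻¹ * (1 + |p.2|)⁻¹)

lemma majorant_nonneg (a b : ℝ) (p : ℝ × ℝ) : 0 ≤ majorant a b p := by
  unfold majorant; positivity

@[fun_prop]
lemma measurable_majorant (a b : ℝ) : Measurable (majorant a b) := by
  unfold majorant; fun_prop

lemma inv_one_add_abs_le (x : ℝ) : (1 + |x|)⁻¹ ≤ (1 + x ^ 2) ^ (-(1 / 2) : ℝ) := by
  rw [Real.rpow_neg (by positivity), ← Real.sqrt_eq_rpow]
  refine inv_anti₀ (Real.sqrt_pos.2 (by positivity)) ?_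
  rw [Real.sqrt_le_left (by positivity)]
  nlinarith [abs_nonneg x, sq_abs x]

/-- The three singular factors are separated by the inequality `u v w ≤ u³ + v³ + w³`. -/
lemma majorant_le (a b : ℝ) (p : ℝ × ℝ) :
    majorant a b p ≤ coneFactor a b p.1 * coneFactor a b p.2
      + coneFactor a b p.1 * (1 + p.1 ^ 2) ^ (3 / 8 : ℝ) * coneFactor 1 p.1 p.2
      + coneFactor a b p.2 * (1 + p.2 ^ 2) ^ (3 / 8 : ℝ) * coneFactor 1 p.2 p.1 := by
  obtain ⟨x, y⟩ := p
  simp only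
  set s : ℝ := (1 + x ^ 2) ^ (1 / 8 : ℝ) with hs
  set t : ℝ := (1 + y ^ 2) ^ (1 / 8 : ℝ) with ht
  set A : ℝ := |a * x - b| ^ (-(1 / 4) : ℝ) with hA
  set B : ℝ := |a * y - b| ^ (-(1 / 4) : ℝ) with hB
  set D : ℝ := |x - y| ^ (-(1 / 4) : ℝ) with hD
  have hs0 : 0 < s := by positivity
  have ht0 : 0 < t := by positivity
  have hpow : ∀ (r : ℝ), 0 ≤ r → ∀ (e : ℝ) (n : ℕ), r ^ (e * n) = (r ^ e) ^ n := fun r hr e n => by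
    rw [Real.rpow_mul hr, Real.rpow_natCast]
  have hneg : ∀ (r : ℝ), 0 ≤ r → ∀ (n : ℕ), (1 + r) ^ (-((1 / 8) * n) : ℝ)
      = (((1 + r) ^ (1 / 8 : ℝ)) ^ n)⁻¹ := fun r hr n => by
    rw [Real.rpow_neg (by positivity), hpow _ (by positivity)]
  have c1 : ∀ r : ℝ, |r| ^ (-(3 / 4) : ℝ) = (|r| ^ (-(1 / 4) : ℝ)) ^ 3 := fun r => by
    rw [← hpow _ (abs_nonneg _)]; norm_num
  have c2 : ∀ r : ℝ, |r| ^ (-(1 / 2) : ℝ) = (|r| ^ (-(1 / 4) : ℝ)) ^ 2 := fun r => by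
    rw [← hpow _ (abs_nonneg _)]; norm_num
  have c3 : ∀ r : ℝ, (1 + r ^ 2) ^ (-(5 / 8) : ℝ) = (((1 + r ^ 2) ^ (1 / 8 : ℝ)) ^ 5)⁻¹ := by
    intro r; rw [← hneg _ (by positivity)]; norm_num
  have c4 : ∀ r : ℝ, (1 + r ^ 2) ^ (3 / 8 : ℝ) = ((1 + r ^ 2) ^ (1 / 8 : ℝ)) ^ 3 := by
    intro r; rw [← hpow _ (by positivity)]; norm_num
  have c5 : ∀ r : ℝ, (1 + r ^ 2) ^ (-(1 / 2) : ℝ) = (((1 + r ^ 2) ^ (1 / 8 : ℝ)) ^ 4)⁻¹ := by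
    intro r; rw [← hneg _ (by positivity)]; norm_num
  have hle : majorant a b (x, y) ≤ A ^ 2 * B ^ 2 * D ^ 2 * ((s ^ 4)⁻¹ * (t ^ 4)⁻¹) := by
    simp only [majorant, c2]
    refine mul_le_mul_of_nonneg_left ?_ (by positivity)
    have h1 := inv_one_add_abs_le x
    have h2 := inv_one_add_abs_le y
    rw [c5] at h1 h2
    exact mul_le_mul h1 h2 (by positivity) (by positivity)
  refine hle.trans ?_
  simp only [coneFactor, one_mul, c1, c3, c4]
  rw [abs_sub_comm y x]
  simp only [← hA, ← hB, ← hD, ← hs, ← ht]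
  have amgm : ∀ u v w : ℝ, 0 ≤ u → 0 ≤ v → 0 ≤ w → u * v * w ≤ u ^ 3 + v ^ 3 + w ^ 3 := by
    intro u v w hu hv hw
    nlinarith [mul_nonneg (add_nonneg (add_nonneg hu hv) hw)
      (add_nonneg (add_nonneg (sq_nonneg (u - v)) (sq_nonneg (v - w))) (sq_nonneg (u - w))),
      mul_nonneg (mul_nonneg hu hv) hw]
  have hA0 : 0 ≤ A := by positivity
  have hB0 : 0 ≤ B := by positivity
  have hD0 : 0 ≤ D := by positivity
  -- The product of the three is `(st)⁸` times the left side, their cubes are `(st)⁸` times the terms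
  -- of the right side.
  have key := amgm (A * s * (B * t)) (A * s * (D * s * t)) (B * t * (D * s * t))
    (by positivity) (by positivity) (by positivity)
  have hK : 0 ≤ (s ^ 8)⁻¹ * (t ^ 8)⁻¹ := by positivity
  have key2 := mul_le_mul_of_nonneg_right key hK
  refine le_trans (le_of_eq ?_) (key2.trans (le_of_eq ?_))
  · field_simp
  · field_simp

/-- The integral of the majorant is finite, and bounded as long as `ξ` stays away from the tip of
the cone. -/
lemma exists_lintegral_majorant_le {ρ : ℝ} (hρ : 0 < ρ) :
    ∃ C : ENNReal, C ≠ ⊤ ∧ ∀ a b : ℝ, ρ ≤ a ^ 2 + b ^ 2 →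
      ∫⁻ p, ENNReal.ofReal (majorant a b p) ≤ C := by
  obtain ⟨C, hC, hb⟩ := exists_lintegral_coneFactor_le
  set K : ENNReal := C * ENNReal.ofReal (ρ ^ (-(3 / 8) : ℝ)) with hK
  have hKtop : K ≠ ⊤ := ENNReal.mul_ne_top hC ENNReal.ofReal_ne_top
  refine ⟨K * K + C * K + C * K, by finiteness, fun a b hab => ?_⟩
  have hJ : ∫⁻ x, ENNReal.ofReal (coneFactor a b x) ≤ K := by
    refine (hb a b (hρ.trans_le hab)).trans (mul_le_mul_right (ENNReal.ofReal_le_ofReal ?_) _)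
    exact Real.rpow_le_rpow_of_nonpos hρ hab (by norm_num)
  -- The inner integral is `O((1 + x²)^{-3/8})`, which compensates the power in front of it.
  have hmixed : ∫⁻ x, ∫⁻ y, ENNReal.ofReal
      (coneFactor a b x * (1 + x ^ 2) ^ (3 / 8 : ℝ) * coneFactor 1 x y) ≤ C * K := by
    calc _ ≤ ∫⁻ x, C * ENNReal.ofReal (coneFactor a b x) := by
          refine lintegral_mono fun x => ?_
          have h0 : 0 ≤ coneFactor a b x * (1 + x ^ 2) ^ (3 / 8 : ℝ) :=
            mul_nonneg (coneFactor_nonneg _ _ _) (by positivity)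
          simp_rw [ENNReal.ofReal_mul h0]
          rw [lintegral_const_mul _ (by fun_prop)]
          refine (mul_le_mul_right (hb 1 x (by positivity)) _).trans (le_of_eq ?_)
          rw [mul_left_comm, ← ENNReal.ofReal_mul h0]
          congr 2
          rw [mul_assoc, one_pow, ← Real.rpow_add (by positivity)]
          norm_num
      _ = C * ∫⁻ x, ENNReal.ofReal (coneFactor a b x) := lintegral_const_mul _ (by fun_prop)
      _ ≤ _ := mul_le_mul_right hJ _
  have n1 : ∀ p : ℝ × ℝ, 0 ≤ coneFactor a b p.1 * coneFactor a b p.2 := fun p =>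
    mul_nonneg (coneFactor_nonneg _ _ _) (coneFactor_nonneg _ _ _)
  have n2 : ∀ p : ℝ × ℝ,
      0 ≤ coneFactor a b p.1 * (1 + p.1 ^ 2) ^ (3 / 8 : ℝ) * coneFactor 1 p.1 p.2 := fun p =>
    mul_nonneg (mul_nonneg (coneFactor_nonneg _ _ _) (by positivity)) (coneFactor_nonneg _ _ _)
  have n3 : ∀ p : ℝ × ℝ,
      0 ≤ coneFactor a b p.2 * (1 + p.2 ^ 2) ^ (3 / 8 : ℝ) * coneFactor 1 p.2 p.1 := fun p =>
    mul_nonneg (mul_nonneg (coneFactor_nonneg _ _ _) (by positivity)) (coneFactor_nonneg _ _ _)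
  have m1 : Measurable fun p : ℝ × ℝ =>
      ENNReal.ofReal (coneFactor a b p.1 * coneFactor a b p.2) := by
    unfold coneFactor; fun_prop
  have m2 : Measurable fun p : ℝ × ℝ => ENNReal.ofReal
      (coneFactor a b p.1 * (1 + p.1 ^ 2) ^ (3 / 8 : ℝ) * coneFactor 1 p.1 p.2) := by
    unfold coneFactor; fun_prop
  have m3 : Measurable fun p : ℝ × ℝ => ENNReal.ofReal
      (coneFactor a b p.2 * (1 + p.2 ^ 2) ^ (3 / 8 : ℝ) * coneFactor 1 p.2 p.1) := by
    unfold coneFactor; fun_prop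
  calc _ ≤ ∫⁻ p : ℝ × ℝ, (ENNReal.ofReal (coneFactor a b p.1 * coneFactor a b p.2)
        + ENNReal.ofReal
          (coneFactor a b p.1 * (1 + p.1 ^ 2) ^ (3 / 8 : ℝ) * coneFactor 1 p.1 p.2)
        + ENNReal.ofReal
          (coneFactor a b p.2 * (1 + p.2 ^ 2) ^ (3 / 8 : ℝ) * coneFactor 1 p.2 p.1)) := by
        refine lintegral_mono fun p => ?_
        rw [← ENNReal.ofReal_add (n1 p) (n2 p), ← ENNReal.ofReal_add (add_nonneg (n1 p) (n2 p)) (n3 p)]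
        exact ENNReal.ofReal_le_ofReal (majorant_le a b p)
    _ ≤ K * K + C * K + C * K := by
        rw [lintegral_add_right _ m3, lintegral_add_right _ m2]
        gcongr
        · simp_rw [ENNReal.ofReal_mul (coneFactor_nonneg _ _ _)]
          have hm : AEMeasurable (fun x => ENNReal.ofReal (coneFactor a b x)) volume := by fun_prop
          rw [Measure.volume_eq_prod, lintegral_prod_mul hm hm]
          exact mul_le_mul' hJ hJ
        · rw [Measure.volume_eq_prod, lintegral_prod _ m2.aemeasurable]
          exact hmixed
        · rw [Measure.volume_eq_prod, lintegral_prod_symm _ m3.aemeasurable]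
          exact hmixed

lemma integrable_majorant {a b : ℝ} (hab : 0 < a ^ 2 + b ^ 2) : Integrable (majorant a b) := by
  obtain ⟨C, hC, hb⟩ := exists_lintegral_majorant_le hab
  refine ⟨(measurable_majorant a b).aestronglyMeasurable, ?_⟩
  rw [hasFiniteIntegral_iff_ofReal (Eventually.of_forall (majorant_nonneg a b))]
  exact (hb a b le_rfl).trans_lt (lt_top_iff_ne_top.2 hC)

lemma exists_integral_majorant_le {ρ : ℝ} (hρ : 0 < ρ) :
    ∃ C : ℝ, 0 ≤ C ∧ ∀ a b : ℝ, ρ ≤ a ^ 2 + b ^ 2 → ∫ p, majorant a b p ≤ C := by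
  obtain ⟨C, hC, hb⟩ := exists_lintegral_majorant_le hρ
  refine ⟨C.toReal, ENNReal.toReal_nonneg, fun a b hab => ?_⟩
  rw [integral_eq_lintegral_of_nonneg_ae (Eventually.of_forall (majorant_nonneg a b))
    (measurable_majorant a b).aestronglyMeasurable]
  exact ENNReal.toReal_mono hC (hb a b hab)

/-! ### Regular boundary pairs on the tube -/

/-- The point of the tube `{Im λ > 0 > Im μ}` at height `η` above the real point `p`. -/
def lift (η : ℝ) (p : ℝ × ℝ) : ℂ × ℂ :=
  ((p.1 : ℂ) + (η : ℂ) * Complex.I, (p.2 : ℂ) - (η : ℂ) * Complex.I)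

/-- The part of the definition of `H²_reg(𝒯⁻)` that the inversion formula depends on, in the
coordinates `(λ, μ)`: `G` is holomorphic on the tube, `g` is an almost everywhere limit of `G` along
some sequence of heights, and both obey the bound `cst (1 + |λ|)⁻¹ (1 + |μ|)⁻¹`. -/
structure BoundaryPair (G : ℂ × ℂ → ℂ) (g : ℝ × ℝ → ℂ) (c : ℝ) : Prop where
  holo : DifferentiableOn ℂ G (tube 1 (-1))
  meas : AEStronglyMeasurable g
  bound : ∀ p ∈ tube 1 (-1), ‖G p‖ ≤ c * (1 + ‖p.1‖)⁻¹ * (1 + ‖p.2‖)⁻¹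
  bound_real : ∀ᵐ p : ℝ × ℝ, ‖g p‖ ≤ c * (1 + |p.1|)⁻¹ * (1 + |p.2|)⁻¹
  approx : ∃ η : ℕ → ℝ, (∀ n, 0 < η n) ∧ Tendsto η atTop (𝓝 0) ∧
    ∀ᵐ p : ℝ × ℝ, Tendsto (fun n => G (lift (η n) p)) atTop (𝓝 (g p))

lemma mem_tube_iff {p : ℂ × ℂ} : p ∈ tube 1 (-1) ↔ 0 < p.1.im ∧ p.2.im < 0 := by
  simp [tube]

lemma isOpen_tube : IsOpen (tube 1 (-1)) := by
  have : tube 1 (-1) = {p : ℂ × ℂ | 0 < p.1.im} ∩ {p | p.2.im < 0} := by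
    ext p; simp [mem_tube_iff]
  rw [this]
  exact (isOpen_lt continuous_const (Complex.continuous_im.comp continuous_fst)).inter
    (isOpen_lt (Complex.continuous_im.comp continuous_snd) continuous_const)

lemma lift_mem {η : ℝ} (hη : 0 < η) (p : ℝ × ℝ) : lift η p ∈ tube 1 (-1) := by
  rw [mem_tube_iff]; simp [lift, hη]

@[fun_prop]
lemma continuous_lift (η : ℝ) : Continuous (lift η) := by unfold lift; fun_prop

lemma abs_le_norm_lift_fst (η : ℝ) (p : ℝ × ℝ) : |p.1| ≤ ‖(lift η p).1‖ := by
  simpa [lift] using Complex.abs_re_le_norm (lift η p).1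

lemma abs_le_norm_lift_snd (η : ℝ) (p : ℝ × ℝ) : |p.2| ≤ ‖(lift η p).2‖ := by
  simpa [lift] using Complex.abs_re_le_norm (lift η p).2

namespace BoundaryPair

variable {G : ℂ × ℂ → ℂ} {g : ℝ × ℝ → ℂ} {c : ℝ}

lemma const_nonneg (h : BoundaryPair G g c) : 0 ≤ c := by
  have h1 := h.bound (Complex.I, -Complex.I) (by rw [mem_tube_iff]; simp)
  have h2 := (norm_nonneg _).trans h1
  simp at h2
  linarith

lemma bound_lift (h : BoundaryPair G g c) {η : ℝ} (hη : 0 < η) (p : ℝ × ℝ) :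
    ‖G (lift η p)‖ ≤ c * ((1 + |p.1|)⁻¹ * (1 + |p.2|)⁻¹) := by
  refine (h.bound _ (lift_mem hη p)).trans ?_
  rw [mul_assoc]
  refine mul_le_mul_of_nonneg_left ?_ h.const_nonneg
  have h1 := abs_le_norm_lift_fst η p
  have h2 := abs_le_norm_lift_snd η p
  gcongr

lemma continuous_lift_comp (h : BoundaryPair G g c) {η : ℝ} (hη : 0 < η) :
    Continuous fun p => G (lift η p) :=
  h.holo.continuousOn.comp_continuous (continuous_lift η) (lift_mem hη)

lemma differentiableOn_fst (h : BoundaryPair G g c) {m : ℂ} (hm : m.im < 0) :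
    DifferentiableOn ℂ (fun l => G (l, m)) {l | 0 < l.im} :=
  h.holo.comp (by fun_prop) fun l hl => mem_tube_iff.2 ⟨hl, hm⟩

lemma differentiableOn_snd (h : BoundaryPair G g c) {l : ℂ} (hl : 0 < l.im) :
    DifferentiableOn ℂ (fun m => G (l, m)) {m | m.im < 0} :=
  h.holo.comp (by fun_prop) fun m hm => mem_tube_iff.2 ⟨hl, hm⟩

lemma bound_fst (h : BoundaryPair G g c) {l m : ℂ} (hl : 0 < l.im) (hm : m.im < 0) :
    ‖G (l, m)‖ ≤ c * (1 + ‖l‖)⁻¹ := by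
  refine (h.bound _ (mem_tube_iff.2 ⟨hl, hm⟩)).trans ?_
  refine mul_le_of_le_one_right (mul_nonneg h.const_nonneg (by positivity)) ?_
  exact inv_le_one_of_one_le₀ (by linarith [norm_nonneg m])

lemma bound_snd (h : BoundaryPair G g c) {l m : ℂ} (hl : 0 < l.im) (hm : m.im < 0) :
    ‖G (l, m)‖ ≤ c * (1 + ‖m‖)⁻¹ := by
  refine (h.bound _ (mem_tube_iff.2 ⟨hl, hm⟩)).trans ?_
  refine mul_le_mul_of_nonneg_right ?_ (by positivity)
  refine mul_le_of_le_one_right h.const_nonneg ?_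
  exact inv_le_one_of_one_le₀ (by linarith [norm_nonneg l])

/-- The double Cauchy integral of the boundary value reproduces the function. -/
theorem cauchy (h : BoundaryPair G g c) {l m : ℂ} (hl : 0 < l.im) (hm : m.im < 0) :
    ∫ p : ℝ × ℝ, g p / (((p.1 : ℂ) - l) * ((p.2 : ℂ) - m)) = 4 * Real.pi ^ 2 * G (l, m) := by
  obtain ⟨η, hηpos, hη0, hlim⟩ := h.approx
  obtain ⟨κ₁, hκ₁, hb₁⟩ := exists_lower_bound_line l (v := l.im / 2) (by linarith)
  obtain ⟨κ₂, hκ₂, hb₂⟩ := exists_lower_bound_line m (v := -m.im / 2) (by linarith)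
  set d : ℕ → ℝ × ℝ → ℂ := fun n p => ((lift (η n) p).1 - l) * ((lift (η n) p).2 - m) with hd
  have hsmall : ∀ᶠ n in atTop, η n < l.im / 2 ∧ η n < -m.im / 2 :=
    (hη0.eventually_lt_const (by linarith)).and (hη0.eventually_lt_const (by linarith))
  have hlow : ∀ η : ℝ, 0 < η → η < l.im / 2 → η < -m.im / 2 → ∀ p : ℝ × ℝ,
      κ₁ * κ₂ * ((1 + |p.1|) * (1 + |p.2|)) ≤ ‖((lift η p).1 - l) * ((lift η p).2 - m)‖ := by
    intro η h0 h1 h2 p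
    have e1 := hb₁ p.1 η (by rw [abs_sub_comm, abs_of_pos (by linarith)]; linarith)
    have e2 := hb₂ p.2 (-η) (by rw [abs_of_pos (by linarith)]; linarith)
    rw [norm_mul]
    have e3 : (lift η p).2 - m = (p.2 : ℂ) + ((-η : ℝ) : ℂ) * Complex.I - m := by
      simp only [lift]; push_cast; ring
    rw [e3]
    calc _ = (κ₁ * (1 + |p.1|)) * (κ₂ * (1 + |p.2|)) := by ring
      _ ≤ _ := mul_le_mul e1 e2 (by positivity) (norm_nonneg _)
  have hdom : ∀ η : ℝ, 0 < η → η < l.im / 2 → η < -m.im / 2 → ∀ p : ℝ × ℝ,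
      ‖G (lift η p) / (((lift η p).1 - l) * ((lift η p).2 - m))‖
        ≤ c * (κ₁ * κ₂)⁻¹ * (((1 + |p.1|)⁻¹) ^ 2 * ((1 + |p.2|)⁻¹) ^ 2) := by
    intro η h0 h1 h2 p
    have e := hlow η h0 h1 h2 p
    have hc := h.const_nonneg
    rw [norm_div, div_le_iff₀ (lt_of_lt_of_le (by positivity) e)]
    refine (h.bound_lift h0 p).trans ?_
    calc c * ((1 + |p.1|)⁻¹ * (1 + |p.2|)⁻¹)
        = c * (κ₁ * κ₂)⁻¹ * (((1 + |p.1|)⁻¹) ^ 2 * ((1 + |p.2|)⁻¹) ^ 2)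
            * (κ₁ * κ₂ * ((1 + |p.1|) * (1 + |p.2|))) := by field_simp
      _ ≤ _ := mul_le_mul_of_nonneg_left e (by positivity)
  have hdint : Integrable fun p : ℝ × ℝ =>
      c * (κ₁ * κ₂)⁻¹ * (((1 + |p.1|)⁻¹) ^ 2 * ((1 + |p.2|)⁻¹) ^ 2) :=
    (integrable_one_add_abs_inv_sq.mul_prod integrable_one_add_abs_inv_sq).const_mul _
  have hcont : ∀ η : ℝ, 0 < η → η < l.im / 2 → η < -m.im / 2 →
      Continuous fun p => G (lift η p) / (((lift η p).1 - l) * ((lift η p).2 - m)) := by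
    intro η h0 h1 h2
    refine (h.continuous_lift_comp h0).div (by fun_prop) fun p hp => ?_
    have e := hlow η h0 h1 h2 p
    rw [hp, norm_zero] at e
    have : 0 < κ₁ * κ₂ * ((1 + |p.1|) * (1 + |p.2|)) := by positivity
    linarith
  have hval : ∀ η : ℝ, 0 < η → η < l.im / 2 → η < -m.im / 2 →
      ∫ p : ℝ × ℝ, G (lift η p) / (((lift η p).1 - l) * ((lift η p).2 - m))
        = 4 * Real.pi ^ 2 * G (l, m) := by
    intro η h0 h1 h2
    have hint : Integrable fun p => G (lift η p) / (((lift η p).1 - l) * ((lift η p).2 - m)) :=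
      hdint.mono' (hcont η h0 h1 h2).aestronglyMeasurable (Eventually.of_forall (hdom η h0 h1 h2))
    rw [Measure.volume_eq_prod] at hint ⊢
    rw [integral_prod _ hint]
    have hinner : ∀ x : ℝ, ∫ y : ℝ, G (lift η (x, y)) / (((lift η (x, y)).1 - l) *
        ((lift η (x, y)).2 - m)) = -(2 * Real.pi * Complex.I) *
          (G ((x : ℂ) + (η : ℂ) * Complex.I, m) / ((x : ℂ) + (η : ℂ) * Complex.I - l)) := by
      intro x
      have hx : 0 < ((x : ℂ) + (η : ℂ) * Complex.I).im := by simpa using h0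
      have := integral_line_cauchy_lower (h := fun y => G ((x : ℂ) + (η : ℂ) * Complex.I, y))
        (w := m) h0 (by linarith) (h.differentiableOn_snd hx) fun z hz => h.bound_snd hx hz
      simp only [lift]
      calc _ = ∫ y : ℝ, (((x : ℂ) + (η : ℂ) * Complex.I - l)⁻¹) *
            (G ((x : ℂ) + (η : ℂ) * Complex.I, (y : ℂ) - (η : ℂ) * Complex.I) /
              ((y : ℂ) - (η : ℂ) * Complex.I - m)) := by
            refine integral_congr_ae (Eventually.of_forall fun y => ?_)
            simp only [div_eq_mul_inv, mul_inv]
            ring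
        _ = _ := by
            rw [integral_const_mul, this]
            simp only [div_eq_mul_inv]
            ring
    simp_rw [hinner]
    rw [integral_const_mul, integral_line_cauchy (h := fun z => G (z, m)) h0 (by linarith)
      (h.differentiableOn_fst hm) fun z hz => h.bound_fst hz hm]
    linear_combination (-4 * Real.pi ^ 2 * G (l, m)) * Complex.I_mul_I
  have ht : Tendsto (fun n => ∫ p : ℝ × ℝ, G (lift (η n) p) /
      (((lift (η n) p).1 - l) * ((lift (η n) p).2 - m))) atTop
      (𝓝 (∫ p : ℝ × ℝ, g p / (((p.1 : ℂ) - l) * ((p.2 : ℂ) - m)))) := by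
    refine tendsto_integral_filter_of_dominated_convergence _ ?_ ?_ hdint ?_
    · filter_upwards [hsmall] with n hn
      exact (hcont _ (hηpos n) hn.1 hn.2).aestronglyMeasurable
    · filter_upwards [hsmall] with n hn
      exact Eventually.of_forall (hdom _ (hηpos n) hn.1 hn.2)
    · filter_upwards [hlim] with p hp
      have hηc : Tendsto (fun n => ((η n : ℝ) : ℂ)) atTop (𝓝 ((0 : ℝ) : ℂ)) :=
        (Complex.continuous_ofReal.tendsto _).comp hη0
      have e1 : Tendsto (fun n => (lift (η n) p).1) atTop (𝓝 (p.1 : ℂ)) := by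
        have := (hηc.mul_const Complex.I).const_add (p.1 : ℂ)
        simpa [lift] using this
      have e2 : Tendsto (fun n => (lift (η n) p).2) atTop (𝓝 (p.2 : ℂ)) := by
        have := (hηc.mul_const Complex.I).const_sub (p.2 : ℂ)
        simpa [lift] using this
      refine hp.div ((e1.sub_const l).mul (e2.sub_const m)) (mul_ne_zero ?_ ?_)
      · intro h0
        have := congrArg Complex.im h0
        simp at this
        linarith
      · intro h0
        have := congrArg Complex.im h0
        simp at this
        linarith
  refine tendsto_nhds_unique ht ?_
  refine tendsto_const_nhds.congr' ?_
  filter_upwards [hsmall] with n hn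
  exact (hval _ (hηpos n) hn.1 hn.2).symm

end BoundaryPair

/-! ### The light-cone and complex powers -/

/-- The point of the light-cone with spinor coordinates `(a, b)`. -/
def spinor (a b : ℝ) : Fin 3 → ℝ := ![(a ^ 2 + b ^ 2) / 2, (a ^ 2 - b ^ 2) / 2, a * b]

lemma exists_spinor {ξ : Fin 3 → ℝ} (hξ : ξ ∈ futureCone) :
    ∃ a b : ℝ, 0 < a ^ 2 + b ^ 2 ∧ ξ = spinor a b := by
  obtain ⟨h1, h2, h3⟩ := hξ
  simp only [mink] at h1
  have hA : 0 ≤ ξ 0 + ξ 1 := by nlinarith [sq_nonneg (ξ 2), sq_nonneg (ξ 0 + ξ 1)]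
  have hB : 0 ≤ ξ 0 - ξ 1 := by nlinarith [sq_nonneg (ξ 2), sq_nonneg (ξ 0 - ξ 1)]
  have key : ∀ a b : ℝ, a ^ 2 = ξ 0 + ξ 1 → b ^ 2 = ξ 0 - ξ 1 → ξ 2 = a * b →
      0 < a ^ 2 + b ^ 2 ∧ ξ = spinor a b := by
    intro a b ha hb hab
    have hξ : ξ = spinor a b := by
      ext i
      fin_cases i
      · simp [spinor]; linarith
      · simp [spinor]; linarith
      · simpa [spinor] using hab
    refine ⟨lt_of_le_of_ne (by positivity) fun h0 => h3 ?_, hξ⟩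
    have ha0 : a = 0 := by nlinarith [sq_nonneg a, sq_nonneg b]
    have hb0 : b = 0 := by nlinarith [sq_nonneg a, sq_nonneg b]
    rw [hξ, ha0, hb0]
    ext i
    fin_cases i <;> simp [spinor]
  have hs : (Real.sqrt (ξ 0 + ξ 1) * Real.sqrt (ξ 0 - ξ 1)) ^ 2 = ξ 2 ^ 2 := by
    rw [mul_pow, Real.sq_sqrt hA, Real.sq_sqrt hB]; linarith
  rcases sq_eq_sq_iff_eq_or_eq_neg.1 hs with h | h
  · exact ⟨_, _, key _ _ (Real.sq_sqrt hA) (Real.sq_sqrt hB) h.symm⟩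
  · refine ⟨_, _, key (Real.sqrt (ξ 0 + ξ 1)) (-Real.sqrt (ξ 0 - ξ 1)) (Real.sq_sqrt hA) ?_ ?_⟩
    · rw [neg_sq, Real.sq_sqrt hB]
    · linarith

lemma spinor_mem {a b : ℝ} (h : 0 < a ^ 2 + b ^ 2) : spinor a b ∈ futureCone := by
  refine ⟨?_, ?_, fun h0 => ?_⟩
  · simp only [mink, spinor, Matrix.cons_val]; ring
  · simp only [spinor, Matrix.cons_val]; positivity
  · have := congrFun h0 0
    simp [spinor] at this
    linarith

lemma mink_toC_spinor (w : Fin 3 → ℂ) (a b : ℝ) : mink w (toC (spinor a b))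
    = w 0 * ((a ^ 2 + b ^ 2) / 2) - w 1 * ((a ^ 2 - b ^ 2) / 2) - w 2 * (a * b) := by
  simp [mink, toC, spinor]

lemma mink_param_spinor (l m : ℂ) (a b : ℝ) :
    mink (param l m) (toC (spinor a b)) = (a * l - b) * (a * m - b) / (l - m) := by
  rw [mink_toC_spinor, param_zero, param_one, param_two]
  ring

lemma mink_param_spinor_real (l m a b : ℝ) :
    mink (param l m) (spinor a b) = (a * l - b) * (a * m - b) / (l - m) := by
  simp only [mink, spinor, param, Matrix.cons_val]
  ring

lemma mul_sub_ne_zero {a b : ℝ} (hab : 0 < a ^ 2 + b ^ 2) {l : ℂ} (hl : l.im ≠ 0) :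
    (a : ℂ) * l - b ≠ 0 := by
  intro h0
  have h1 := congrArg Complex.im h0
  have h2 := congrArg Complex.re h0
  simp at h1 h2
  rcases h1 with h1 | h1
  · rw [h1] at h2
    simp at h2
    rw [h1, h2] at hab
    simp at hab
  · exact hl h1

/-- For `z ∈ 𝒯⁻` and `ξ` on the cone, `[z·ξ]` lies in the lower half-plane. -/
lemma im_mink_param_neg {l m : ℂ} (hl : 0 < l.im) (hm : m.im < 0) {ξ : Fin 3 → ℝ}
    (hξ : ξ ∈ futureCone) : (mink (param l m) (toC ξ)).im < 0 := by
  obtain ⟨a, b, hab, rfl⟩ := exists_spinor hξ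
  rw [mink_param_spinor]
  have hd : l - m ≠ 0 := by
    intro h0
    have := congrArg Complex.im h0
    simp at this
    linarith
  have hA := mul_sub_ne_zero hab hl.ne'
  have hB := mul_sub_ne_zero hab hm.ne
  have hN : 0 < Complex.normSq (l - m) := Complex.normSq_pos.2 hd
  have key : ((a * l - b) * (a * m - b) / (l - m)).im * Complex.normSq (l - m)
      = Complex.normSq (a * l - b) * m.im - Complex.normSq (a * m - b) * l.im := by
    rw [Complex.div_im]
    field_simp
    simp only [Complex.normSq_apply, Complex.sub_re, Complex.sub_im, Complex.mul_re, Complex.mul_im,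
      Complex.ofReal_re, Complex.ofReal_im]
    ring
  have h1 := mul_neg_of_pos_of_neg (Complex.normSq_pos.2 hA) hm
  have h2 := mul_pos (Complex.normSq_pos.2 hB) hl
  by_contra hcon
  push Not at hcon
  have := mul_nonneg hcon hN.le
  linarith

lemma param_swap {K : Type*} [Field K] (l m : K) : param m l = -param l m := by
  ext i
  fin_cases i
  · change (1 + m * l) / (m - l) = -((1 + l * m) / (l - m))
    rw [← neg_sub l m, div_neg, mul_comm]
  · change (1 - m * l) / (m - l) = -((1 - l * m) / (l - m))
    rw [← neg_sub l m, div_neg, mul_comm]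
  · change (m + l) / (m - l) = -((l + m) / (l - m))
    rw [← neg_sub l m, div_neg, add_comm]

lemma mink_neg_left {K : Type*} [CommRing K] (x y : Fin 3 → K) : mink (-x) y = -mink x y := by
  simp only [mink, Pi.neg_apply]; ring

/-- For `z ∈ 𝒯⁺` and `ξ` on the cone, `[z·ξ]` lies in the upper half-plane. -/
lemma im_mink_param_pos {l m : ℂ} (hl : l.im < 0) (hm : 0 < m.im) {ξ : Fin 3 → ℝ}
    (hξ : ξ ∈ futureCone) : 0 < (mink (param l m) (toC ξ)).im := by
  have h := im_mink_param_neg hm hl hξ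
  rw [param_swap, mink_neg_left, Complex.neg_im] at h
  linarith

lemma norm_cpow_half_eq {w : ℂ} (hw : w ≠ 0) (ν : ℝ) :
    ‖w ^ (-1 / 2 - Complex.I * ν)‖ = ‖w‖ ^ (-(1 / 2) : ℝ) * Real.exp (ν * w.arg) := by
  rw [Complex.norm_cpow_of_ne_zero hw]
  have h1 : (-1 / 2 - Complex.I * (ν : ℂ)).re = -(1 / 2) := by simp; norm_num
  have h2 : (-1 / 2 - Complex.I * (ν : ℂ)).im = -ν := by simp
  rw [h1, h2, div_eq_mul_inv, ← Real.exp_neg]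
  ring_nf

lemma exponent_ne_zero (ν : ℝ) : (-1 / 2 - Complex.I * (ν : ℂ)) ≠ 0 := by
  intro h
  have := congrArg Complex.re h
  simp at this

lemma norm_cpow_half_le (w : ℂ) (ν : ℝ) :
    ‖w ^ (-1 / 2 - Complex.I * ν)‖ ≤ Real.exp (Real.pi * |ν|) * ‖w‖ ^ (-(1 / 2) : ℝ) := by
  by_cases hw : w = 0
  · rw [hw, Complex.zero_cpow (exponent_ne_zero ν), norm_zero]; positivity
  · rw [norm_cpow_half_eq hw, mul_comm]
    refine mul_le_mul_of_nonneg_right (Real.exp_le_exp.2 ?_) (by positivity)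
    calc ν * w.arg ≤ |ν * w.arg| := le_abs_self _
      _ = |w.arg| * |ν| := by rw [abs_mul, mul_comm]
      _ ≤ _ := mul_le_mul_of_nonneg_right (Complex.abs_arg_le_pi w) (abs_nonneg _)

/-- Approached from the upper half-plane, the principal branch has the boundary value `t_+^s`. -/
lemma bvPow_one (t : ℝ) {s : ℂ} (hs : s ≠ 0) : bvPow 1 t s = (t : ℂ) ^ s := by
  unfold bvPow
  split_ifs with h1 h2
  · rw [abs_of_pos h1]
  · rw [abs_of_neg h2]
    have ht : (t : ℂ) ≠ 0 := by exact_mod_cast h2.ne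
    have ht' : ((-t : ℝ) : ℂ) ≠ 0 := by exact_mod_cast (neg_pos.2 h2).ne'
    rw [Complex.cpow_def_of_ne_zero ht, Complex.cpow_def_of_ne_zero ht', ← Complex.exp_add]
    congr 1
    have : Complex.log (t : ℂ) = Complex.log ((-t : ℝ) : ℂ) + Real.pi * Complex.I := by
      rw [Complex.log, Complex.log, Complex.arg_ofReal_of_neg h2,
        Complex.arg_ofReal_of_nonneg (by linarith)]
      simp
    rw [this]
    push_cast
    ring
  · have : t = 0 := le_antisymm (not_lt.1 h1) (not_lt.1 h2)
    rw [this, Complex.ofReal_zero, Complex.zero_cpow hs]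

/-- `(-t)_-^s = e^{-iπs} t_+^s`. -/
lemma bvPow_neg_one_neg (t : ℝ) {s : ℂ} :
    bvPow (-1) (-t) s = Complex.exp (-(Real.pi * Complex.I * s)) * bvPow 1 t s := by
  unfold bvPow
  rw [abs_neg]
  rcases lt_trichotomy t 0 with h | h | h
  · rw [if_pos (by linarith : 0 < -t), if_neg (by linarith), if_pos h, ← mul_assoc,
      ← Complex.exp_add]
    simp
  · simp [h]
  · rw [if_neg (by linarith), if_pos (by linarith : -t < 0), if_pos h]
    congr 2
    push_cast
    ring

/-- `(-t)_+^s = e^{iπs} t_-^s`. -/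
lemma bvPow_one_neg (t : ℝ) {s : ℂ} :
    bvPow 1 (-t) s = Complex.exp (Real.pi * Complex.I * s) * bvPow (-1) t s := by
  have h := bvPow_neg_one_neg (-t) (s := s)
  rw [neg_neg] at h
  rw [h, ← mul_assoc, ← Complex.exp_add]
  simp

lemma norm_bvPow_le {ε : ℝ} (hε : ε = 1 ∨ ε = -1) (t ν : ℝ) :
    ‖bvPow ε t (-1 / 2 - Complex.I * ν)‖
      ≤ Real.exp (Real.pi * |ν|) * |t| ^ (-(1 / 2) : ℝ) := by
  have h1 : ∀ t : ℝ, ‖((|t| : ℝ) : ℂ) ^ (-1 / 2 - Complex.I * (ν : ℂ))‖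
      ≤ |t| ^ (-(1 / 2) : ℝ) := by
    intro t
    by_cases ht : t = 0
    · rw [ht, abs_zero, Complex.ofReal_zero, Complex.zero_cpow (exponent_ne_zero ν), norm_zero]
      positivity
    · rw [norm_cpow_half_eq (by simpa using ht), Complex.arg_ofReal_of_nonneg (abs_nonneg _)]
      simp
  have hexp : 1 ≤ Real.exp (Real.pi * |ν|) :=
    Real.one_le_exp (mul_nonneg Real.pi_pos.le (abs_nonneg _))
  unfold bvPow
  split_ifs with h2 h3
  · refine (h1 t).trans (le_mul_of_one_le_left (by positivity) hexp)
  · rw [norm_mul]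
    refine mul_le_mul ?_ (h1 t) (norm_nonneg _) (Real.exp_nonneg _)
    rw [Complex.norm_exp]
    refine Real.exp_le_exp.2 ?_
    have : (((ε * Real.pi : ℝ) : ℂ) * Complex.I * (-1 / 2 - Complex.I * (ν : ℂ))).re
        = ε * Real.pi * ν := by
      simp
    rw [this]
    rcases hε with rfl | rfl
    · rw [one_mul]; exact mul_le_mul_of_nonneg_left (le_abs_self _) Real.pi_pos.le
    · rw [neg_one_mul, neg_mul, ← mul_neg]
      exact mul_le_mul_of_nonneg_left (neg_le_abs _) Real.pi_pos.le
  · rw [norm_zero]; positivity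

lemma tendsto_cpow_upper {ι : Type*} {F : Filter ι} {w : ι → ℂ} {t : ℝ} (ht : t ≠ 0) (s : ℂ)
    (hw : Tendsto w F (𝓝 (t : ℂ))) (him : ∀ᶠ n in F, 0 ≤ (w n).im) :
    Tendsto (fun n => w n ^ s) F (𝓝 ((t : ℂ) ^ s)) := by
  rcases lt_or_gt_of_ne ht with h | h
  · have htc : (t : ℂ) ≠ 0 := by exact_mod_cast ht
    have hlog : Tendsto (fun n => Complex.log (w n)) F (𝓝 (Complex.log t)) := by
      have h1 : ContinuousWithinAt Complex.log {z : ℂ | 0 ≤ z.im} (t : ℂ) :=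
        Complex.continuousWithinAt_log_of_re_neg_of_im_zero (by simpa using h) (by simp)
      exact h1.tendsto.comp (tendsto_nhdsWithin_iff.2 ⟨hw, him⟩)
    rw [Complex.cpow_def_of_ne_zero htc]
    refine ((Complex.continuous_exp.tendsto _).comp (hlog.mul_const s)).congr' ?_
    filter_upwards [hw.eventually_ne htc] with n hn
    simp only [Function.comp_apply, Complex.cpow_def_of_ne_zero hn]
  · exact (continuousAt_cpow_const (Or.inl (by simpa using h))).tendsto.comp hw

lemma neg_cpow_of_im_neg {w : ℂ} (hw : w.im < 0) (s : ℂ) :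
    w ^ s = Complex.exp (-(Real.pi * Complex.I * s)) * (-w) ^ s := by
  have h0 : w ≠ 0 := by rintro rfl; simp at hw
  rw [Complex.cpow_def_of_ne_zero h0, Complex.cpow_def_of_ne_zero (neg_ne_zero.2 h0),
    ← Complex.exp_add]
  congr 1
  have : Complex.log (-w) = Complex.log w + Real.pi * Complex.I := by
    simp only [Complex.log, norm_neg, Complex.arg_neg_eq_arg_add_pi_of_im_neg hw]
    push_cast
    ring
  rw [this]
  ring

lemma tendsto_cpow_lower {ι : Type*} {F : Filter ι} {w : ι → ℂ} {t : ℝ} (ht : t ≠ 0) {s : ℂ}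
    (hs : s ≠ 0) (hw : Tendsto w F (𝓝 (t : ℂ))) (him : ∀ᶠ n in F, (w n).im < 0) :
    Tendsto (fun n => w n ^ s) F (𝓝 (bvPow (-1) t s)) := by
  have h1 : Tendsto (fun n => (-w n) ^ s) F (𝓝 (((-t : ℝ) : ℂ) ^ s)) := by
    refine tendsto_cpow_upper (neg_ne_zero.2 ht) s (by simpa using hw.neg) ?_
    filter_upwards [him] with n hn
    simp [hn.le]
  have h2 : bvPow (-1) t s = Complex.exp (-(Real.pi * Complex.I * s)) * ((-t : ℝ) : ℂ) ^ s := by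
    rw [← bvPow_one _ hs, ← bvPow_neg_one_neg, neg_neg]
  rw [h2]
  refine (h1.const_mul _).congr' ?_
  filter_upwards [him] with n hn
  exact (neg_cpow_of_im_neg hn s).symm

/-! ### The transforms in the coordinates `(λ, μ)` -/

/-- The Fourier–Helgason kernel in the coordinates `(λ, μ)`, against `(λ - μ)⁻¹ f dλ dμ`. -/
def chartKernel (ε ν : ℝ) (ξ : Fin 3 → ℝ) (p : ℝ × ℝ) : ℂ :=
  bvPow ε (mink (param p.1 p.2) ξ) (-1 / 2 - Complex.I * ν) / ((p.1 - p.2 : ℝ) : ℂ)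

lemma measurable_bvPow (ε : ℝ) (s : ℂ) : Measurable fun t => bvPow ε t s := by
  unfold bvPow
  refine Measurable.ite (measurableSet_lt measurable_const measurable_id) ?_
    (Measurable.ite (measurableSet_lt measurable_id measurable_const) ?_ measurable_const)
  · fun_prop
  · fun_prop

lemma measurable_mink_right (ξ : Fin 3 → ℝ) : Measurable fun x : Fin 3 → ℝ => mink x ξ := by
  unfold mink; fun_prop

lemma measurable_chartKernel (ε ν : ℝ) (ξ : Fin 3 → ℝ) : Measurable (chartKernel ε ν ξ) := by
  unfold chartKernel
  refine Measurable.div ?_ (by fun_prop)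
  exact (measurable_bvPow ε _).comp ((measurable_mink_right ξ).comp measurable_param)

/-- The modulus of `[z·ξ]^{-1/2} / (λ - μ)`. -/
lemma rpow_div_kernel {A B D : ℝ} (hA : 0 ≤ A) (hB : 0 ≤ B) (hD : 0 ≤ D) :
    (A * B / D) ^ (-(1 / 2) : ℝ) / D
      = A ^ (-(1 / 2) : ℝ) * B ^ (-(1 / 2) : ℝ) * D ^ (-(1 / 2) : ℝ) := by
  rcases hD.eq_or_lt with h | h
  · rw [← h]; simp
  · rw [Real.div_rpow (mul_nonneg hA hB) hD, Real.mul_rpow hA hB, div_div, div_eq_mul_inv]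
    congr 1
    rw [← Real.rpow_add_one h.ne', ← Real.rpow_neg hD]
    norm_num

lemma norm_chartKernel_mul_le {ε : ℝ} (hε : ε = 1 ∨ ε = -1) (ν a b : ℝ) {c : ℝ} {p : ℝ × ℝ}
    {w : ℂ} (hw : ‖w‖ ≤ c * (1 + |p.1|)⁻¹ * (1 + |p.2|)⁻¹) :
    ‖chartKernel ε ν (spinor a b) p * w‖ ≤ Real.exp (Real.pi * |ν|) * c * majorant a b p := by
  rw [norm_mul, chartKernel, norm_div, Complex.norm_real, Real.norm_eq_abs, mink_param_spinor_real]
  have h1 := norm_bvPow_le hε ((a * p.1 - b) * (a * p.2 - b) / (p.1 - p.2)) ν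
  have h2 := div_le_div_of_nonneg_right h1 (abs_nonneg (p.1 - p.2))
  rw [mul_div_assoc (Real.exp _), abs_div, abs_mul,
    rpow_div_kernel (abs_nonneg _) (abs_nonneg _) (abs_nonneg _)] at h2
  refine (mul_le_mul h2 hw (norm_nonneg _) (by positivity)).trans (le_of_eq ?_)
  unfold majorant
  ring

lemma integrable_chartKernel_mul {ε : ℝ} (hε : ε = 1 ∨ ε = -1) (ν : ℝ) {ξ : Fin 3 → ℝ}
    (hξ : ξ ∈ futureCone) {g : ℝ × ℝ → ℂ} (hg : AEStronglyMeasurable g) {c : ℝ}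
    (hb : ∀ᵐ p : ℝ × ℝ, ‖g p‖ ≤ c * (1 + |p.1|)⁻¹ * (1 + |p.2|)⁻¹) :
    Integrable fun p => chartKernel ε ν ξ p * g p := by
  obtain ⟨a, b, hab, rfl⟩ := exists_spinor hξ
  refine ((integrable_majorant hab).const_mul (Real.exp (Real.pi * |ν|) * c)).mono'
    ((measurable_chartKernel _ _ _).aestronglyMeasurable.mul hg) ?_
  filter_upwards [hb] with p hp
  exact norm_chartKernel_mul_le hε ν a b hp

lemma aestronglyMeasurable_comp_param {f : (Fin 3 → ℝ) → ℂ} (hf : AEStronglyMeasurable f sigma) :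
    AEStronglyMeasurable (fun p : ℝ × ℝ => f (param p.1 p.2)) := by
  rw [sigma_eq_map] at hf
  have h1 : AEStronglyMeasurable (fun p : ℝ × ℝ => f (param p.1 p.2)) chartMeasure :=
    hf.comp_measurable measurable_param
  refine h1.mono_ac ?_
  refine withDensity_absolutelyContinuous' ?_ ?_
  · exact (measurable_const.div
      ((measurable_fst.sub measurable_snd).pow_const 2)).ennreal_ofReal.aemeasurable
  · filter_upwards [ae_fst_ne_snd] with p hp
    have : 0 < (p.1 - p.2) ^ 2 := by
      have := sub_ne_zero.2 hp
      positivity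
    simp only [ne_eq, ENNReal.ofReal_eq_zero, not_le]
    positivity

lemma aestronglyMeasurable_reducedReal {f : (Fin 3 → ℝ) → ℂ}
    (hf : AEStronglyMeasurable f sigma) : AEStronglyMeasurable (reducedReal f) := by
  unfold reducedReal
  have h2 : Measurable fun p : ℝ × ℝ => (((p.1 - p.2 : ℝ) : ℂ))⁻¹ := by fun_prop
  simp only [div_eq_mul_inv]
  exact (aestronglyMeasurable_comp_param hf).mul h2.aestronglyMeasurable

lemma aestronglyMeasurable_fhIntegrand (ε ν : ℝ) (ξ : Fin 3 → ℝ) {f : (Fin 3 → ℝ) → ℂ}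
    (hf : AEStronglyMeasurable f sigma) : AEStronglyMeasurable (fhIntegrand ε f ν ξ) sigma := by
  unfold fhIntegrand
  exact ((measurable_bvPow ε _).comp (measurable_mink_right ξ)).aestronglyMeasurable.mul hf

lemma density_smul_fhIntegrand (ε ν : ℝ) (ξ : Fin 3 → ℝ) (f : (Fin 3 → ℝ) → ℂ) (p : ℝ × ℝ) :
    (ENNReal.ofReal (1 / (p.1 - p.2) ^ 2)).toReal • fhIntegrand ε f ν ξ (param p.1 p.2)
      = chartKernel ε ν ξ p * reducedReal f p := by
  rw [ENNReal.toReal_ofReal (by positivity), fhIntegrand, chartKernel, reducedReal,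
    Complex.real_smul, Complex.ofReal_div, Complex.ofReal_one, Complex.ofReal_pow]
  ring

lemma integrable_fhIntegrand_iff (ε ν : ℝ) (ξ : Fin 3 → ℝ) {f : (Fin 3 → ℝ) → ℂ}
    (hf : AEStronglyMeasurable f sigma) :
    Integrable (fhIntegrand ε f ν ξ) sigma ↔
      Integrable fun p => chartKernel ε ν ξ p * reducedReal f p := by
  have hm := aestronglyMeasurable_fhIntegrand ε ν ξ hf
  rw [sigma_eq_map] at hm ⊢
  rw [integrable_map_measure hm measurable_param.aemeasurable, chartMeasure,
    integrable_withDensity_iff_integrable_smul']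
  · refine integrable_congr (Eventually.of_forall fun p => ?_)
    exact density_smul_fhIntegrand ε ν ξ f p
  · exact (measurable_const.div ((measurable_fst.sub measurable_snd).pow_const 2)).ennreal_ofReal
  · exact Eventually.of_forall fun p => ENNReal.ofReal_lt_top

lemma fh_eq (ε ν : ℝ) (ξ : Fin 3 → ℝ) {f : (Fin 3 → ℝ) → ℂ} (hf : AEStronglyMeasurable f sigma) :
    fh ε f ν ξ = ∫ p, chartKernel ε ν ξ p * reducedReal f p := by
  have hm := aestronglyMeasurable_fhIntegrand ε ν ξ hf
  unfold fh
  rw [sigma_eq_map] at hm ⊢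
  rw [integral_map measurable_param.aemeasurable hm, chartMeasure,
    integral_withDensity_eq_integral_toReal_smul]
  · exact integral_congr_ae (Eventually.of_forall fun p => density_smul_fhIntegrand ε ν ξ f p)
  · exact (measurable_const.div ((measurable_fst.sub measurable_snd).pow_const 2)).ennreal_ofReal
  · exact Eventually.of_forall fun p => ENNReal.ofReal_lt_top

/-! ### The vanishing transform -/

lemma norm_cpow_div_le (ν a b : ℝ) (l m : ℂ) :
    ‖mink (param l m) (toC (spinor a b)) ^ (-1 / 2 - Complex.I * (ν : ℂ)) / (l - m)‖
      ≤ Real.exp (Real.pi * |ν|) * (‖a * l - b‖ ^ (-(1 / 2) : ℝ) * ‖a * m - b‖ ^ (-(1 / 2) : ℝ)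
        * ‖l - m‖ ^ (-(1 / 2) : ℝ)) := by
  rw [norm_div, ← rpow_div_kernel (norm_nonneg _) (norm_nonneg _) (norm_nonneg _), ← mul_div_assoc]
  refine div_le_div_of_nonneg_right ?_ (norm_nonneg _)
  have h := norm_cpow_half_le (mink (param l m) (toC (spinor a b))) ν
  rwa [mink_param_spinor, norm_div, norm_mul, ← mink_param_spinor] at h

lemma ae_mul_sub_ne_zero {a b : ℝ} (hab : 0 < a ^ 2 + b ^ 2) :
    ∀ᵐ p : ℝ × ℝ, a * p.1 - b ≠ 0 ∧ a * p.2 - b ≠ 0 := by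
  have h : ∀ᵐ x : ℝ, a * x - b ≠ 0 := by
    have hs : ({x : ℝ | a * x - b ≠ 0}ᶜ).Subsingleton := by
      intro x hx y hy
      simp only [mem_compl_iff, mem_ofPred_eq, not_not] at hx hy
      by_cases ha : a = 0
      · rw [ha] at hx hab
        have hb : b = 0 := by linarith
        rw [hb] at hab
        norm_num at hab
      · have : a * (x - y) = 0 := by linarith
        rcases mul_eq_zero.1 this with h | h
        · exact absurd h ha
        · linarith
    exact hs.measure_zero _
  exact (Measure.quasiMeasurePreserving_fst.ae h).and (Measure.quasiMeasurePreserving_snd.ae h)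

lemma rpow_neg_half_le_of_le {x y : ℝ} (hx : 0 < x) (hxy : x ≤ y) :
    y ^ (-(1 / 2) : ℝ) ≤ x ^ (-(1 / 2) : ℝ) :=
  Real.rpow_le_rpow_of_nonpos hx hxy (by norm_num)

/-- On a horizontal line above the real axis, the holomorphic Fourier–Helgason kernel times a regular function of the
tube has vanishing integral in `λ`. -/
lemma integral_kernel_fst_eq_zero {G : ℂ × ℂ → ℂ} {g : ℝ × ℝ → ℂ} {c : ℝ}
    (h : BoundaryPair G g c) (ν : ℝ) {ξ : Fin 3 → ℝ} (hξ : ξ ∈ futureCone) {η : ℝ} (hη : 0 < η)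
    {m : ℂ} (hm : m.im < 0) :
    ∫ x : ℝ, mink (param ((x : ℂ) + (η : ℂ) * Complex.I) m) (toC ξ)
      ^ (-1 / 2 - Complex.I * (ν : ℂ)) / ((x : ℂ) + (η : ℂ) * Complex.I - m)
        * G ((x : ℂ) + (η : ℂ) * Complex.I, m) = 0 := by
  obtain ⟨a, b, hab, rfl⟩ := exists_spinor hξ
  have hc := h.const_nonneg
  obtain ⟨κ, R₁, hκ, hκb⟩ : ∃ κ R₁ : ℝ, 0 < κ ∧ ∀ l : ℂ, R₁ ≤ ‖l‖ → κ ≤ ‖(a : ℂ) * l - b‖ := by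
    by_cases ha : a = 0
    · refine ⟨|b|, 0, ?_, fun l _ => ?_⟩
      · rw [abs_pos]; rintro rfl; rw [ha] at hab; norm_num at hab
      · rw [ha]; simp
    · have ha' : 0 < |a| := abs_pos.2 ha
      refine ⟨1, (|b| + 1) / |a|, one_pos, fun l hl => ?_⟩
      rw [div_le_iff₀ ha'] at hl
      have h1 := norm_sub_norm_le ((a : ℂ) * l) b
      rw [norm_mul, Complex.norm_real, Complex.norm_real, Real.norm_eq_abs, Real.norm_eq_abs] at h1
      linarith
  refine integral_line_eq_zero (h := fun l => mink (param l m) (toC (spinor a b))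
    ^ (-1 / 2 - Complex.I * (ν : ℂ)) / (l - m) * G (l, m)) (a := 0) (η := η)
    (C := Real.exp (Real.pi * |ν|) * (κ ^ (-(1 / 2) : ℝ) * ‖a * m - b‖ ^ (-(1 / 2) : ℝ)
      * 2 ^ (1 / 2 : ℝ)) * c) (R₀ := max R₁ (2 * ‖m‖ + 1)) hη ?_ ?_
  · have hlm : ∀ l : ℂ, 0 < l.im → l - m ≠ 0 := by
      intro l hl h0
      have := congrArg Complex.im h0
      simp at this
      linarith
    refine DifferentiableOn.mul (DifferentiableOn.div ?_ (by fun_prop) fun l hl => hlm l hl)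
      (h.differentiableOn_fst hm)
    refine DifferentiableOn.cpow_const ?_ ?_
    · simp_rw [mink_param_spinor]
      exact DifferentiableOn.div (by fun_prop) (by fun_prop) fun l hl => hlm l hl
    · intro l hl
      exact Or.inr (im_mink_param_neg hl hm (spinor_mem hab)).ne
  · intro l hl hR
    have hlpos : 0 < l.im := hη.trans_le hl
    have hR1 := (le_max_left _ _).trans hR
    have hR2 := (le_max_right _ _).trans hR
    have hl0 : 0 < ‖l‖ := by linarith [norm_nonneg m]
    have e1 : ‖l‖ / 2 ≤ ‖l - m‖ := by linarith [norm_sub_norm_le l m]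
    have b1 := rpow_neg_half_le_of_le hκ (hκb l hR1)
    have b2 := rpow_neg_half_le_of_le (by positivity) e1
    have b3 : (‖l‖ / 2) ^ (-(1 / 2) : ℝ) = 2 ^ (1 / 2 : ℝ) * ‖l‖ ^ (-(1 / 2) : ℝ) := by
      rw [Real.div_rpow hl0.le (by norm_num), Real.rpow_neg (by norm_num : (0 : ℝ) ≤ 2),
        div_inv_eq_mul, mul_comm]
    have b4 : ‖G (l, m)‖ ≤ c * ‖l‖⁻¹ := by
      refine (h.bound_fst hlpos hm).trans (mul_le_mul_of_nonneg_left ?_ hc)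
      exact inv_anti₀ hl0 (by linarith)
    rw [b3] at b2
    rw [norm_mul]
    have b5 : ‖l‖ ^ (-(1 / 2) : ℝ) * ‖l‖⁻¹ = ‖l‖ ^ (-(3 / 2) : ℝ) := by
      rw [← Real.rpow_neg_one, ← Real.rpow_add hl0]; norm_num
    calc _ ≤ (Real.exp (Real.pi * |ν|) * (κ ^ (-(1 / 2) : ℝ) * ‖a * m - b‖ ^ (-(1 / 2) : ℝ)
          * (2 ^ (1 / 2 : ℝ) * ‖l‖ ^ (-(1 / 2) : ℝ)))) * (c * ‖l‖⁻¹) := by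
          refine mul_le_mul ((norm_cpow_div_le ν a b l m).trans ?_) b4 (norm_nonneg _)
            (by positivity)
          gcongr
      _ = _ := by rw [← b5]; ring

lemma tendsto_lift {ι : Type*} {F : Filter ι} {η : ι → ℝ} (hη : Tendsto η F (𝓝 0)) (p : ℝ × ℝ) :
    Tendsto (fun n => (lift (η n) p).1) F (𝓝 (p.1 : ℂ)) ∧
      Tendsto (fun n => (lift (η n) p).2) F (𝓝 (p.2 : ℂ)) := by
  have hηc : Tendsto (fun n => ((η n : ℝ) : ℂ)) F (𝓝 ((0 : ℝ) : ℂ)) :=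
    (Complex.continuous_ofReal.tendsto _).comp hη
  constructor
  · have := (hηc.mul_const Complex.I).const_add (p.1 : ℂ)
    simpa [lift] using this
  · have := (hηc.mul_const Complex.I).const_sub (p.2 : ℂ)
    simpa [lift] using this

lemma ofReal_mink_param_spinor (p : ℝ × ℝ) (a b : ℝ) :
    ((mink (param p.1 p.2) (spinor a b) : ℝ) : ℂ)
      = (a * p.1 - b) * (a * p.2 - b) / ((p.1 : ℂ) - p.2) := by
  rw [mink_param_spinor_real]; push_cast; ring

/-- The transform whose kernel is the boundary value of a holomorphic function on the tube of `G`
vanishes. -/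
theorem BoundaryPair.integral_chartKernel_neg_one {G : ℂ × ℂ → ℂ} {g : ℝ × ℝ → ℂ} {c : ℝ}
    (h : BoundaryPair G g c) (ν : ℝ) {ξ : Fin 3 → ℝ} (hξ : ξ ∈ futureCone) :
    ∫ p, chartKernel (-1) ν ξ p * g p = 0 := by
  obtain ⟨η, hηpos, hη0, hlim⟩ := h.approx
  have hzero : ∀ n, ∫ p : ℝ × ℝ, mink (param (lift (η n) p).1 (lift (η n) p).2) (toC ξ)
      ^ (-1 / 2 - Complex.I * (ν : ℂ)) / ((lift (η n) p).1 - (lift (η n) p).2)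
        * G (lift (η n) p) = 0 := by
    intro n
    by_cases hint : Integrable fun p : ℝ × ℝ =>
      mink (param (lift (η n) p).1 (lift (η n) p).2) (toC ξ)
      ^ (-1 / 2 - Complex.I * (ν : ℂ)) / ((lift (η n) p).1 - (lift (η n) p).2)
        * G (lift (η n) p)
    · rw [Measure.volume_eq_prod] at hint ⊢
      rw [integral_prod_symm _ hint]
      have : ∀ y : ℝ, ∫ x : ℝ, mink (param (lift (η n) (x, y)).1 (lift (η n) (x, y)).2) (toC ξ)
        ^ (-1 / 2 - Complex.I * (ν : ℂ)) / ((lift (η n) (x, y)).1 - (lift (η n) (x, y)).2)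
          * G (lift (η n) (x, y)) = 0 := fun y =>
        integral_kernel_fst_eq_zero h ν hξ (hηpos n)
          (m := (y : ℂ) - ((η n : ℝ) : ℂ) * Complex.I) (by simpa using hηpos n)
      simp_rw [this, integral_zero]
    -- the integral of a function that is not integrable is zero by convention
    · exact integral_undef hint
  obtain ⟨a, b, hab, rfl⟩ := exists_spinor hξ
  have hc := h.const_nonneg
  have ht : Tendsto (fun n => ∫ p : ℝ × ℝ,
      mink (param (lift (η n) p).1 (lift (η n) p).2) (toC (spinor a b))
      ^ (-1 / 2 - Complex.I * (ν : ℂ)) / ((lift (η n) p).1 - (lift (η n) p).2)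
        * G (lift (η n) p)) atTop (𝓝 (∫ p, chartKernel (-1) ν (spinor a b) p * g p)) := by
    refine tendsto_integral_filter_of_dominated_convergence
      (fun p => Real.exp (Real.pi * |ν|) * c * majorant a b p) ?_ ?_
      ((integrable_majorant hab).const_mul _) ?_
    · refine Eventually.of_forall fun n => Continuous.aestronglyMeasurable ?_
      have hl := fun p => mem_tube_iff.1 (lift_mem (hηpos n) p)
      have hd : ∀ p, (lift (η n) p).1 - (lift (η n) p).2 ≠ 0 := by
        intro p h0
        have := congrArg Complex.im h0
        have h1 := hl p
        simp only [Complex.sub_im, Complex.zero_im] at this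
        linarith
      refine (Continuous.div ?_ (by fun_prop) hd).mul (h.continuous_lift_comp (hηpos n))
      refine Continuous.cpow ?_ continuous_const fun p =>
        Or.inr (im_mink_param_neg (hl p).1 (hl p).2 hξ).ne
      simp_rw [mink_param_spinor]
      exact Continuous.div (by fun_prop) (by fun_prop) hd
    · refine Eventually.of_forall fun n => ?_
      filter_upwards [ae_mul_sub_ne_zero hab, ae_fst_ne_snd] with p hp hp'
      rw [norm_mul]
      refine (mul_le_mul (norm_cpow_div_le ν a b _ _) (h.bound_lift (hηpos n) p) (norm_nonneg _)
        (by positivity)).trans ?_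
      unfold majorant
      have r1 : |a * p.1 - b| ≤ ‖(a : ℂ) * (lift (η n) p).1 - b‖ := by
        simpa [lift] using Complex.abs_re_le_norm ((a : ℂ) * (lift (η n) p).1 - b)
      have r2 : |a * p.2 - b| ≤ ‖(a : ℂ) * (lift (η n) p).2 - b‖ := by
        simpa [lift] using Complex.abs_re_le_norm ((a : ℂ) * (lift (η n) p).2 - b)
      have r3 : |p.1 - p.2| ≤ ‖(lift (η n) p).1 - (lift (η n) p).2‖ := by
        simpa [lift] using Complex.abs_re_le_norm ((lift (η n) p).1 - (lift (η n) p).2)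
      have s1 := rpow_neg_half_le_of_le (abs_pos.2 hp.1) r1
      have s2 := rpow_neg_half_le_of_le (abs_pos.2 hp.2) r2
      have s3 := rpow_neg_half_le_of_le (abs_pos.2 (sub_ne_zero.2 hp')) r3
      calc _ ≤ Real.exp (Real.pi * |ν|) * (|a * p.1 - b| ^ (-(1 / 2) : ℝ) *
            |a * p.2 - b| ^ (-(1 / 2) : ℝ) * |p.1 - p.2| ^ (-(1 / 2) : ℝ)) *
              (c * ((1 + |p.1|)⁻¹ * (1 + |p.2|)⁻¹)) := by gcongr
        _ = _ := by ring
    · filter_upwards [hlim, ae_mul_sub_ne_zero hab, ae_fst_ne_snd] with p hp hp1 hp2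
      obtain ⟨e1, e2⟩ := tendsto_lift hη0 p
      have hpd : (p.1 : ℂ) - p.2 ≠ 0 := by
        rw [← Complex.ofReal_sub]; exact_mod_cast sub_ne_zero.2 hp2
      refine Tendsto.mul ?_ hp
      unfold chartKernel
      rw [Complex.ofReal_sub]
      refine Tendsto.div ?_ (e1.sub e2) hpd
      refine tendsto_cpow_lower ?_ (exponent_ne_zero ν) ?_ ?_
      · rw [mink_param_spinor_real]
        exact div_ne_zero (mul_ne_zero hp1.1 hp1.2) (sub_ne_zero.2 hp2)
      · simp_rw [mink_param_spinor]
        rw [ofReal_mink_param_spinor]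
        exact Tendsto.div (((e1.const_mul _).sub_const _).mul ((e2.const_mul _).sub_const _))
          (e1.sub e2) hpd
      · refine Eventually.of_forall fun n => ?_
        have hl := mem_tube_iff.1 (lift_mem (hηpos n) p)
        exact im_mink_param_neg hl.1 hl.2 hξ
  refine tendsto_nhds_unique ht ?_
  simp_rw [hzero]
  exact tendsto_const_nhds

/-! ### Regularisation of the transform -/

/-- The real point `x = tan φ` moved to `tan (φ - i artanh τ)`. Unlike a translation, this keeps a
uniform distance to the real line near infinity as well. -/
def regPoint (τ x : ℝ) : ℂ := (x - Complex.I * τ) / (1 + Complex.I * τ * x)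

/-- The denominator `λ - μ` of the regularised point, up to the factor
`(1 + iτλ) (1 - iτμ)`. -/
def regDen (τ : ℝ) (p : ℝ × ℝ) : ℂ :=
  (1 + τ ^ 2) * ((p.1 : ℂ) - p.2) - 2 * Complex.I * τ * (1 + p.1 * p.2)

/-- The point of `𝒯⁺` near the real point with coordinates `p`. -/
def regParam (τ : ℝ) (p : ℝ × ℝ) : Fin 3 → ℂ := param (regPoint τ p.1) (regPoint (-τ) p.2)

/-- The Fourier–Helgason kernel with the real point moved into `𝒯⁺`. -/
def regKernel (τ ν : ℝ) (ξ : Fin 3 → ℝ) (p : ℝ × ℝ) : ℂ :=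
  mink (regParam τ p) (toC ξ) ^ (-1 / 2 - Complex.I * (ν : ℂ)) / regDen τ p

lemma one_add_I_mul_ne_zero (τ x : ℝ) : (1 : ℂ) + Complex.I * τ * x ≠ 0 := by
  intro h
  have := congrArg Complex.re h
  simp at this

lemma im_regPoint (τ x : ℝ) : (regPoint τ x).im = -(τ * (1 + x ^ 2)) / (1 + (τ * x) ^ 2) := by
  have h : (1 : ℝ) + (τ * x) ^ 2 ≠ 0 := by positivity
  have h2 : Complex.normSq (1 + Complex.I * τ * x) = 1 + (τ * x) ^ 2 := by
    simp [Complex.normSq_apply]; ring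
  unfold regPoint
  rw [Complex.div_im, h2]
  simp
  field_simp
  ring

lemma im_regPoint_neg {τ : ℝ} (hτ : 0 < τ) (x : ℝ) : (regPoint τ x).im < 0 := by
  rw [im_regPoint, neg_div]
  have : 0 < τ * (1 + x ^ 2) / (1 + (τ * x) ^ 2) := by positivity
  linarith

lemma im_regPoint_pos {τ : ℝ} (hτ : 0 < τ) (x : ℝ) : 0 < (regPoint (-τ) x).im := by
  rw [im_regPoint]
  have : 0 < τ * (1 + x ^ 2) / (1 + (-τ * x) ^ 2) := by positivity
  rwa [neg_mul, neg_neg]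

lemma regPoint_sub (τ : ℝ) (p : ℝ × ℝ) : regPoint τ p.1 - regPoint (-τ) p.2
    = regDen τ p / ((1 + Complex.I * τ * p.1) * (1 - Complex.I * τ * p.2)) := by
  have h1 := one_add_I_mul_ne_zero τ p.1
  have h2 := one_add_I_mul_ne_zero (-τ) p.2
  have h3 : (1 : ℂ) - Complex.I * τ * p.2 ≠ 0 := by
    convert h2 using 1; push_cast; ring
  unfold regPoint regDen
  push_cast at h2 ⊢
  rw [div_sub_div _ _ h1 h2]
  have e : (1 : ℂ) + Complex.I * -(τ : ℂ) * p.2 = 1 - Complex.I * τ * p.2 := by ring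
  rw [e]
  congr 1
  linear_combination (-(τ : ℂ) ^ 2 * (p.1 - p.2)) * Complex.I_sq

lemma mink_regParam (τ a b : ℝ) (p : ℝ × ℝ) :
    mink (regParam τ p) (toC (spinor a b))
      = ((a * p.1 - b : ℝ) - Complex.I * (τ * (a + b * p.1) : ℝ)) *
        ((a * p.2 - b : ℝ) + Complex.I * (τ * (a + b * p.2) : ℝ)) / regDen τ p := by
  have h1 := one_add_I_mul_ne_zero τ p.1
  have h2 := one_add_I_mul_ne_zero (-τ) p.2
  have e : (1 : ℂ) + Complex.I * ((-τ : ℝ) : ℂ) * p.2 = 1 - Complex.I * τ * p.2 := by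
    push_cast; ring
  rw [e] at h2
  have e1 : (a : ℂ) * regPoint τ p.1 - b = ((a * p.1 - b : ℝ) - Complex.I * (τ * (a + b * p.1) : ℝ))
      / (1 + Complex.I * τ * p.1) := by
    rw [eq_div_iff h1, sub_mul, regPoint, mul_assoc, div_mul_cancel₀ _ h1]
    push_cast; ring
  have e2 : (a : ℂ) * regPoint (-τ) p.2 - b
      = ((a * p.2 - b : ℝ) + Complex.I * (τ * (a + b * p.2) : ℝ)) / (1 - Complex.I * τ * p.2) := by
    rw [eq_div_iff h2, sub_mul, regPoint, e, mul_assoc, div_mul_cancel₀ _ h2]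
    push_cast; ring
  rw [regParam, mink_param_spinor, regPoint_sub, e1, e2, div_mul_div_comm,
    div_div_div_cancel_right₀ (mul_ne_zero h1 h2)]

lemma abs_le_norm_sub_I_mul (x y : ℝ) : |x| ≤ ‖(x : ℂ) - Complex.I * y‖ := by
  simpa using Complex.abs_re_le_norm ((x : ℂ) - Complex.I * y)

lemma abs_le_norm_add_I_mul (x y : ℝ) : |x| ≤ ‖(x : ℂ) + Complex.I * y‖ := by
  simpa using Complex.abs_re_le_norm ((x : ℂ) + Complex.I * y)

lemma abs_le_norm_regDen (τ : ℝ) (p : ℝ × ℝ) : |p.1 - p.2| ≤ ‖regDen τ p‖ := by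
  have e : regDen τ p = (((1 + τ ^ 2) * (p.1 - p.2) : ℝ) : ℂ)
      - Complex.I * (2 * τ * (1 + p.1 * p.2) : ℝ) := by
    unfold regDen; push_cast; ring
  rw [e]
  refine le_trans ?_ (abs_le_norm_sub_I_mul _ _)
  rw [abs_mul]
  refine le_mul_of_one_le_left (abs_nonneg _) ?_
  rw [abs_of_pos (by positivity)]
  nlinarith [sq_nonneg τ]

lemma norm_regKernel_le (τ ν a b : ℝ) (p : ℝ × ℝ) : ‖regKernel τ ν (spinor a b) p‖
    ≤ Real.exp (Real.pi * |ν|) *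
      (‖((a * p.1 - b : ℝ) : ℂ) - Complex.I * (τ * (a + b * p.1) : ℝ)‖ ^ (-(1 / 2) : ℝ) *
        ‖((a * p.2 - b : ℝ) : ℂ) + Complex.I * (τ * (a + b * p.2) : ℝ)‖ ^ (-(1 / 2) : ℝ) *
        ‖regDen τ p‖ ^ (-(1 / 2) : ℝ)) := by
  unfold regKernel
  rw [norm_div, ← rpow_div_kernel (norm_nonneg _) (norm_nonneg _) (norm_nonneg _), ← mul_div_assoc]
  refine div_le_div_of_nonneg_right ?_ (norm_nonneg _)
  have h := norm_cpow_half_le (mink (regParam τ p) (toC (spinor a b))) ν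
  refine h.trans (le_of_eq ?_)
  rw [mink_regParam, norm_div, norm_mul]

/-- A bound uniform in `τ`: each of the three linear factors is at least as large as its real part,
which is the corresponding factor of the majorant. -/
lemma norm_regKernel_mul_le (τ ν : ℝ) {a b c : ℝ} {p : ℝ × ℝ} {w : ℂ}
    (hp : a * p.1 - b ≠ 0 ∧ a * p.2 - b ≠ 0) (hp' : p.1 ≠ p.2)
    (hw : ‖w‖ ≤ c * (1 + |p.1|)⁻¹ * (1 + |p.2|)⁻¹) :
    ‖regKernel τ ν (spinor a b) p * w‖ ≤ Real.exp (Real.pi * |ν|) * c * majorant a b p := by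
  rw [norm_mul]
  refine (mul_le_mul (norm_regKernel_le τ ν a b p) hw (norm_nonneg _) (by positivity)).trans ?_
  have s1 := rpow_neg_half_le_of_le (abs_pos.2 hp.1)
    (abs_le_norm_sub_I_mul (a * p.1 - b) (τ * (a + b * p.1)))
  have s2 := rpow_neg_half_le_of_le (abs_pos.2 hp.2)
    (abs_le_norm_add_I_mul (a * p.2 - b) (τ * (a + b * p.2)))
  have s3 := rpow_neg_half_le_of_le (abs_pos.2 (sub_ne_zero.2 hp')) (abs_le_norm_regDen τ p)
  have hw0 : 0 ≤ c * (1 + |p.1|)⁻¹ * (1 + |p.2|)⁻¹ := (norm_nonneg _).trans hw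
  unfold majorant
  calc _ ≤ Real.exp (Real.pi * |ν|) * (|a * p.1 - b| ^ (-(1 / 2) : ℝ) *
        |a * p.2 - b| ^ (-(1 / 2) : ℝ) * |p.1 - p.2| ^ (-(1 / 2) : ℝ)) *
          (c * (1 + |p.1|)⁻¹ * (1 + |p.2|)⁻¹) := by gcongr
    _ = _ := by ring

lemma regDen_ne_zero {τ : ℝ} (hτ : 0 < τ) (p : ℝ × ℝ) : regDen τ p ≠ 0 := by
  intro h0
  have h1 := regPoint_sub τ p
  rw [h0, zero_div, sub_eq_zero] at h1
  have h2 := im_regPoint_neg hτ p.1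
  rw [h1] at h2
  exact absurd (im_regPoint_pos hτ p.2) (not_lt.2 h2.le)

/-- The transform with the real point moved into `𝒯⁺`. -/
def regTransform (τ : ℝ) (g : ℝ × ℝ → ℂ) (ν : ℝ) (ξ : Fin 3 → ℝ) : ℂ :=
  ∫ p, regKernel τ ν ξ p * g p

lemma im_mink_regParam_pos {τ : ℝ} (hτ : 0 < τ) (p : ℝ × ℝ) {ξ : Fin 3 → ℝ}
    (hξ : ξ ∈ futureCone) : 0 < (mink (regParam τ p) (toC ξ)).im :=
  im_mink_param_pos (im_regPoint_neg hτ _) (im_regPoint_pos hτ _) hξ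

lemma continuous_regPoint (τ : ℝ) : Continuous (regPoint τ) := by
  unfold regPoint
  exact Continuous.div (by fun_prop) (by fun_prop) fun x => one_add_I_mul_ne_zero τ x

lemma continuous_regDen (τ : ℝ) : Continuous (regDen τ) := by
  unfold regDen; fun_prop

lemma continuous_regParam {τ : ℝ} (hτ : 0 < τ) : Continuous (regParam τ) := by
  have hd : ∀ p : ℝ × ℝ, regPoint τ p.1 - regPoint (-τ) p.2 ≠ 0 := by
    intro p h0
    have := congrArg Complex.im h0
    simp only [Complex.sub_im, Complex.zero_im] at this
    linarith [im_regPoint_neg hτ p.1, im_regPoint_pos hτ p.2]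
  have c1 : Continuous fun p : ℝ × ℝ => regPoint τ p.1 := (continuous_regPoint τ).comp continuous_fst
  have c2 : Continuous fun p : ℝ × ℝ => regPoint (-τ) p.2 :=
    (continuous_regPoint (-τ)).comp continuous_snd
  unfold regParam
  refine continuous_pi fun i => ?_
  fin_cases i
  · exact (continuous_const.add (c1.mul c2)).div (c1.sub c2) hd
  · exact (continuous_const.sub (c1.mul c2)).div (c1.sub c2) hd
  · exact (c1.add c2).div (c1.sub c2) hd

lemma continuous_mink_toC : Continuous fun q : (Fin 3 → ℂ) × (Fin 3 → ℝ) =>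
    mink q.1 (toC q.2) := by
  unfold mink toC; fun_prop

lemma continuous_regKernel {τ : ℝ} (hτ : 0 < τ) (ν : ℝ) {ξ : Fin 3 → ℝ} (hξ : ξ ∈ futureCone) :
    Continuous (regKernel τ ν ξ) := by
  unfold regKernel
  refine Continuous.div ?_ (continuous_regDen τ) (regDen_ne_zero hτ)
  refine Continuous.cpow ?_ continuous_const fun p => Or.inr (im_mink_regParam_pos hτ p hξ).ne'
  exact continuous_mink_toC.comp ((continuous_regParam hτ).prodMk continuous_const)

/-- A bound of the transform uniform in the regularisation, away from the tip of the cone. -/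
lemma exists_norm_regTransform_le {g : ℝ × ℝ → ℂ} {c ρ : ℝ} (hc : 0 ≤ c) (hρ : 0 < ρ)
    (hb : ∀ᵐ p : ℝ × ℝ, ‖g p‖ ≤ c * (1 + |p.1|)⁻¹ * (1 + |p.2|)⁻¹) :
    ∃ B, 0 ≤ B ∧ ∀ τ ν : ℝ, ∀ ξ ∈ futureCone, ρ ≤ ξ 0 →
      ‖regTransform τ g ν ξ‖ ≤ B * Real.exp (Real.pi * |ν|) := by
  obtain ⟨C, hC0, hC⟩ := exists_integral_majorant_le (ρ := 2 * ρ) (by linarith)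
  refine ⟨c * C, mul_nonneg hc hC0, fun τ ν ξ hξ hξρ => ?_⟩
  obtain ⟨a, b, hab, rfl⟩ := exists_spinor hξ
  have hab' : 2 * ρ ≤ a ^ 2 + b ^ 2 := by
    simp only [spinor, Matrix.cons_val] at hξρ
    linarith
  have h1 : ‖regTransform τ g ν (spinor a b)‖
      ≤ ∫ p, Real.exp (Real.pi * |ν|) * c * majorant a b p := by
    refine norm_integral_le_of_norm_le ((integrable_majorant hab).const_mul _) ?_
    filter_upwards [hb, ae_mul_sub_ne_zero hab, ae_fst_ne_snd] with p h1 h2 h3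
    exact norm_regKernel_mul_le τ ν h2 h3 h1
  rw [integral_const_mul] at h1
  refine h1.trans ?_
  have := mul_le_mul_of_nonneg_left (hC a b hab')
    (mul_nonneg (Real.exp_nonneg (Real.pi * |ν|)) hc)
  linarith

/-- The regularised transform converges to the transform. -/
lemma tendsto_regTransform {g : ℝ × ℝ → ℂ} {c : ℝ} (hg : AEStronglyMeasurable g)
    (hb : ∀ᵐ p : ℝ × ℝ, ‖g p‖ ≤ c * (1 + |p.1|)⁻¹ * (1 + |p.2|)⁻¹) (ν : ℝ) {ξ : Fin 3 → ℝ}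
    (hξ : ξ ∈ futureCone) :
    Tendsto (fun τ => regTransform τ g ν ξ) (𝓝[>] 0) (𝓝 (∫ p, chartKernel 1 ν ξ p * g p)) := by
  obtain ⟨a, b, hab, rfl⟩ := exists_spinor hξ
  refine tendsto_integral_filter_of_dominated_convergence
    (fun p => Real.exp (Real.pi * |ν|) * c * majorant a b p) ?_ ?_
    ((integrable_majorant hab).const_mul _) ?_
  · filter_upwards [self_mem_nhdsWithin] with τ hτ
    exact (continuous_regKernel hτ ν hξ).aestronglyMeasurable.mul hg
  · refine Eventually.of_forall fun τ => ?_
    filter_upwards [hb, ae_mul_sub_ne_zero hab, ae_fst_ne_snd] with p h1 h2 h3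
    exact norm_regKernel_mul_le τ ν h2 h3 h1
  · filter_upwards [ae_mul_sub_ne_zero hab, ae_fst_ne_snd] with p hp1 hp2
    refine Tendsto.mul_const _ ?_
    have hpd : (p.1 : ℂ) - p.2 ≠ 0 := by
      rw [← Complex.ofReal_sub]; exact_mod_cast sub_ne_zero.2 hp2
    have hden : Tendsto (fun τ => regDen τ p) (𝓝[>] 0) (𝓝 ((p.1 : ℂ) - p.2)) := by
      have hcont : Continuous fun τ : ℝ => regDen τ p := by unfold regDen; fun_prop
      have := (hcont.tendsto 0).mono_left (nhdsWithin_le_nhds (s := Ioi 0))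
      simpa [regDen] using this
    unfold regKernel chartKernel
    rw [Complex.ofReal_sub]
    refine Tendsto.div ?_ hden hpd
    rw [bvPow_one _ (exponent_ne_zero ν)]
    refine tendsto_cpow_upper ?_ _ ?_ ?_
    · rw [mink_param_spinor_real]
      exact div_ne_zero (mul_ne_zero hp1.1 hp1.2) (sub_ne_zero.2 hp2)
    · simp_rw [mink_regParam]
      rw [ofReal_mink_param_spinor]
      refine Tendsto.div ?_ hden hpd
      have hcont : Continuous fun τ : ℝ =>
          (((a * p.1 - b : ℝ) : ℂ) - Complex.I * (τ * (a + b * p.1) : ℝ)) *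
            ((a * p.2 - b : ℝ) + Complex.I * (τ * (a + b * p.2) : ℝ)) := by fun_prop
      have := (hcont.tendsto 0).mono_left (nhdsWithin_le_nhds (s := Ioi 0))
      simpa using this
    · filter_upwards [self_mem_nhdsWithin] with τ hτ
      exact (im_mink_regParam_pos hτ p hξ).le

/-- For a fixed regularisation, a bound of the kernel that depends on `ξ` only through `ξ₀`. -/
lemma norm_regKernel_mul_le_of_pos {τ : ℝ} (hτ : 0 < τ) (hτ1 : τ ≤ 1) (ν : ℝ) {ξ : Fin 3 → ℝ}
    (hξ : ξ ∈ futureCone) {ρ : ℝ} (hρ : 0 < ρ) (hξρ : ρ ≤ ξ 0) {c : ℝ} (hc : 0 ≤ c) {p : ℝ × ℝ}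
    {w : ℂ} (hw : ‖w‖ ≤ c * (1 + |p.1|)⁻¹ * (1 + |p.2|)⁻¹) :
    ‖regKernel τ ν ξ p * w‖ ≤ c * (4 * τ ^ 3 * ρ) ^ (-(1 / 2) : ℝ) * Real.exp (Real.pi * |ν|) *
      ((1 + p.1 ^ 2)⁻¹ * (1 + p.2 ^ 2)⁻¹) := by
  obtain ⟨a, b, hab, rfl⟩ := exists_spinor hξ
  have hab' : 2 * ρ ≤ a ^ 2 + b ^ 2 := by
    simp only [spinor, Matrix.cons_val] at hξρ
    linarith
  set X : ℝ := 1 + p.1 ^ 2 with hX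
  set Y : ℝ := 1 + p.2 ^ 2 with hY
  have hX0 : 0 < X := by positivity
  have hY0 : 0 < Y := by positivity
  have hpow : ∀ r : ℝ, 0 ≤ r → r ^ (-(1 / 2) : ℝ) = (r ^ 2) ^ (-(1 / 4) : ℝ) := fun r hr => by
    rw [← Real.rpow_natCast, ← Real.rpow_mul hr]; norm_num
  have hτ2 : τ ^ 2 ≤ 1 := by nlinarith
  have q1 : τ ^ 2 * (2 * ρ) * X
      ≤ ‖((a * p.1 - b : ℝ) : ℂ) - Complex.I * (τ * (a + b * p.1) : ℝ)‖ ^ 2 := by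
    rw [← Complex.normSq_eq_norm_sq, Complex.normSq_apply]
    simp
    have : τ ^ 2 * (2 * ρ) * X ≤ τ ^ 2 * ((a ^ 2 + b ^ 2) * X) := by
      rw [mul_assoc]; gcongr
    refine this.trans ?_
    have h2 : (a ^ 2 + b ^ 2) * X = (a * p.1 - b) ^ 2 + (a + b * p.1) ^ 2 := by rw [hX]; ring
    rw [h2]
    nlinarith [sq_nonneg (a * p.1 - b)]
  have q2 : τ ^ 2 * (2 * ρ) * Y
      ≤ ‖((a * p.2 - b : ℝ) : ℂ) + Complex.I * (τ * (a + b * p.2) : ℝ)‖ ^ 2 := by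
    rw [← Complex.normSq_eq_norm_sq, Complex.normSq_apply]
    simp
    have : τ ^ 2 * (2 * ρ) * Y ≤ τ ^ 2 * ((a ^ 2 + b ^ 2) * Y) := by
      rw [mul_assoc]; gcongr
    refine this.trans ?_
    have h2 : (a ^ 2 + b ^ 2) * Y = (a * p.2 - b) ^ 2 + (a + b * p.2) ^ 2 := by rw [hY]; ring
    rw [h2]
    nlinarith [sq_nonneg (a * p.2 - b)]
  have q3 : 4 * τ ^ 2 * (X * Y) ≤ ‖regDen τ p‖ ^ 2 := by
    have e : regDen τ p = (((1 + τ ^ 2) * (p.1 - p.2) : ℝ) : ℂ)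
        - Complex.I * (2 * τ * (1 + p.1 * p.2) : ℝ) := by
      unfold regDen; push_cast; ring
    rw [e, ← Complex.normSq_eq_norm_sq, Complex.normSq_apply, Complex.sub_re, Complex.sub_im,
      Complex.ofReal_re, Complex.ofReal_im, Complex.re_mul_ofReal, Complex.im_mul_ofReal,
      Complex.I_re, Complex.I_im]
    have h2 : X * Y = (p.1 - p.2) ^ 2 + (1 + p.1 * p.2) ^ 2 := by rw [hX, hY]; ring
    rw [h2]
    nlinarith [mul_nonneg (sq_nonneg (1 - τ ^ 2)) (sq_nonneg (p.1 - p.2))]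
  have hmain := norm_regKernel_le τ ν a b p
  have anti : ∀ r s : ℝ, 0 < r → 0 ≤ s → r ≤ s ^ 2 → s ^ (-(1 / 2) : ℝ) ≤ r ^ (-(1 / 4) : ℝ) :=
    fun r s hr hs h => by
      rw [hpow s hs]; exact Real.rpow_le_rpow_of_nonpos hr h (by norm_num)
  have s1 := anti _ _ (by positivity) (norm_nonneg _) q1
  have s2 := anti _ _ (by positivity) (norm_nonneg _) q2
  have s3 := anti _ _ (by positivity) (norm_nonneg _) q3
  have hw2 : ‖w‖ ≤ c * (X ^ (-(1 / 2) : ℝ) * Y ^ (-(1 / 2) : ℝ)) := by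
    refine hw.trans ?_
    rw [mul_assoc]
    have h1 := inv_one_add_abs_le p.1
    have h2 := inv_one_add_abs_le p.2
    gcongr
  have hcomb : (τ ^ 2 * (2 * ρ) * X) ^ (-(1 / 4) : ℝ) * (τ ^ 2 * (2 * ρ) * Y) ^ (-(1 / 4) : ℝ) *
      (4 * τ ^ 2 * (X * Y)) ^ (-(1 / 4) : ℝ) * (X ^ (-(1 / 2) : ℝ) * Y ^ (-(1 / 2) : ℝ))
      = (4 * τ ^ 3 * ρ) ^ (-(1 / 2) : ℝ) * (X⁻¹ * Y⁻¹) := by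
    have e1 : (4 * τ ^ 3 * ρ) ^ (-(1 / 2) : ℝ)
        = (τ ^ 2 * (2 * ρ) * (τ ^ 2 * (2 * ρ)) * (4 * τ ^ 2)) ^ (-(1 / 4) : ℝ) := by
      rw [hpow _ (by positivity)]
      congr 1; ring
    have e2 : X⁻¹ = X ^ (-(1 / 4) : ℝ) * X ^ (-(1 / 4) : ℝ) * X ^ (-(1 / 2) : ℝ) := by
      rw [← Real.rpow_add hX0, ← Real.rpow_add hX0, ← Real.rpow_neg_one]; norm_num
    have e3 : Y⁻¹ = Y ^ (-(1 / 4) : ℝ) * Y ^ (-(1 / 4) : ℝ) * Y ^ (-(1 / 2) : ℝ) := by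
      rw [← Real.rpow_add hY0, ← Real.rpow_add hY0, ← Real.rpow_neg_one]; norm_num
    rw [e1, e2, e3, Real.mul_rpow (x := τ ^ 2 * (2 * ρ)) (y := X) (by positivity) hX0.le,
      Real.mul_rpow (x := τ ^ 2 * (2 * ρ)) (y := Y) (by positivity) hY0.le,
      Real.mul_rpow (x := 4 * τ ^ 2) (y := X * Y) (by positivity) (by positivity),
      Real.mul_rpow hX0.le hY0.le,
      Real.mul_rpow (x := τ ^ 2 * (2 * ρ) * (τ ^ 2 * (2 * ρ))) (by positivity) (by positivity),
      Real.mul_rpow (x := τ ^ 2 * (2 * ρ)) (y := τ ^ 2 * (2 * ρ)) (by positivity) (by positivity)]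
    ring
  rw [norm_mul]
  calc _ ≤ (Real.exp (Real.pi * |ν|) * ((τ ^ 2 * (2 * ρ) * X) ^ (-(1 / 4) : ℝ) *
        (τ ^ 2 * (2 * ρ) * Y) ^ (-(1 / 4) : ℝ) * (4 * τ ^ 2 * (X * Y)) ^ (-(1 / 4) : ℝ))) *
          (c * (X ^ (-(1 / 2) : ℝ) * Y ^ (-(1 / 2) : ℝ))) := by
        refine mul_le_mul (hmain.trans ?_) hw2 (norm_nonneg _) (by positivity)
        gcongr
    _ = c * Real.exp (Real.pi * |ν|) * ((τ ^ 2 * (2 * ρ) * X) ^ (-(1 / 4) : ℝ) *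
        (τ ^ 2 * (2 * ρ) * Y) ^ (-(1 / 4) : ℝ) * (4 * τ ^ 2 * (X * Y)) ^ (-(1 / 4) : ℝ) *
          (X ^ (-(1 / 2) : ℝ) * Y ^ (-(1 / 2) : ℝ))) := by ring
    _ = _ := by rw [hcomb]; ring

lemma integrable_inv_one_add_sq_prod :
    Integrable fun p : ℝ × ℝ => (1 + p.1 ^ 2)⁻¹ * (1 + p.2 ^ 2)⁻¹ :=
  integrable_inv_one_add_sq.mul_prod integrable_inv_one_add_sq

lemma zero_lt_of_mem_futureCone {ξ : Fin 3 → ℝ} (hξ : ξ ∈ futureCone) : 0 < ξ 0 := by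
  obtain ⟨a, b, hab, rfl⟩ := exists_spinor hξ
  simp only [spinor, Matrix.cons_val]
  linarith

/-- The regularised transform is continuous in `(ν, ξ)`. -/
lemma continuousOn_regTransform {τ : ℝ} (hτ : 0 < τ) (hτ1 : τ ≤ 1) {g : ℝ × ℝ → ℂ} {c : ℝ}
    (hc : 0 ≤ c) (hg : AEStronglyMeasurable g)
    (hb : ∀ᵐ p : ℝ × ℝ, ‖g p‖ ≤ c * (1 + |p.1|)⁻¹ * (1 + |p.2|)⁻¹) :
    ContinuousOn (fun q : ℝ × (Fin 3 → ℝ) => regTransform τ g q.1 q.2) (univ ×ˢ futureCone) := by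
  rintro ⟨ν₀, ξ₀⟩ ⟨-, hξ₀⟩
  have hpos := zero_lt_of_mem_futureCone hξ₀
  have hev : ∀ᶠ q : ℝ × (Fin 3 → ℝ) in 𝓝[univ ×ˢ futureCone] (ν₀, ξ₀),
      q.2 ∈ futureCone ∧ ξ₀ 0 / 2 ≤ q.2 0 ∧ |q.1| ≤ |ν₀| + 1 := by
    have h1 : ∀ᶠ q : ℝ × (Fin 3 → ℝ) in 𝓝 (ν₀, ξ₀), ξ₀ 0 / 2 < q.2 0 :=
      (continuous_const.tendsto (ν₀, ξ₀)).eventually_lt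
        ((by fun_prop : Continuous fun q : ℝ × (Fin 3 → ℝ) => q.2 0).tendsto (ν₀, ξ₀))
        (show ξ₀ 0 / 2 < ξ₀ 0 by linarith)
    have h2 : ∀ᶠ q : ℝ × (Fin 3 → ℝ) in 𝓝 (ν₀, ξ₀), |q.1| < |ν₀| + 1 :=
      ((by fun_prop : Continuous fun q : ℝ × (Fin 3 → ℝ) => |q.1|).tendsto (ν₀, ξ₀)).eventually_lt
        (continuous_const.tendsto (ν₀, ξ₀)) (show |ν₀| < |ν₀| + 1 by linarith)
    filter_upwards [self_mem_nhdsWithin, nhdsWithin_le_nhds h1, nhdsWithin_le_nhds h2]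
      with q hq1 hq2 hq3
    exact ⟨hq1.2, hq2.le, hq3.le⟩
  unfold regTransform
  refine continuousWithinAt_of_dominated
    (bound := fun p => c * (4 * τ ^ 3 * (ξ₀ 0 / 2)) ^ (-(1 / 2) : ℝ) *
      Real.exp (Real.pi * (|ν₀| + 1)) * ((1 + p.1 ^ 2)⁻¹ * (1 + p.2 ^ 2)⁻¹)) ?_ ?_
    (integrable_inv_one_add_sq_prod.const_mul _) ?_
  · filter_upwards [hev] with q hq
    exact (continuous_regKernel hτ q.1 hq.1).aestronglyMeasurable.mul hg
  · filter_upwards [hev] with q hq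
    filter_upwards [hb] with p hp
    refine (norm_regKernel_mul_le_of_pos hτ hτ1 q.1 hq.1 (by linarith) hq.2.1 hc hp).trans ?_
    have := hq.2.2
    have := Real.pi_pos.le
    gcongr
  · refine Eventually.of_forall fun p => ContinuousWithinAt.mul ?_ continuousWithinAt_const
    unfold regKernel
    refine ContinuousWithinAt.div ?_ continuousWithinAt_const (regDen_ne_zero hτ p)
    refine ContinuousAt.continuousWithinAt (ContinuousAt.cpow ?_ ?_ ?_)
    · exact (continuous_mink_toC.comp (continuous_const.prodMk continuous_snd)).continuousAt
    · fun_prop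
    · exact Or.inr (im_mink_regParam_pos hτ p hξ₀).ne'

/-! ### Cycles on the cone -/

lemma norm_add_mul_I_div_of_mem_futureCone {ξ : Fin 3 → ℝ} (hξ : ξ ∈ futureCone) :
    ‖((ξ 1 : ℂ) + ξ 2 * Complex.I) / ξ 0‖ = 1 := by
  have h0 := zero_lt_of_mem_futureCone hξ
  have h1 : ξ 1 ^ 2 + ξ 2 ^ 2 = ξ 0 ^ 2 := by
    have := hξ.1; simp only [mink] at this; linarith
  rw [norm_div, Complex.norm_add_mul_I, h1, Real.sqrt_sq h0.le, Complex.norm_real,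
    Real.norm_of_nonneg h0.le, div_self h0.ne']

lemma mem_futureCone_of_path {p : Fin 3 → ℝ} {γ : Path p p} (hγ : IsCycle γ) (t : ℝ) :
    γ.extend t ∈ futureCone := by
  obtain ⟨H, hH, h0, -, -⟩ := hγ.homotopic
  have := hH (0, projIcc 0 1 zero_le_one t)
  rw [h0] at this
  exact this

/-- Along a loop homotopic to the base circle there is a continuous determination of the angle of
`(ξ₁, ξ₂)`, and it increases by `2π`: the angle is lifted along the whole homotopy through the
covering `ℝ → 𝕊¹`, and the increment, which does not vary along the homotopy, is read off the
base circle. -/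
theorem IsCycle.exists_angle {p : Fin 3 → ℝ} {γ : Path p p} (hγ : IsCycle γ) :
    ∃ θ : ℝ → ℝ, Continuous θ ∧ θ 1 = θ 0 + 2 * Real.pi ∧
      ∀ t, γ.extend t = γ.extend t 0 • ![1, Real.cos (θ t), Real.sin (θ t)] := by
  obtain ⟨H, hH, h0, h1, hl⟩ := hγ.homotopic
  have cov := Circle.isCoveringMap_exp
  -- the direction of `(ξ₁, ξ₂)` along the homotopy, a map to the unit circle
  let U : C(unitInterval × unitInterval, Circle) :=
    ⟨fun q => ⟨((H q 1 : ℂ) + H q 2 * Complex.I) / H q 0, by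
      exact mem_sphere_zero_iff_norm.2 (norm_add_mul_I_div_of_mem_futureCone (hH q))⟩, by
      refine Continuous.subtype_mk ?_ _
      have hc : ∀ i, Continuous fun q => (H q i : ℂ) := fun i => by fun_prop
      exact ((hc 1).add ((hc 2).mul continuous_const)).div (hc 0) fun q => by
        exact_mod_cast (zero_lt_of_mem_futureCone (hH q)).ne'⟩
  have hU : ∀ q, (U q : ℂ) = ((H q 1 : ℂ) + H q 2 * Complex.I) / H q 0 := fun q => rfl
  have hUl : ∀ s, U (s, 0) = U (s, 1) := fun s => by
    apply Subtype.ext; rw [hU, hU, hl s]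
  let U0 : C(unitInterval, Circle) := ⟨fun t => U (0, t), by fun_prop⟩
  obtain ⟨e, he⟩ := Circle.exp_surjective (U0 0)
  let f := cov.liftPath U0 e he.symm
  have hf : ∀ t, U (0, t) = Circle.exp (f t) := fun t =>
    (congrFun (cov.liftPath_lifts U0 e he.symm) t).symm
  let Θ := cov.liftHomotopy U f hf
  have hΘ : ∀ q, Circle.exp (Θ q) = U q := fun q => congrFun (cov.liftHomotopy_lifts U f hf) q
  have hbase : ∀ t : unitInterval, U (1, t) = Circle.exp (2 * Real.pi * t - Real.pi) := fun t => by
    apply Subtype.ext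
    rw [hU, h1, Circle.coe_exp, Complex.exp_mul_I]
    simp [baseCircle, Complex.cos_sub_pi, Complex.sin_sub_pi]
  -- At the end of the homotopy the angle differs from that of the base circle by a constant.
  have hinc1 : Θ (1, 1) = Θ (1, 0) + 2 * Real.pi := by
    have hc : Circle.exp (Θ (1, 0) + Real.pi) = 1 := by
      rw [Circle.exp_add, hΘ, hbase, ← Circle.exp_add]; simp
    have := cov.eq_of_comp_eq (g₁ := fun t : unitInterval => Θ (1, t))
      (g₂ := fun t : unitInterval => (2 * Real.pi * t - Real.pi) + (Θ (1, 0) + Real.pi))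
      (by fun_prop) (by fun_prop) (by
        funext t
        simp only [Function.comp]
        rw [hΘ, hbase, Circle.exp_add _ (Θ (1, 0) + Real.pi), hc, mul_one]) 0 (by simp)
    have := congrFun this 1
    rw [this]; simp only [Icc.coe_one]; ring
  -- The curves `s ↦ Θ (s, 1)` and `s ↦ Θ (s, 0) + 2π` lift the same path and agree at `s = 1`.
  have hinc : Θ (0, 1) = Θ (0, 0) + 2 * Real.pi := by
    have := cov.eq_of_comp_eq (g₁ := fun s : unitInterval => Θ (s, 1))
      (g₂ := fun s : unitInterval => Θ (s, 0) + 2 * Real.pi)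
      (by fun_prop) (by fun_prop) (by
        funext s
        simp only [Function.comp]
        rw [hΘ, ← hUl, Circle.exp_add, hΘ, Circle.exp_two_pi, mul_one]) 1 hinc1
    exact congrFun this 0
  refine ⟨fun t => Θ (0, projIcc 0 1 zero_le_one t), by
    have := continuous_projIcc (h := zero_le_one' ℝ); fun_prop, ?_, fun t => ?_⟩
  · simpa using hinc
  · set q : unitInterval := projIcc 0 1 zero_le_one t
    have hq : γ.extend t = H (0, q) := (h0 q).symm
    have hpos := zero_lt_of_mem_futureCone (hH (0, q))
    have key : Complex.exp (Θ (0, q) * Complex.I) =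
        ((H (0, q) 1 : ℂ) + H (0, q) 2 * Complex.I) / H (0, q) 0 := by
      have := congrArg Subtype.val (hΘ (0, q))
      rwa [hU, Circle.coe_exp] at this
    have hre := congrArg Complex.re key
    have him := congrArg Complex.im key
    rw [Complex.exp_ofReal_mul_I_re, Complex.div_ofReal_re] at hre
    rw [Complex.exp_ofReal_mul_I_im, Complex.div_ofReal_im] at him
    simp only [Complex.add_re, Complex.add_im, Complex.mul_re, Complex.mul_im, Complex.ofReal_re,
      Complex.ofReal_im, Complex.I_re, Complex.I_im] at hre him
    rw [hq]
    ext i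
    fin_cases i
    · simp
    · change H (0, q) 1 = H (0, q) 0 * Real.cos (Θ (0, q))
      rw [hre]; field_simp; ring
    · change H (0, q) 2 = H (0, q) 0 * Real.sin (Θ (0, q))
      rw [him]; field_simp; ring

/-- The angle of a differentiable curve on the cone is differentiable. -/
lemma hasDerivAt_angle {c : ℝ → Fin 3 → ℝ} {θ : ℝ → ℝ} (hθ : Continuous θ)
    (hc : ∀ s, c s = c s 0 • ![1, Real.cos (θ s), Real.sin (θ s)]) (h0 : ∀ s, 0 < c s 0)
    {t : ℝ} {v : Fin 3 → ℝ} (hv : HasDerivAt c v t) :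
    HasDerivAt θ ((c t 1 * v 2 - c t 2 * v 1) / c t 0 ^ 2) t := by
  have hc1 : ∀ s, c s 1 = c s 0 * Real.cos (θ s) := fun s => by
    have := congrFun (hc s) 1; simpa using this
  have hc2 : ∀ s, c s 2 = c s 0 * Real.sin (θ s) := fun s => by
    have := congrFun (hc s) 2; simpa using this
  have hvi := hasDerivAt_pi.1 hv
  -- `S s = sin (θ s - θ t)` is differentiable by its algebraic expression, and `θ` is recovered from it
  -- by `arcsin`, as `|θ s - θ t| < π / 2` near `t`.
  set S : ℝ → ℝ := fun s => (c s 2 * c t 1 - c s 1 * c t 2) / (c s 0 * c t 0) with hS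
  have hSsin : ∀ s, S s = Real.sin (θ s - θ t) := fun s => by
    have := h0 s; have := h0 t
    rw [hS]; simp only [hc1, hc2, Real.sin_sub]
    field_simp
  have hS0 : S t = 0 := by rw [hSsin]; simp
  have hSd : HasDerivAt S ((c t 1 * v 2 - c t 2 * v 1) / c t 0 ^ 2) t := by
    have h0t := (h0 t).ne'
    have := (((hvi 2).mul_const (c t 1)).sub ((hvi 1).mul_const (c t 2))).div
      ((hvi 0).mul_const (c t 0)) (mul_ne_zero h0t h0t)
    refine this.congr_deriv ?_
    simp only [Pi.sub_apply]
    field_simp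
    ring
  have harc : HasDerivAt Real.arcsin 1 (S t) := by
    have := Real.hasDerivAt_arcsin (x := S t) (by rw [hS0]; norm_num) (by rw [hS0]; norm_num)
    simpa [hS0] using this
  have hcomp := (harc.comp t hSd).add_const (θ t)
  rw [one_mul] at hcomp
  refine hcomp.congr_of_eventuallyEq ?_
  have hnear : ∀ᶠ s in 𝓝 t, |θ s - θ t| < Real.pi / 2 := by
    have : Tendsto (fun s => |θ s - θ t|) (𝓝 t) (𝓝 |θ t - θ t|) :=
      ((hθ.tendsto t).sub_const _).abs
    rw [sub_self, abs_zero] at this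
    exact this.eventually_lt_const (by positivity)
  filter_upwards [hnear] with s hs
  rw [abs_lt] at hs
  simp only [Function.comp, hSsin]
  rw [Real.arcsin_sin (by linarith) (by linarith)]
  ring

/-- A piecewise `C¹` path is differentiable with a bounded derivative off a countable set. -/
lemma IsCycle.exists_deriv_bound {p : Fin 3 → ℝ} {γ : Path p p} (hγ : IsCycle γ) :
    ∃ (s : Set ℝ) (M : ℝ), s.Countable ∧
      ∀ t ∈ Ioo (0 : ℝ) 1 \ s, DifferentiableAt ℝ γ.extend t ∧ ‖deriv γ.extend t‖ ≤ M := by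
  obtain ⟨n, τ, hτ, hτ0, hτn, hC⟩ := hγ.piecewise_C1
  have hb : ∀ i, ∃ M : ℝ, i < n → ∀ t ∈ Icc (τ i) (τ (i + 1)),
      ‖derivWithin γ.extend (Icc (τ i) (τ (i + 1))) t‖ ≤ M := fun i => by
    by_cases hi : i < n
    · have hcont := (hC i hi).continuousOn_derivWithin
        (uniqueDiffOn_Icc (hτ (Nat.lt_succ_self i))) le_rfl
      obtain ⟨M, hM⟩ := isCompact_Icc.exists_bound_of_continuousOn hcont
      exact ⟨M, fun _ => hM⟩
    · exact ⟨0, fun h => absurd h hi⟩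
  choose M hM using hb
  refine ⟨range τ, ∑ i ∈ Finset.range n, |M i|, countable_range τ, fun t ht => ?_⟩
  have hex : ∃ k, t < τ k := ⟨n, by rw [hτn]; exact ht.1.2⟩
  classical
  have hk := Nat.find_spec hex
  have hkn : Nat.find hex ≤ n := Nat.find_min' hex (by rw [hτn]; exact ht.1.2)
  obtain ⟨i, hi⟩ : ∃ i, Nat.find hex = i + 1 := by
    refine Nat.exists_eq_succ_of_ne_zero fun h => ?_
    rw [h, hτ0] at hk
    exact absurd hk (not_lt.2 ht.1.1.le)
  rw [hi] at hk hkn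
  have hik : τ i < t := by
    have := Nat.find_min hex (m := i) (by omega)
    exact lt_of_le_of_ne (not_lt.1 this) fun h => ht.2 ⟨i, h⟩
  have hnhds : Icc (τ i) (τ (i + 1)) ∈ 𝓝 t := Icc_mem_nhds hik hk
  have hd := ((hC i (by omega)).differentiableOn one_ne_zero).differentiableAt hnhds
  refine ⟨hd, ?_⟩
  rw [← derivWithin_of_mem_nhds hnhds]
  refine (hM i (by omega) t ⟨hik.le, hk.le⟩).trans ((le_abs_self _).trans ?_)
  exact Finset.single_le_sum (f := fun i => |M i|) (fun _ _ => abs_nonneg _)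
    (Finset.mem_range.2 (by omega))

lemma coneForm_apply (ξ v : Fin 3 → ℝ) :
    coneForm ξ v = 1 / (2 * ξ 0) * (ξ 1 * v 2 - ξ 2 * v 1) := by
  simp [coneForm]

lemma circle_mem_futureCone (α : ℝ) :
    (![1, Real.cos α, Real.sin α] : Fin 3 → ℝ) ∈ futureCone := by
  refine ⟨?_, by simp, fun h => by simpa using congrFun h 0⟩
  simp only [mink, Matrix.cons_val_zero, Matrix.cons_val_one, Matrix.cons_val_two,
    Matrix.head_cons, Matrix.tail_cons]
  have := Real.sin_sq_add_cos_sq α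
  nlinarith

lemma continuous_circle :
    Continuous fun α : ℝ => (![1, Real.cos α, Real.sin α] : Fin 3 → ℝ) := by
  refine continuous_pi fun i => ?_
  fin_cases i
  · exact continuous_const
  · exact Real.continuous_cos
  · exact Real.continuous_sin

/-- The density of `i_Ξ ω` along a path, with respect to its parameter. -/
def formSpeed {p : Fin 3 → ℝ} (γ : Path p p) (t : ℝ) : ℝ :=
  coneForm (γ.extend t) (derivWithin γ.extend (Icc 0 1) t)

lemma curveIntegralFun_coneForm {p : Fin 3 → ℝ} (γ : Path p p) (φ : (Fin 3 → ℝ) → ℂ) (t : ℝ) :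
    curveIntegralFun (fun ξ => (coneForm ξ).smulRight (φ ξ)) γ t =
      (formSpeed γ t : ℂ) * φ (γ.extend t) := by
  rw [curveIntegralFun_def, ContinuousLinearMap.smulRight_apply, Complex.real_smul]
  rfl

lemma formSpeed_eq {p : Fin 3 → ℝ} (γ : Path p p) {t : ℝ} (ht : t ∈ Ioo (0 : ℝ) 1) :
    formSpeed γ t = 1 / (2 * γ.extend t 0) *
      (γ.extend t 1 * deriv γ.extend t 2 - γ.extend t 2 * deriv γ.extend t 1) := by
  rw [formSpeed, derivWithin_of_mem_nhds (Icc_mem_nhds ht.1 ht.2), coneForm_apply]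

lemma aestronglyMeasurable_formSpeed {p : Fin 3 → ℝ} (γ : Path p p) :
    AEStronglyMeasurable (formSpeed γ) (volume.restrict (Icc 0 1)) := by
  rw [← Measure.restrict_congr_set Ioo_ae_eq_Icc]
  have hcγ : ∀ i, StronglyMeasurable fun t => γ.extend t i := fun i =>
    ((continuous_apply i).comp γ.continuous_extend).stronglyMeasurable
  have hmi : ∀ i, StronglyMeasurable (fun t => deriv γ.extend t i) := fun i =>
    (continuous_apply i).comp_stronglyMeasurable (stronglyMeasurable_deriv γ.extend)
  have h : Measurable fun t => 1 / (2 * γ.extend t 0) *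
      (γ.extend t 1 * deriv γ.extend t 2 - γ.extend t 2 * deriv γ.extend t 1) :=
    (measurable_const.div ((hcγ 0).measurable.const_mul 2)).mul
      (((hcγ 1).mul (hmi 2)).sub ((hcγ 2).mul (hmi 1))).measurable
  refine h.aestronglyMeasurable.congr ?_
  filter_upwards [ae_restrict_mem measurableSet_Ioo] with t ht
  exact (formSpeed_eq γ ht).symm

lemma IsCycle.exists_formSpeed_bound {p : Fin 3 → ℝ} {γ : Path p p} (hγ : IsCycle γ) :
    ∃ K, 0 ≤ K ∧ ∀ᵐ t ∂(volume.restrict (Icc (0 : ℝ) 1)), |formSpeed γ t| ≤ K := by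
  obtain ⟨s, M, hs, hsM⟩ := hγ.exists_deriv_bound
  have hpos : ∀ t, 0 < γ.extend t 0 := fun t =>
    zero_lt_of_mem_futureCone (mem_futureCone_of_path hγ t)
  have hcγ : ∀ i, Continuous fun t => γ.extend t i := fun i =>
    (continuous_apply i).comp γ.continuous_extend
  obtain ⟨K, hK⟩ : ∃ K, ∀ t ∈ Icc (0 : ℝ) 1,
      ‖1 / (2 * γ.extend t 0) * (|γ.extend t 1| + |γ.extend t 2|)‖ ≤ K :=
    isCompact_Icc.exists_bound_of_continuousOn
      ((continuous_const.div ((hcγ 0).const_mul 2) fun t => by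
        have := hpos t; positivity).mul ((hcγ 1).abs.add (hcγ 2).abs)).continuousOn
  have hK0 : 0 ≤ K := (norm_nonneg _).trans (hK 0 (by simp))
  refine ⟨K * |M|, by positivity, ?_⟩
  rw [← Measure.restrict_congr_set Ioo_ae_eq_Icc]
  have hsn : ∀ᵐ t ∂(volume.restrict (Ioo (0 : ℝ) 1)), t ∉ s :=
    ae_restrict_of_ae (hs.ae_notMem volume)
  filter_upwards [hsn, ae_restrict_mem measurableSet_Ioo] with t hts ht
  have hd : ∀ i, |deriv γ.extend t i| ≤ |M| := fun i =>
    (norm_le_pi_norm (deriv γ.extend t) i).trans ((hsM t ⟨ht, hts⟩).2.trans (le_abs_self M))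
  refine le_trans ?_ (mul_le_mul_of_nonneg_right (hK t ⟨ht.1.le, ht.2.le⟩) (abs_nonneg M))
  have h0 := hpos t
  rw [Real.norm_of_nonneg (by positivity), formSpeed_eq γ ht, abs_mul,
    abs_of_pos (a := 1 / (2 * γ.extend t 0)) (by positivity), mul_assoc]
  refine mul_le_mul_of_nonneg_left ?_ (by positivity)
  refine (abs_sub _ _).trans ?_
  rw [abs_mul, abs_mul, add_mul]
  exact add_le_add (mul_le_mul_of_nonneg_left (hd 2) (abs_nonneg _))
    (mul_le_mul_of_nonneg_left (hd 1) (abs_nonneg _))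

/-- The integral over a cycle of a one-form `φ(ξ) i_Ξ ω(ξ)`, with `φ` homogeneous of degree `-1`,
does not depend on the cycle: such a form is `φ(1, cos θ, sin θ) dθ / 2`. -/
theorem IsCycle.curveIntegral_eq {p : Fin 3 → ℝ} {γ : Path p p} (hγ : IsCycle γ)
    {φ : (Fin 3 → ℝ) → ℂ} (hφ : ContinuousOn φ futureCone)
    (hhom : ∀ r : ℝ, 0 < r → ∀ ξ ∈ futureCone, φ (r • ξ) = (r : ℂ)⁻¹ * φ ξ) :
    curveIntegral (fun ξ => (coneForm ξ).smulRight (φ ξ)) γ =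
      1 / 2 * ∫ α in (-Real.pi)..Real.pi, φ ![1, Real.cos α, Real.sin α] := by
  obtain ⟨θ, hθ, hθ1, hγθ⟩ := hγ.exists_angle
  obtain ⟨s, M, hs, hsM⟩ := hγ.exists_deriv_bound
  obtain ⟨K, hK0, hK⟩ := hγ.exists_formSpeed_bound
  have hmem := mem_futureCone_of_path hγ
  have hpos : ∀ t, 0 < γ.extend t 0 := fun t => zero_lt_of_mem_futureCone (hmem t)
  set ψ : ℝ → ℂ := fun α => φ ![1, Real.cos α, Real.sin α] with hψ
  have hψc : Continuous ψ := hφ.comp_continuous continuous_circle circle_mem_futureCone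
  have hψp : Function.Periodic ψ (2 * Real.pi) := fun α => by simp [hψ]
  set Ψ : ℝ → ℂ := fun x => ∫ α in (0 : ℝ)..x, ψ α
  have hΨ0 : Ψ = fun x => ∫ α in (0 : ℝ)..x, ψ α := rfl
  have hΨ : ∀ x, HasDerivAt Ψ (ψ x) x := fun x =>
    intervalIntegral.integral_hasDerivAt_right (hψc.intervalIntegrable _ _)
      hψc.aestronglyMeasurable.stronglyMeasurableAtFilter hψc.continuousAt
  have hφγ : ∀ t, φ (γ.extend t) = ((γ.extend t 0 : ℝ) : ℂ)⁻¹ * ψ (θ t) := fun t => by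
    rw [hψ]; dsimp only
    rw [← hhom _ (hpos t) _ (circle_mem_futureCone _), ← hγθ t]
  set g : ℝ → ℂ := fun t => 2 * ((formSpeed γ t : ℂ) * φ (γ.extend t)) with hg
  have hder : ∀ t ∈ Ioo (0 : ℝ) 1 \ s, HasDerivAt (Ψ ∘ θ) (g t) t := fun t ht => by
    have h1 := hasDerivAt_angle hθ hγθ hpos (hsM t ht).1.hasDerivAt
    refine ((hΨ (θ t)).scomp t h1).congr_deriv ?_
    have h0' : ((γ.extend t 0 : ℝ) : ℂ) ≠ 0 := by exact_mod_cast (hpos t).ne'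
    rw [hg]; dsimp only
    rw [formSpeed_eq γ ht.1, hφγ, Complex.real_smul]
    push_cast
    field_simp
  have hφγc : Continuous fun t => φ (γ.extend t) := hφ.comp_continuous γ.continuous_extend hmem
  have hint : IntervalIntegrable g volume 0 1 := by
    rw [intervalIntegrable_iff_integrableOn_Icc_of_le zero_le_one]
    obtain ⟨L, hL⟩ := isCompact_Icc.exists_bound_of_continuousOn
      (s := Icc (0 : ℝ) 1) hφγc.continuousOn
    refine Integrable.const_mul ?_ 2
    refine Integrable.mono' (g := fun _ => K * L) (integrable_const _) ?_ ?_
    · exact (Complex.continuous_ofReal.comp_aestronglyMeasurable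
        (aestronglyMeasurable_formSpeed γ)).mul hφγc.aestronglyMeasurable
    · filter_upwards [hK, ae_restrict_mem measurableSet_Icc] with t h1 h2
      rw [norm_mul, Complex.norm_real]
      exact mul_le_mul h1 (hL t h2) (norm_nonneg _) hK0
  have hftc := integral_eq_of_hasDerivAt_off_countable_of_le (Ψ ∘ θ) g zero_le_one hs
    ((continuous_iff_continuousAt.2 fun x => (hΨ x).continuousAt).comp hθ).continuousOn hder hint
  have h2 : 2 * curveIntegral (fun ξ => (coneForm ξ).smulRight (φ ξ)) γ =
      ∫ t in (0 : ℝ)..1, g t := by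
    rw [hg, intervalIntegral.integral_const_mul, curveIntegral_def]
    simp only [curveIntegralFun_coneForm]
  have h3 : Ψ (θ 1) - Ψ (θ 0) = ∫ α in (-Real.pi)..Real.pi, ψ α := by
    simp only [hΨ0]
    rw [hθ1, intervalIntegral.integral_interval_sub_left (hψc.intervalIntegrable _ _)
      (hψc.intervalIntegrable _ _), hψp.intervalIntegral_add_eq (θ 0) (-Real.pi)]
    congr 1; ring
  rw [hftc, Function.comp, Function.comp, h3] at h2
  rw [← h2]; ring

/-! ### Mellin transforms of complex linear functions -/

lemma norm_cpow_mul_exp {s r : ℂ} {t : ℝ} (ht : 0 < t) :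
    ‖(t : ℂ) ^ (s - 1) * Complex.exp (-(r * t))‖ = t ^ (s.re - 1) * Real.exp (-(r.re * t)) := by
  rw [norm_mul, Complex.norm_cpow_eq_rpow_re_of_pos ht, Complex.norm_exp]
  simp

lemma measurable_cpow_mul_exp (s r : ℂ) :
    Measurable fun t : ℝ => (t : ℂ) ^ (s - 1) * Complex.exp (-(r * t)) := by
  have := Complex.measurable_ofReal
  fun_prop

lemma integrableOn_rpow_mul_exp {σ b : ℝ} (hσ : 0 < σ) (hb : 0 < b) :
    IntegrableOn (fun t : ℝ => t ^ (σ - 1) * Real.exp (-(b * t))) (Ioi 0) := by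
  have := integrableOn_rpow_mul_exp_neg_mul_rpow (p := 1) (s := σ - 1) (b := b) (by linarith)
    one_pos hb
  simpa using this

lemma integrableOn_cpow_mul_exp {s r : ℂ} (hs : 0 < s.re) (hr : 0 < r.re) :
    IntegrableOn (fun t : ℝ => (t : ℂ) ^ (s - 1) * Complex.exp (-(r * t))) (Ioi 0) := by
  refine Integrable.mono' (integrableOn_rpow_mul_exp hs hr)
    (measurable_cpow_mul_exp s r).aestronglyMeasurable ?_
  filter_upwards [ae_restrict_mem measurableSet_Ioi] with t ht
  exact (norm_cpow_mul_exp ht).le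

/-- The Laplace transform of a power, at a complex point: by analytic continuation from real
points. -/
lemma integral_cpow_mul_exp {s r : ℂ} (hs : 0 < s.re) (hr : 0 < r.re) :
    ∫ t in Ioi (0 : ℝ), (t : ℂ) ^ (s - 1) * Complex.exp (-(r * t)) =
      Complex.Gamma s * r ^ (-s) := by
  set U : Set ℂ := {r | 0 < r.re} with hU
  have hUo : IsOpen U := isOpen_lt continuous_const Complex.continuous_re
  have hUc : IsPreconnected U := (convex_halfSpace_re_gt 0).isPreconnected
  have hL : AnalyticOnNhd ℂ
      (fun r : ℂ => ∫ t in Ioi (0 : ℝ), (t : ℂ) ^ (s - 1) * Complex.exp (-(r * t))) U := by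
    refine DifferentiableOn.analyticOnNhd (fun r₀ hr₀ => ?_) hUo
    have hr₀' : 0 < r₀.re := hr₀
    have key := hasDerivAt_integral_of_dominated_loc_of_deriv_le
      (μ := volume.restrict (Ioi (0 : ℝ))) (x₀ := r₀) (s := {r : ℂ | r₀.re / 2 < r.re})
      (F := fun r (t : ℝ) => (t : ℂ) ^ (s - 1) * Complex.exp (-(r * t)))
      (F' := fun r (t : ℝ) => (t : ℂ) ^ (s - 1) * (Complex.exp (-(r * t)) * -t))
      (bound := fun t => t ^ (s.re + 1 - 1) * Real.exp (-(r₀.re / 2 * t)))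
      ((isOpen_lt continuous_const Complex.continuous_re).mem_nhds (by
        show r₀.re / 2 < r₀.re
        linarith))
      (Eventually.of_forall fun r => (measurable_cpow_mul_exp s r).aestronglyMeasurable)
      (integrableOn_cpow_mul_exp hs hr₀)
      (by
        have := Complex.measurable_ofReal
        exact Measurable.aestronglyMeasurable (by fun_prop))
      (by
        filter_upwards [ae_restrict_mem measurableSet_Ioi] with t ht r hr
        have ht' : 0 < t := ht
        have hr' : r₀.re / 2 < r.re := hr
        rw [← mul_assoc, norm_mul, norm_cpow_mul_exp ht, norm_neg, Complex.norm_real,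
          Real.norm_of_nonneg ht'.le, mul_right_comm]
        have : t ^ (s.re - 1) * t = t ^ (s.re + 1 - 1) := by
          rw [← Real.rpow_add_one ht'.ne']; congr 1; ring
        rw [this]
        gcongr)
      (integrableOn_rpow_mul_exp (by linarith) (by linarith))
      (by
        refine Eventually.of_forall fun t r _ => HasDerivAt.const_mul _ ?_
        have h1 : HasDerivAt (fun r : ℂ => -(r * t)) (-t : ℂ) r := by
          simpa using ((hasDerivAt_id' r).mul_const (t : ℂ)).fun_neg
        exact h1.cexp)
    exact key.2.differentiableAt.differentiableWithinAt
  have hR : AnalyticOnNhd ℂ (fun r : ℂ => Complex.Gamma s * r ^ (-s)) U := by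
    refine DifferentiableOn.analyticOnNhd (fun r₀ hr₀ => ?_) hUo
    exact ((differentiableAt_id.cpow_const (Or.inl hr₀)).const_mul _).differentiableWithinAt
  refine hL.eqOn_of_preconnected_of_frequently_eq hR hUc (z₀ := 1) (by simp [hU]) ?_ hr
  have hreal : ∀ x : ℝ, 0 < x →
      ∫ t in Ioi (0 : ℝ), (t : ℂ) ^ (s - 1) * Complex.exp (-((x : ℂ) * t)) =
        Complex.Gamma s * (x : ℂ) ^ (-s) := fun x hx => by
    rw [Complex.integral_cpow_mul_exp_neg_mul_Ioi hs hx, mul_comm, one_div, Complex.inv_cpow,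
      Complex.cpow_neg]
    rw [Complex.arg_ofReal_of_nonneg hx.le]
    exact Real.pi_pos.ne
  have hseq : Tendsto (fun n : ℕ => ((1 + 1 / ((n : ℝ) + 1) : ℝ) : ℂ)) atTop (𝓝[≠] 1) := by
    refine tendsto_nhdsWithin_iff.2 ⟨?_, Eventually.of_forall fun n => ?_⟩
    · have := (tendsto_one_div_add_atTop_nhds_zero_nat (𝕜 := ℝ)).const_add 1
      rw [add_zero] at this
      exact (Complex.continuous_ofReal.tendsto 1).comp this
    · have : (0 : ℝ) < 1 / ((n : ℝ) + 1) := by positivity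
      simp only [mem_compl_iff, mem_singleton_iff, ← Complex.ofReal_one, Complex.ofReal_inj]
      linarith
  exact hseq.frequently (Frequently.of_forall fun n => hreal _ (by positivity))

lemma ofReal_mul_cpow {r : ℝ} (hr : 0 < r) {w : ℂ} (hw : w ≠ 0) (s : ℂ) :
    ((r : ℂ) * w) ^ s = (r : ℂ) ^ s * w ^ s := by
  have hr' : (r : ℂ) ≠ 0 := by exact_mod_cast hr.ne'
  rw [Complex.cpow_def_of_ne_zero (mul_ne_zero hr' hw), Complex.cpow_def_of_ne_zero hr',
    Complex.cpow_def_of_ne_zero hw, Complex.log_ofReal_mul hr hw, ← Complex.exp_add,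
    Complex.ofReal_log hr.le]
  congr 1; ring

/-- `∫ t^{s-1} / (t w + y) dt` for `w`, `y` in the right half-plane: `1 / (t w + y)` is a Laplace
transform, and the two integrals are exchanged. -/
lemma integral_cpow_div_of_re_pos {s w y : ℂ} (hs : 0 < s.re) (hs1 : s.re < 1) (hw : 0 < w.re)
    (hy : 0 < y.re) :
    ∫ t in Ioi (0 : ℝ), (t : ℂ) ^ (s - 1) / (t * w + y) =
      Real.pi / Complex.sin (Real.pi * s) * (w ^ (-s) * y ^ (s - 1)) := by
  set μ := volume.restrict (Ioi (0 : ℝ))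
  set Φ : ℝ → ℝ → ℂ := fun t r =>
    (t : ℂ) ^ (s - 1) * Complex.exp (-((r * w : ℂ) * t)) * Complex.exp (-(y * r)) with hΦ
  have h1 : ∀ t ∈ Ioi (0 : ℝ), ∫ r, Φ t r ∂μ = (t : ℂ) ^ (s - 1) / (t * w + y) := fun t ht => by
    have ht' : 0 < t := ht
    have hre : (-(t * w + y) : ℂ).re < 0 := by
      simp only [Complex.neg_re, Complex.add_re, Complex.re_ofReal_mul]
      nlinarith [mul_pos ht' hw]
    have := integral_exp_mul_complex_Ioi hre 0
    simp only [Complex.ofReal_zero, mul_zero, Complex.exp_zero] at this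
    have h2 : ∀ r : ℝ, Φ t r = (t : ℂ) ^ (s - 1) * Complex.exp (-(t * w + y) * r) := fun r => by
      rw [hΦ]; dsimp only
      rw [mul_assoc, ← Complex.exp_add]; congr 2; ring
    simp_rw [h2]
    rw [integral_const_mul, this, neg_div_neg_eq, mul_one_div]
  have h2 : ∀ r ∈ Ioi (0 : ℝ), ∫ t, Φ t r ∂μ =
      Complex.Gamma s * w ^ (-s) * ((r : ℂ) ^ ((1 - s) - 1) * Complex.exp (-(y * r))) := by
    intro r hr
    have hr' : 0 < r := hr
    have hre : 0 < ((r : ℂ) * w).re := by rw [Complex.re_ofReal_mul]; positivity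
    rw [hΦ]; dsimp only
    have hw0 : w ≠ 0 := fun h => by simp [h] at hw
    rw [integral_mul_const, integral_cpow_mul_exp hs hre, ofReal_mul_cpow hr' hw0,
      show 1 - s - 1 = -s by ring]
    ring
  have hm : AEStronglyMeasurable (Function.uncurry Φ) (μ.prod μ) := by
    have := Complex.measurable_ofReal
    refine Measurable.aestronglyMeasurable ?_
    simp only [hΦ, Function.uncurry_def]
    fun_prop
  have hint : Integrable (Function.uncurry Φ) (μ.prod μ) := by
    refine (integrable_prod_iff' hm).2 ⟨?_, ?_⟩
    · filter_upwards [ae_restrict_mem measurableSet_Ioi] with r hr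
      have hr' : 0 < r := hr
      have hre : 0 < ((r : ℂ) * w).re := by rw [Complex.re_ofReal_mul]; positivity
      exact (integrableOn_cpow_mul_exp hs hre).mul_const (Complex.exp (-(y * r)))
    · have hg : IntegrableOn (fun r : ℝ => (1 / w.re) ^ s.re * Real.Gamma s.re *
          (r ^ ((1 - s.re) - 1) * Real.exp (-(y.re * r)))) (Ioi 0) :=
        (integrableOn_rpow_mul_exp (by linarith) hy).const_mul _
      refine hg.congr ?_
      filter_upwards [ae_restrict_mem measurableSet_Ioi] with r hr
      have hr' : 0 < r := hr
      have hb : 0 < w.re * r := by positivity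
      have h3 : ∀ t ∈ Ioi (0 : ℝ), ‖Function.uncurry Φ (t, r)‖ =
          t ^ (s.re - 1) * Real.exp (-(w.re * r * t)) * Real.exp (-(y.re * r)) := fun t ht => by
        simp only [hΦ, Function.uncurry_apply_pair]
        rw [norm_mul, norm_cpow_mul_exp ht, Complex.norm_exp, Complex.re_ofReal_mul]
        simp [mul_comm]
      rw [setIntegral_congr_fun measurableSet_Ioi h3, integral_mul_const,
        Real.integral_rpow_mul_exp_neg_mul_Ioi hs hb, one_div, one_div, mul_inv,
        Real.mul_rpow (by positivity) (by positivity), Real.inv_rpow hr'.le,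
        ← Real.rpow_neg hr'.le, show 1 - s.re - 1 = -s.re by ring]
      ring
  have hswap := integral_integral_swap hint
  rw [setIntegral_congr_fun measurableSet_Ioi h1, setIntegral_congr_fun measurableSet_Ioi h2,
    integral_const_mul, integral_cpow_mul_exp (by simpa using hs1) hy] at hswap
  rw [hswap, ← Complex.Gamma_mul_Gamma_one_sub, show -(1 - s) = s - 1 by ring]
  ring

lemma I_mul_cpow_of_im_neg {u : ℂ} (hu : u.im < 0) (s : ℂ) :
    (Complex.I * u) ^ s = Complex.I ^ s * u ^ s := by
  have hu0 : u ≠ 0 := fun h => by simp [h] at hu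
  have harg : u.arg ∈ Ioo (-Real.pi) 0 :=
    ⟨Complex.neg_pi_lt_arg u, Complex.arg_neg_iff.2 hu⟩
  rw [Complex.cpow_def_of_ne_zero (mul_ne_zero Complex.I_ne_zero hu0),
    Complex.cpow_def_of_ne_zero Complex.I_ne_zero, Complex.cpow_def_of_ne_zero hu0,
    (Complex.log_mul_eq_add_log_iff Complex.I_ne_zero hu0).2, ← Complex.exp_add]
  · congr 1; ring
  · rw [Complex.arg_I]
    constructor <;> linarith [harg.1, harg.2, Real.pi_pos]

/-- The same integral for points of the lower half-plane, which multiplication by `i` carries to the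
right half-plane, and with `s = 1/2 + iν`. -/
lemma integral_cpow_div_of_im_neg {u v : ℂ} (hu : u.im < 0) (hv : v.im < 0) (ν : ℝ) :
    ∫ t in Ioi (0 : ℝ), (t : ℂ) ^ ((1 / 2 + Complex.I * ν) - 1 : ℂ) / (t * u + v) =
      Real.pi / Complex.cosh (Real.pi * ν) *
        (u ^ (-1 / 2 - Complex.I * ν) * v ^ (-1 / 2 + Complex.I * ν)) := by
  set s : ℂ := 1 / 2 + Complex.I * ν with hs
  have hre : s.re = 1 / 2 := by simp [hs]
  have h := integral_cpow_div_of_re_pos (s := s) (w := Complex.I * u) (y := Complex.I * v)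
    (by rw [hre]; norm_num) (by rw [hre]; norm_num) (by simpa using hu) (by simpa using hv)
  have h1 : ∀ t : ℝ, (t : ℂ) ^ (s - 1) / (t * (Complex.I * u) + Complex.I * v) =
      -Complex.I * ((t : ℂ) ^ (s - 1) / (t * u + v)) := fun t => by
    rw [show (t : ℂ) * (Complex.I * u) + Complex.I * v = Complex.I * (t * u + v) by ring,
      div_mul_eq_div_div_swap, div_eq_mul_inv _ Complex.I, Complex.inv_I]
    ring
  simp_rw [h1] at h
  rw [integral_const_mul, I_mul_cpow_of_im_neg hu, I_mul_cpow_of_im_neg hv] at h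
  have hI : Complex.I ^ (-s) * Complex.I ^ (s - 1) = -Complex.I := by
    rw [← Complex.cpow_add _ _ Complex.I_ne_zero, show -s + (s - 1) = -1 by ring,
      Complex.cpow_neg_one, Complex.inv_I]
  have hsin : Complex.sin (Real.pi * s) = Complex.cosh (Real.pi * ν) := by
    rw [hs, show (Real.pi : ℂ) * (1 / 2 + Complex.I * ν) =
      Real.pi / 2 - -(Real.pi * ν * Complex.I) by ring, Complex.sin_pi_div_two_sub,
      Complex.cos_neg, Complex.cos_mul_I]
  have h2 : Complex.I ^ (-s) * u ^ (-s) * (Complex.I ^ (s - 1) * v ^ (s - 1)) =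
      -Complex.I * (u ^ (-s) * v ^ (s - 1)) := by rw [← hI]; ring
  rw [h2, hsin, mul_left_comm] at h
  have := mul_left_cancel₀ (neg_ne_zero.2 Complex.I_ne_zero) h
  rw [this]
  congr 3 <;> rw [hs] <;> ring

/-! ### Circle integrals of inverse linear forms -/

/-- The substitution `x = tan (α / 2)`. -/
lemma integral_circle_eq_integral_line (g : ℝ → ℂ) :
    ∫ α in (-Real.pi)..Real.pi, g α =
      ∫ x : ℝ, ((2 / (1 + x ^ 2) : ℝ) : ℂ) * g (2 * Real.arctan x) := by
  have himg : (fun x : ℝ => 2 * Real.arctan x) '' univ = Ioo (-Real.pi) Real.pi := by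
    ext α
    simp only [image_univ, mem_range, mem_Ioo]
    constructor
    · rintro ⟨x, rfl⟩
      constructor <;> linarith [Real.neg_pi_div_two_lt_arctan x, Real.arctan_lt_pi_div_two x]
    · rintro ⟨h1, h2⟩
      exact ⟨Real.tan (α / 2), by rw [Real.arctan_tan (by linarith) (by linarith)]; ring⟩
  have hder : ∀ x ∈ (univ : Set ℝ), HasDerivWithinAt (fun x : ℝ => 2 * Real.arctan x)
      (2 / (1 + x ^ 2)) univ x := fun x _ => by
    have := (Real.hasDerivAt_arctan x).const_mul 2
    rw [mul_one_div] at this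
    exact this.hasDerivWithinAt
  have hinj : InjOn (fun x : ℝ => 2 * Real.arctan x) univ := fun x _ y _ h =>
    Real.arctan_injective (mul_left_cancel₀ two_ne_zero h)
  have := integral_image_eq_integral_abs_deriv_smul MeasurableSet.univ hder hinj g
  rw [himg, setIntegral_univ] at this
  rw [intervalIntegral.integral_of_le (by linarith [Real.pi_pos]),
    integral_Ioc_eq_integral_Ioo, this]
  refine integral_congr_ae (Eventually.of_forall fun x => ?_)
  have : (0 : ℝ) < 2 / (1 + x ^ 2) := by positivity
  simp only [abs_of_pos this, Complex.real_smul]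

lemma circle_two_arctan (x : ℝ) :
    (![1, Real.cos (2 * Real.arctan x), Real.sin (2 * Real.arctan x)] : Fin 3 → ℝ) =
      (2 / (1 + x ^ 2)) • spinor 1 x := by
  have h : (1 + x ^ 2) ≠ 0 := by positivity
  ext i
  fin_cases i
  · simp [spinor]; field_simp
  · simp [spinor, Real.cos_two_mul, Real.cos_sq_arctan]; field_simp; ring
  · simp only [spinor, Real.sin_two_mul, Real.sin_arctan, Real.cos_arctan]
    simp
    have := Real.mul_self_sqrt (show (0:ℝ) ≤ 1 + x ^ 2 by positivity)
    have h2 : √(1 + x ^ 2) ≠ 0 := by positivity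
    field_simp
    rw [Real.sq_sqrt (by positivity)]

/-- Residues: one pole on each side of the real axis. -/
lemma integral_inv_mul_sub {r s : ℂ} (hr : 0 < r.im) (hs : s.im < 0) :
    ∫ x : ℝ, (((x : ℂ) - r) * (x - s))⁻¹ = 2 * Real.pi * Complex.I / (r - s) := by
  set η : ℝ := -s.im / 2 with hη
  have hη0 : 0 < η := by rw [hη]; linarith
  set s' : ℂ := s + η * Complex.I with hs'
  have him : s'.im = -η := by simp [hs', hη]; ring
  have hne : ∀ z : ℂ, 0 < z.im → η ≤ ‖z - s'‖ := fun z hz => by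
    refine le_trans ?_ (Complex.abs_im_le_norm _)
    rw [Complex.sub_im, him]
    exact le_trans (by linarith) (le_abs_self _)
  have h := integral_line_cauchy (h := fun z => (z - s')⁻¹) (η := η)
    (C := (1 + ‖s'‖) / η + 1) (w := r + η * Complex.I) hη0 (by simp; exact hr)
    (fun z hz => by
      have : z - s' ≠ 0 := norm_pos_iff.1 (hη0.trans_le (hne z hz))
      exact ((differentiableAt_fun_id.sub_const s').inv this).differentiableWithinAt)
    (fun z hz => by
      have h1 := hne z hz
      have h0 : 0 < ‖z - s'‖ := hη0.trans_le h1
      rw [norm_inv, ← one_div, ← div_eq_mul_inv, div_le_div_iff₀ h0 (by positivity)]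
      have h2 : ‖z‖ ≤ ‖z - s'‖ + ‖s'‖ := by simpa using norm_add_le (z - s') s'
      have h3 : 1 + ‖s'‖ ≤ (1 + ‖s'‖) / η * ‖z - s'‖ := by
        rw [div_mul_eq_mul_div, le_div_iff₀ hη0]
        exact mul_le_mul_of_nonneg_left h1 (by positivity)
      linarith)
  have h2 : ∀ x : ℝ, ((x : ℂ) + η * Complex.I - s')⁻¹ / (x + η * Complex.I - (r + η * Complex.I)) =
      (((x : ℂ) - r) * (x - s))⁻¹ := fun x => by
    rw [hs', mul_inv, div_eq_mul_inv]
    ring_nf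
  simp_rw [h2] at h
  rw [h, hs', div_eq_mul_inv]
  ring_nf

/-- Residues: no pole in the upper half-plane. -/
lemma integral_inv_mul_sub_eq_zero_of_im_neg {r s : ℂ} (hr : r.im < 0) (hs : s.im < 0) :
    ∫ x : ℝ, (((x : ℂ) - r) * (x - s))⁻¹ = 0 := by
  have h := integral_line_eq_zero (h := fun z => ((z - r) * (z - s))⁻¹) (a := max r.im s.im)
    (η := 0) (C := 4) (R₀ := 1 + 2 * ‖r‖ + 2 * ‖s‖) (max_lt hr hs)
    (fun z hz => by
      have hz' : max r.im s.im < z.im := hz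
      have h1 : z - r ≠ 0 := fun h => by
        rw [sub_eq_zero.1 h] at hz'
        exact absurd (le_max_left r.im s.im) (not_le.2 hz')
      have h2 : z - s ≠ 0 := fun h => by
        rw [sub_eq_zero.1 h] at hz'
        exact absurd (le_max_right r.im s.im) (not_le.2 hz')
      exact (((differentiableAt_fun_id.sub_const r).mul (differentiableAt_fun_id.sub_const s)).inv
        (mul_ne_zero h1 h2)).differentiableWithinAt)
    (fun z _ hz => by
      have hr0 := norm_nonneg r
      have hs0 := norm_nonneg s
      have hz1 : 1 ≤ ‖z‖ := by linarith
      have h1 : ‖z‖ / 2 ≤ ‖z - r‖ := by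
        have := norm_sub_norm_le z r
        linarith
      have h2 : ‖z‖ / 2 ≤ ‖z - s‖ := by
        have := norm_sub_norm_le z s
        linarith
      rw [norm_inv, norm_mul]
      calc (‖z - r‖ * ‖z - s‖)⁻¹ ≤ (‖z‖ / 2 * (‖z‖ / 2))⁻¹ := by gcongr
        _ = 4 * ‖z‖ ^ (-2 : ℝ) := by
          rw [Real.rpow_neg (by linarith), Real.rpow_two]; field_simp; norm_num
        _ ≤ 4 * ‖z‖ ^ (-(3 / 2) : ℝ) := by
          gcongr
          norm_num)
  simpa using h

lemma integral_inv_mul_sub_eq_zero_of_im_pos {r s : ℂ} (hr : 0 < r.im) (hs : 0 < s.im) :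
    ∫ x : ℝ, (((x : ℂ) - r) * (x - s))⁻¹ = 0 := by
  have h := integral_inv_mul_sub_eq_zero_of_im_neg (r := -r) (s := -s) (by simpa) (by simpa)
  rw [← integral_neg_eq_self] at h
  rw [← h]
  refine integral_congr_ae (Eventually.of_forall fun x => ?_)
  push_cast
  congr 1
  ring

lemma mink_smul_toC_right (W : Fin 3 → ℂ) (r : ℝ) (ξ : Fin 3 → ℝ) :
    mink W (toC (r • ξ)) = r * mink W (toC ξ) := by
  simp only [mink, toC, Pi.smul_apply, smul_eq_mul]
  push_cast
  ring

lemma continuous_mink_circle (W : Fin 3 → ℂ) :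
    Continuous fun α : ℝ => mink W (toC ![1, Real.cos α, Real.sin α]) := by
  simp only [mink, toC, Matrix.cons_val]
  fun_prop

/-- The integral of `1 / [W·ξ]` over the circle, for a complex linear form with values in the lower
half-plane. As `1 / [W·ξ]` has a positive imaginary part, so has the integral; this shows at once
that the two roots of the quadratic polynomial `[W·ξ(x)]`, `x = tan (α / 2)`, are on both sides of
the real axis, and which square root of `-W²` occurs. -/
theorem exists_integral_inv_mink {W : Fin 3 → ℂ}
    (hW : ∀ ξ ∈ futureCone, (mink W (toC ξ)).im < 0) :
    ∃ D : ℂ, D ^ 2 = -mink W W ∧ 0 < D.re ∧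
      ∫ α in (-Real.pi)..Real.pi, (mink W (toC ![1, Real.cos α, Real.sin α]))⁻¹ =
        2 * Real.pi * Complex.I / D := by
  set J := ∫ α in (-Real.pi)..Real.pi, (mink W (toC ![1, Real.cos α, Real.sin α]))⁻¹ with hJ
  have hne : ∀ ξ ∈ futureCone, mink W (toC ξ) ≠ 0 := fun ξ hξ h => by
    have := hW ξ hξ
    simp [h] at this
  have hJim : 0 < J.im := by
    have hc : Continuous fun α : ℝ => (mink W (toC ![1, Real.cos α, Real.sin α]))⁻¹ :=
      (continuous_mink_circle W).inv₀ fun α => hne _ (circle_mem_futureCone α)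
    have h1 : J.im = ∫ α in (-Real.pi)..Real.pi,
        ((mink W (toC ![1, Real.cos α, Real.sin α]))⁻¹).im :=
      (Complex.imCLM.intervalIntegral_comp_comm (hc.intervalIntegrable _ _)).symm
    rw [h1]
    refine intervalIntegral.intervalIntegral_pos_of_pos
      ((Complex.continuous_im.comp hc).intervalIntegrable _ _) (fun α => ?_)
      (by linarith [Real.pi_pos])
    have h2 := hW _ (circle_mem_futureCone α)
    rw [Complex.inv_im]
    exact div_pos (by linarith) (Complex.normSq_pos.2 (hne _ (circle_mem_futureCone α)))
  set A : ℂ := W 0 + W 1 with hA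
  have hA0 : A ≠ 0 := fun h => by
    refine hne (spinor 0 1) (spinor_mem (by norm_num)) ?_
    rw [mink_toC_spinor]
    push_cast
    linear_combination h / 2
  obtain ⟨d, hd⟩ : ∃ d : ℂ, d ^ 2 = -mink W W := IsAlgClosed.exists_pow_nat_eq _ two_pos
  have hdW : d ^ 2 = W 2 ^ 2 - A * (W 0 - W 1) := by rw [hd, mink]; ring
  have hfac : ∀ x : ℂ, A * ((x - (W 2 + d) / A) * (x - (W 2 - d) / A)) =
      A * x ^ 2 - 2 * W 2 * x + (W 0 - W 1) := fun x => by
    field_simp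
    linear_combination -hdW
  set r := (W 2 + d) / A with hr
  set s := (W 2 - d) / A with hs
  have hsp : ∀ x : ℝ, 2 * mink W (toC (spinor 1 x)) = A * ((x - r) * (x - s)) := fun x => by
    rw [hfac, mink_toC_spinor, hA]; push_cast; ring
  have hrs : ∀ x : ℝ, (x : ℂ) - r ≠ 0 ∧ (x : ℂ) - s ≠ 0 := fun x => by
    have h1 : A * ((x - r) * (x - s)) ≠ 0 := by
      rw [← hsp]
      exact mul_ne_zero two_ne_zero (hne _ (spinor_mem (by positivity)))
    exact mul_ne_zero_iff.1 (right_ne_zero_of_mul h1)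
  have him : ∀ w : ℂ, (∀ x : ℝ, (x : ℂ) - w ≠ 0) → w.im ≠ 0 := fun w hw h0 =>
    hw w.re (by apply Complex.ext <;> simp [h0])
  have hJ2 : J = 2 / A * ∫ x : ℝ, (((x : ℂ) - r) * (x - s))⁻¹ := by
    rw [hJ, integral_circle_eq_integral_line, ← integral_const_mul]
    refine integral_congr_ae (Eventually.of_forall fun x => ?_)
    dsimp only
    have h1 : ((2 / (1 + x ^ 2) : ℝ) : ℂ) ≠ 0 := by
      have : (0 : ℝ) < 2 / (1 + x ^ 2) := by positivity
      exact_mod_cast this.ne'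
    have h2 := hsp x
    have h3 := hrs x
    have h4 := h3.1
    have h5 := h3.2
    rw [circle_two_arctan, mink_smul_toC_right, mul_inv, mul_inv_cancel_left₀ h1,
      show mink W (toC (spinor 1 x)) = A * ((x - r) * (x - s)) / 2 by rw [← h2]; ring]
    field_simp
  have hrs2 : r - s = 2 * d / A := by rw [hr, hs]; ring
  have hfin : ∀ D : ℂ, D ^ 2 = -mink W W → J = 2 * Real.pi * Complex.I / D →
      ∃ D : ℂ, D ^ 2 = -mink W W ∧ 0 < D.re ∧ J = 2 * Real.pi * Complex.I / D := fun D h1 h2 => by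
    refine ⟨D, h1, ?_, h2⟩
    rw [h2, show 2 * (Real.pi : ℂ) * Complex.I / D = ((2 * Real.pi : ℝ) : ℂ) * (Complex.I * D⁻¹) by
      push_cast; ring, Complex.im_ofReal_mul, Complex.I_mul_im, Complex.inv_re] at hJim
    have h3 := (mul_pos_iff_of_pos_left (by positivity)).1 hJim
    by_contra h4
    exact absurd h3 (not_lt.2 (div_nonpos_of_nonpos_of_nonneg (not_lt.1 h4) (Complex.normSq_nonneg _)))
  have hd0 : d ≠ 0 := fun h0 => by
    -- A double root would lie on one side of the real axis, and the integral would vanish.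
    have hrseq : r = s := by rw [← sub_eq_zero, hrs2, h0]; simp
    rcases lt_or_gt_of_ne (him r fun x => (hrs x).1) with h1 | h1
    · rw [← hrseq, integral_inv_mul_sub_eq_zero_of_im_neg h1 h1] at hJ2
      simp [hJ2] at hJim
    · rw [← hrseq, integral_inv_mul_sub_eq_zero_of_im_pos h1 h1] at hJ2
      simp [hJ2] at hJim
  rcases lt_or_gt_of_ne (him r fun x => (hrs x).1) with h1 | h1 <;>
  rcases lt_or_gt_of_ne (him s fun x => (hrs x).2) with h2 | h2
  · rw [integral_inv_mul_sub_eq_zero_of_im_neg h1 h2] at hJ2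
    simp [hJ2] at hJim
  · refine hfin (-d) (by rw [neg_sq, hd]) ?_
    simp_rw [mul_comm ((_ : ℂ) - r) _] at hJ2
    rw [hJ2, integral_inv_mul_sub h2 h1, ← neg_sub, hrs2]
    field_simp
  · refine hfin d hd ?_
    rw [hJ2, integral_inv_mul_sub h1 h2, hrs2]
    field_simp
  · rw [integral_inv_mul_sub_eq_zero_of_im_pos h1 h2] at hJ2
    simp [hJ2] at hJim

/-! ### Two Fourier integrals -/

/-- The integral `integral_cpow_div_of_im_neg` in the variable `σ = -log t`. -/
lemma fourier_inv_exp {u v : ℂ} (hu : u.im < 0) (hv : v.im < 0) (ν : ℝ) :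
    ∫ σ : ℝ, Complex.exp (-(Complex.I * ν * σ)) *
        (Real.exp (-(σ / 2)) * u + Real.exp (σ / 2) * v)⁻¹ =
      Real.pi / Complex.cosh (Real.pi * ν) *
        (u ^ (-1 / 2 - Complex.I * ν) * v ^ (-1 / 2 + Complex.I * ν)) := by
  rw [← integral_cpow_div_of_im_neg hu hv]
  have h := mellin_eq_fourier (fun t : ℝ => ((t : ℂ) * u + v)⁻¹) (s := 1 / 2 + Complex.I * ν)
  rw [mellin, Real.fourier_real_eq_integral_exp_smul] at h
  simp only [smul_eq_mul, ← div_eq_mul_inv] at h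
  rw [h]
  refine integral_congr_ae (Eventually.of_forall fun σ => ?_)
  have hre : (1 / 2 + Complex.I * ν : ℂ).re = 1 / 2 := by simp
  have him : (1 / 2 + Complex.I * ν : ℂ).im = ν := by simp
  dsimp only
  rw [hre, him, Complex.real_smul]
  congr 1
  · congr 1
    have := Real.pi_ne_zero
    push_cast
    have : (Real.pi : ℂ) ≠ 0 := by exact_mod_cast this
    field_simp
  · have h1 : (Real.exp (-σ) : ℂ) = Real.exp (-(σ / 2)) * Real.exp (-(σ / 2)) := by
      rw [← Complex.ofReal_mul, ← Real.exp_add]; congr 2; ring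
    have h2 : (Real.exp (σ / 2) : ℂ) = (Real.exp (-(σ / 2)) : ℂ)⁻¹ := by
      rw [← Complex.ofReal_inv, ← Real.exp_neg, neg_neg]
    have h3 : (Real.exp (-(σ / 2)) : ℂ) ≠ 0 := by exact_mod_cast (Real.exp_pos _).ne'
    rw [h1, h2, show -(1 / 2 : ℝ) * σ = -(σ / 2) by ring, ← inv_inv (Real.exp (-(σ / 2)) : ℂ),
      ← mul_inv, inv_inv]
    congr 1
    field_simp

lemma half_mul_exp_le_sinh {x : ℝ} (hx : 0 ≤ x) : x / 2 * Real.exp (x / 2) ≤ Real.sinh x := by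
  have h1 : x / 2 ≤ Real.sinh (x / 2) := Real.self_le_sinh_iff.2 (by linarith)
  have h2 : Real.sinh x = 2 * Real.sinh (x / 2) * Real.cosh (x / 2) := by
    rw [← Real.sinh_two_mul]; congr 1; ring
  have h3 : Real.exp (x / 2) ≤ 2 * Real.cosh (x / 2) := by
    rw [Real.cosh_eq]; linarith [Real.exp_pos (-(x / 2))]
  rw [h2]
  nlinarith [mul_le_mul h1 h3 (Real.exp_pos _).le (le_trans (by linarith) h1)]

/-- The bound by which `1 / sinh` is tamed near `0`. -/
lemma abs_sin_div_sinh_le (ν : ℝ) {σ : ℝ} (hσ : 0 < σ) :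
    |Real.sin (ν * σ)| / Real.sinh (σ / 2) ≤ 4 * |ν| * Real.exp (-(1 / 4) * σ) := by
  have h1 := half_mul_exp_le_sinh (x := σ / 2) (by linarith)
  have h2 : |Real.sin (ν * σ)| ≤ |ν| * σ := by
    refine Real.abs_sin_le_abs.trans ?_
    rw [abs_mul, abs_of_pos hσ]
  have h3 : 0 < Real.sinh (σ / 2) := Real.sinh_pos_iff.2 (by linarith)
  rw [div_le_iff₀ h3]
  have h4 : Real.exp (-(1 / 4) * σ) * Real.exp (σ / 2 / 2) = 1 := by
    rw [← Real.exp_add]; ring_nf; simp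
  calc |Real.sin (ν * σ)| ≤ |ν| * σ := h2
    _ = 4 * |ν| * (Real.exp (-(1 / 4) * σ) * (σ / 2 / 2 * Real.exp (σ / 2 / 2))) := by
      linear_combination (-|ν| * σ) * h4
    _ ≤ 4 * |ν| * Real.exp (-(1 / 4) * σ) * Real.sinh (σ / 2) := by
      rw [← mul_assoc (4 * |ν|)]
      exact mul_le_mul_of_nonneg_left h1 (by positivity)

lemma integral_eq_integral_Ioi_add {f : ℝ → ℂ} (hf : Integrable f) :
    ∫ x, f x = ∫ x in Ioi (0 : ℝ), (f x + f (-x)) := by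
  rw [integral_add hf.integrableOn hf.comp_neg.integrableOn, integral_comp_neg_Ioi, neg_zero,
    add_comm, intervalIntegral.integral_Iic_add_Ioi hf.integrableOn hf.integrableOn]

lemma integrable_exp_neg_mul_abs {b : ℝ} (hb : 0 < b) :
    Integrable fun x : ℝ => Real.exp (-(b * |x|)) := by
  rw [← integrableOn_univ, ← Iic_union_Ioi (a := (0 : ℝ)), integrableOn_union]
  constructor
  · refine (integrableOn_exp_mul_Iic hb 0).congr_fun (fun x hx => ?_) measurableSet_Iic
    rw [abs_of_nonpos hx]; ring_nf
  · refine (integrableOn_exp_mul_Ioi (neg_lt_zero.2 hb) 0).congr_fun (fun x hx => ?_)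
      measurableSet_Ioi
    rw [abs_of_pos hx]; ring_nf

lemma norm_inv_exp_le {u v : ℂ} {δ : ℝ} (hδ : 0 < δ) (hu : u.im ≤ -δ) (hv : v.im ≤ -δ) (σ : ℝ) :
    ‖((Real.exp (-(σ / 2)) : ℂ) * u + Real.exp (σ / 2) * v)⁻¹‖ ≤
      δ⁻¹ * Real.exp (-(1 / 2 * |σ|)) := by
  have h1 : δ * Real.exp (1 / 2 * |σ|) ≤
      ‖(Real.exp (-(σ / 2)) : ℂ) * u + Real.exp (σ / 2) * v‖ := by
    refine le_trans ?_ (Complex.abs_im_le_norm _)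
    rw [Complex.add_im, Complex.im_ofReal_mul, Complex.im_ofReal_mul]
    refine le_trans ?_ (neg_le_abs _)
    have ha := Real.exp_pos (-(σ / 2))
    have hb := Real.exp_pos (σ / 2)
    have h2 : Real.exp (1 / 2 * |σ|) ≤ Real.exp (-(σ / 2)) + Real.exp (σ / 2) := by
      rcases abs_cases σ with ⟨h, -⟩ | ⟨h, -⟩ <;> rw [h]
      · rw [show 1 / 2 * σ = σ / 2 by ring]; linarith
      · rw [show 1 / 2 * -σ = -(σ / 2) by ring]; linarith
    nlinarith [mul_le_mul_of_nonneg_left h2 hδ.le]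
  rw [norm_inv, Real.exp_neg (1 / 2 * |σ|), ← mul_inv]
  exact inv_anti₀ (by positivity) h1

lemma integrable_exp_mul_inv_exp {u v : ℂ} (hu : u.im < 0) (hv : v.im < 0) (ν : ℝ) :
    Integrable fun σ : ℝ => Complex.exp (-(Complex.I * ν * σ)) *
        ((Real.exp (-(σ / 2)) : ℂ) * u + Real.exp (σ / 2) * v)⁻¹ := by
  set δ := min (-u.im) (-v.im) with hδ
  have hδ0 : 0 < δ := lt_min (by linarith) (by linarith)
  have h1 : u.im ≤ -δ := by linarith [min_le_left (-u.im) (-v.im)]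
  have h2 : v.im ≤ -δ := by linarith [min_le_right (-u.im) (-v.im)]
  refine Integrable.mono' ((integrable_exp_neg_mul_abs one_half_pos).const_mul δ⁻¹) ?_
    (Eventually.of_forall fun σ => ?_)
  · have := Complex.measurable_ofReal
    exact Measurable.aestronglyMeasurable (by fun_prop)
  · rw [norm_mul, Complex.norm_exp]
    simpa using norm_inv_exp_le hδ0 h1 h2 σ

/-- The sine transform of `1 / sinh`: the limit, on the boundary of the tube of holomorphy, of the
odd part of the Fourier transform of `1 / (e^{-σ/2} u + e^{σ/2} v)`. -/
lemma integral_sin_div_sinh (ν : ℝ) :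
    ∫ σ in Ioi (0 : ℝ), Real.sin (ν * σ) / Real.sinh (σ / 2) =
      Real.pi * Real.tanh (Real.pi * ν) := by
  -- Two points of the unit circle in the lower half-plane, which tend to `1` and `-1` as `θ → π`. In
  -- the limit the kernel `K` is `-1 / (2 sinh (σ / 2))`; its pole is cancelled by the sine.
  set U : ℝ → ℂ := fun θ => Complex.exp ((θ / 2 - Real.pi / 2 : ℝ) * Complex.I) with hU
  set V : ℝ → ℂ := fun θ => Complex.exp ((-θ / 2 - Real.pi / 2 : ℝ) * Complex.I) with hV
  set K : ℝ → ℝ → ℂ := fun θ σ =>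
    ((Real.exp (-(σ / 2)) : ℂ) * U θ + Real.exp (σ / 2) * V θ)⁻¹ with hK
  have hUpi : U Real.pi = 1 := by simp [hU]
  have hVpi : V Real.pi = -1 := by
    rw [hV]; dsimp only
    rw [show -Real.pi / 2 - Real.pi / 2 = -Real.pi by ring]
    push_cast
    rw [neg_mul, Complex.exp_neg, Complex.exp_pi_mul_I]; norm_num
  have hUim : ∀ θ ∈ Ioo 0 Real.pi, (U θ).im < 0 := fun θ hθ => by
    rw [hU, Complex.exp_ofReal_mul_I_im]
    exact Real.sin_neg_of_neg_of_neg_pi_lt (by linarith [hθ.2]) (by linarith [hθ.1, Real.pi_pos])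
  have hVim : ∀ θ ∈ Ioo 0 Real.pi, (V θ).im < 0 := fun θ hθ => by
    rw [hV, Complex.exp_ofReal_mul_I_im]
    exact Real.sin_neg_of_neg_of_neg_pi_lt (by linarith [hθ.1, Real.pi_pos]) (by linarith [hθ.2])
  have hcpow : ∀ x : ℝ, x ∈ Ioo (-Real.pi) 0 → ∀ s : ℂ,
      Complex.exp (x * Complex.I) ^ s = Complex.exp (x * Complex.I * s) := fun x hx s => by
    rw [Complex.cpow_def_of_ne_zero (Complex.exp_ne_zero _), Complex.log_exp]
    · simpa using hx.1
    · simpa using hx.2.le.trans Real.pi_pos.le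
  have h1 : ∀ θ ∈ Ioo 0 Real.pi, ∀ ν : ℝ,
      ∫ σ : ℝ, Complex.exp (-(Complex.I * ν * σ)) * K θ σ =
        Real.pi / Complex.cosh (Real.pi * ν) * (Complex.I * Complex.exp (ν * θ)) := by
    intro θ hθ ν
    rw [hK]; dsimp only
    rw [fourier_inv_exp (hUim θ hθ) (hVim θ hθ), hU, hV,
      hcpow _ ⟨by linarith [hθ.1, Real.pi_pos], by linarith [hθ.2]⟩,
      hcpow _ ⟨by linarith [hθ.2], by linarith [hθ.1, Real.pi_pos]⟩, ← Complex.exp_add]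
    congr 1
    rw [show Complex.I * Complex.exp (ν * θ) = Complex.exp (Real.pi / 2 * Complex.I + ν * θ) by
      rw [Complex.exp_add, Complex.exp_pi_div_two_mul_I]]
    congr 1
    push_cast
    linear_combination (-(θ : ℂ) * ν) * Complex.I_sq
  have h2 : ∀ θ ∈ Ioo 0 Real.pi, ∫ σ : ℝ, (Real.sin (ν * σ) : ℂ) * K θ σ =
      -(Real.pi * Complex.sinh (ν * θ) / Complex.cosh (Real.pi * ν)) := fun θ hθ => by
    have e1 := h1 θ hθ ν
    have e2 := h1 θ hθ (-ν)
    have i1 := integrable_exp_mul_inv_exp (hUim θ hθ) (hVim θ hθ) ν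
    have i2 := integrable_exp_mul_inv_exp (hUim θ hθ) (hVim θ hθ) (-ν)
    have e3 : ∀ σ : ℝ, (Real.sin (ν * σ) : ℂ) * K θ σ = Complex.I / 2 *
        (Complex.exp (-(Complex.I * ν * σ)) * K θ σ -
          Complex.exp (-(Complex.I * (-ν : ℝ) * σ)) * K θ σ) := fun σ => by
      rw [Complex.ofReal_sin, Complex.sin]
      push_cast
      ring_nf
    simp_rw [e3]
    rw [integral_const_mul, integral_sub i1 i2, e1, e2, Complex.sinh]
    have e4 : Complex.cosh (Real.pi * (-ν : ℝ)) = Complex.cosh (Real.pi * ν) := by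
      push_cast; rw [mul_neg, Complex.cosh_neg]
    rw [e4]
    push_cast
    rw [show -(ν : ℂ) * θ = -(ν * θ) by ring]
    linear_combination (Real.pi / Complex.cosh (Real.pi * ν) *
      (Complex.exp (ν * θ) - Complex.exp (-(ν * θ))) / 2) * Complex.I_sq
  have hint : Integrable fun σ : ℝ => 2 * |ν| * Real.exp (-(1 / 4 * |σ|)) :=
    (integrable_exp_neg_mul_abs (by norm_num)).const_mul _
  have hbound : ∀ θ σ : ℝ, ‖(Real.sin (ν * σ) : ℂ) * K θ σ‖ ≤
      2 * |ν| * Real.exp (-(1 / 4 * |σ|)) := fun θ σ => by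
    rcases eq_or_ne σ 0 with rfl | hσ
    · simp
    have hσ' : 0 < |σ| := abs_pos.2 hσ
    have h3 : 2 * Real.sinh (|σ| / 2) ≤
        ‖(Real.exp (-(σ / 2)) : ℂ) * U θ + Real.exp (σ / 2) * V θ‖ := by
      have h := abs_norm_sub_norm_le ((Real.exp (σ / 2) : ℂ) * V θ)
        (-((Real.exp (-(σ / 2)) : ℂ) * U θ))
      rw [sub_neg_eq_add, add_comm, norm_neg, norm_mul, norm_mul, hU, hV,
        Complex.norm_exp_ofReal_mul_I, Complex.norm_exp_ofReal_mul_I, Complex.norm_real,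
        Complex.norm_real, Real.norm_of_nonneg (Real.exp_pos _).le,
        Real.norm_of_nonneg (Real.exp_pos _).le, mul_one, mul_one] at h
      refine le_trans (le_of_eq ?_) h
      rw [Real.sinh_eq, mul_div_cancel₀ _ (two_ne_zero' ℝ)]
      rcases abs_cases σ with ⟨h, h'⟩ | ⟨h, h'⟩
      · rw [h, abs_of_nonneg]
        simp only [sub_nonneg, Real.exp_le_exp]
        linarith
      · rw [h, abs_of_neg, neg_div, neg_neg, neg_sub]
        simp only [sub_neg, Real.exp_lt_exp]
        linarith
    have h4 := abs_sin_div_sinh_le ν hσ'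
    have h5 : ‖(Real.sin (ν * σ) : ℂ)‖ = |Real.sin (ν * |σ|)| := by
      rw [Complex.norm_real, Real.norm_eq_abs]
      rcases abs_cases σ with ⟨h, -⟩ | ⟨h, -⟩ <;> rw [h]
      rw [mul_neg, Real.sin_neg, abs_neg]
    have h6 : 0 < Real.sinh (|σ| / 2) := Real.sinh_pos_iff.2 (by linarith)
    rw [norm_mul, h5, hK, norm_inv, show 2 * |ν| * Real.exp (-(1 / 4 * |σ|)) =
      (4 * |ν| * Real.exp (-(1 / 4) * |σ|)) / 2 by rw [neg_mul]; ring]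
    calc _ ≤ |Real.sin (ν * |σ|)| * (2 * Real.sinh (|σ| / 2))⁻¹ := by gcongr
      _ = |Real.sin (ν * |σ|)| / Real.sinh (|σ| / 2) / 2 := by field_simp
      _ ≤ _ := by gcongr
  have hm : ∀ θ, Measurable fun σ => (Real.sin (ν * σ) : ℂ) * K θ σ := fun θ => by
    have := Complex.measurable_ofReal
    fun_prop
  have hlim := tendsto_integral_filter_of_dominated_convergence (l := 𝓝[Ioo 0 Real.pi] Real.pi)
    (μ := (volume : Measure ℝ)) (F := fun θ σ => (Real.sin (ν * σ) : ℂ) * K θ σ)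
    (f := fun σ => (Real.sin (ν * σ) : ℂ) * K Real.pi σ)
    (fun σ : ℝ => 2 * |ν| * Real.exp (-(1 / 4 * |σ|)))
    (Eventually.of_forall fun θ => (hm θ).aestronglyMeasurable)
    (Eventually.of_forall fun θ => Eventually.of_forall (hbound θ)) hint
    (Eventually.of_forall fun σ => by
      rcases eq_or_ne σ 0 with rfl | hσ
      · simpa using tendsto_const_nhds
      refine Tendsto.const_mul _ (Tendsto.mono_left ?_ nhdsWithin_le_nhds)
      refine ContinuousAt.tendsto (f := fun θ => K θ σ) ?_
      have hUc : Continuous U := by rw [hU]; fun_prop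
      have hVc : Continuous V := by rw [hV]; fun_prop
      refine ContinuousAt.inv₀ (by fun_prop) ?_
      rw [hUpi, hVpi]
      intro h0
      rw [mul_one, mul_neg_one, ← sub_eq_add_neg, sub_eq_zero, Complex.ofReal_inj,
        Real.exp_eq_exp] at h0
      exact hσ (by linarith))
  have hlim2 : Tendsto (fun θ : ℝ => -(Real.pi * Complex.sinh (ν * θ) /
      Complex.cosh (Real.pi * ν))) (𝓝[Ioo 0 Real.pi] Real.pi)
      (𝓝 (-(Real.pi * Complex.sinh (ν * Real.pi) / Complex.cosh (Real.pi * ν)))) := by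
    refine Tendsto.mono_left ?_ nhdsWithin_le_nhds
    refine ContinuousAt.tendsto (f := fun θ : ℝ => -(Real.pi * Complex.sinh (ν * θ) /
      Complex.cosh (Real.pi * ν))) (Continuous.continuousAt ?_)
    have := Complex.continuous_ofReal
    fun_prop
  have hne : (𝓝[Ioo 0 Real.pi] Real.pi).NeBot := by
    rw [nhdsWithin_Ioo_eq_nhdsLT Real.pi_pos]; infer_instance
  have huniq := tendsto_nhds_unique (hlim.congr' (by
    filter_upwards [self_mem_nhdsWithin] with θ hθ
    exact h2 θ hθ)) hlim2
  have hi : Integrable fun σ => (Real.sin (ν * σ) : ℂ) * K Real.pi σ :=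
    Integrable.mono' hint (hm _).aestronglyMeasurable (Eventually.of_forall (hbound _))
  have hKpi : ∀ σ, K Real.pi σ = -(2 * Real.sinh (σ / 2) : ℝ)⁻¹ := fun σ => by
    simp only [hK, hUpi, hVpi]
    rw [mul_one, mul_neg_one, Complex.ofReal_inv, ← inv_neg, Real.sinh_eq]
    congr 1
    push_cast
    ring
  rw [integral_eq_integral_Ioi_add hi] at huniq
  have h7 : ∀ σ : ℝ, (Real.sin (ν * σ) : ℂ) * K Real.pi σ +
      (Real.sin (ν * -σ) : ℂ) * K Real.pi (-σ) =
      -((Real.sin (ν * σ) / Real.sinh (σ / 2) : ℝ) : ℂ) := fun σ => by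
    rw [hKpi, hKpi, mul_neg ν, Real.sin_neg, neg_div, Real.sinh_neg]
    push_cast
    rw [mul_neg 2, inv_neg, mul_inv]
    ring
  simp_rw [h7] at huniq
  rw [integral_neg, neg_inj, integral_complex_ofReal] at huniq
  have h8 : (Real.pi * Complex.sinh (ν * Real.pi) / Complex.cosh (Real.pi * ν) : ℂ) =
      ((Real.pi * Real.tanh (Real.pi * ν) : ℝ) : ℂ) := by
    rw [Real.tanh_eq_sinh_div_cosh]
    push_cast
    rw [mul_comm (ν : ℂ), mul_div_assoc]
  rw [h8] at huniq
  exact_mod_cast huniq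

/-! ### Inversion of the Fourier transform of `(2 cosh σ + 2 ζ)^{-1/2}` -/

lemma abs_mul_exp_le {b : ℝ} (hb : 0 < b) (x : ℝ) :
    |x| * Real.exp (-(b * |x|)) ≤ 2 / b * Real.exp (-(b / 2 * |x|)) := by
  have h1 : b / 2 * |x| ≤ Real.exp (b / 2 * |x|) :=
    (le_trans (by linarith) (Real.add_one_le_exp _))
  have h2 : Real.exp (-(b * |x|)) * Real.exp (b / 2 * |x|) = Real.exp (-(b / 2 * |x|)) := by
    rw [← Real.exp_add]; congr 1; ring
  have h3 := mul_le_mul_of_nonneg_left h1 (Real.exp_pos (-(b * |x|))).le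
  rw [h2] at h3
  calc |x| * Real.exp (-(b * |x|)) = 2 / b * (Real.exp (-(b * |x|)) * (b / 2 * |x|)) := by
        field_simp
    _ ≤ _ := by gcongr

lemma integrable_abs_mul_exp {b : ℝ} (hb : 0 < b) :
    Integrable fun x : ℝ => |x| * Real.exp (-(b * |x|)) :=
  Integrable.mono' ((integrable_exp_neg_mul_abs (half_pos hb)).const_mul (2 / b))
    (by fun_prop) (Eventually.of_forall fun x => by
      rw [Real.norm_of_nonneg (by positivity)]
      exact abs_mul_exp_le hb x)

lemma sq_mem_slitPlane {D : ℂ} (hD : 0 < D.re) : D ^ 2 ∈ Complex.slitPlane := by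
  rw [Complex.mem_slitPlane_iff, sq, Complex.mul_re, Complex.mul_im]
  by_contra h
  push Not at h
  have : D.im = 0 := by
    have := h.2
    rcases mul_eq_zero.1 (show D.re * D.im = 0 by linarith) with h | h
    · linarith
    · exact h
  rw [this] at h
  nlinarith [h.1]

/-- The function `(2 cosh σ + 2 ζ)^{-1/2}`. -/
def invSqrtCosh (ζ : ℂ) (σ : ℝ) : ℂ := (2 * Complex.cosh σ + 2 * ζ) ^ (-1 / 2 : ℂ)

lemma invSqrtCosh_eq_inv {ζ D : ℂ} {σ : ℝ} (hD : D ^ 2 = 2 * Complex.cosh σ + 2 * ζ)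
    (hre : 0 < D.re) : invSqrtCosh ζ σ = D⁻¹ := by
  rw [invSqrtCosh, ← hD, neg_div, Complex.cpow_neg, one_div, Complex.sq_cpow_two_inv hre]

lemma invSqrtCosh_neg (ζ : ℂ) (σ : ℝ) : invSqrtCosh ζ (-σ) = invSqrtCosh ζ σ := by
  simp [invSqrtCosh]

section

variable {ζ : ℂ}

lemma sq_invSqrtCosh_mul {σ : ℝ} (h : 2 * Complex.cosh σ + 2 * ζ ∈ Complex.slitPlane) :
    invSqrtCosh ζ σ ^ 2 * (2 * Complex.cosh σ + 2 * ζ) = 1 := by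
  have h0 := Complex.slitPlane_ne_zero h
  rw [invSqrtCosh, ← Complex.cpow_nat_mul]
  norm_num
  rw [Complex.cpow_neg_one, inv_mul_cancel₀ h0]

lemma hasDerivAt_invSqrtCosh {σ : ℝ} (h : 2 * Complex.cosh σ + 2 * ζ ∈ Complex.slitPlane) :
    HasDerivAt (invSqrtCosh ζ) (-(Complex.sinh σ * invSqrtCosh ζ σ ^ 3)) σ := by
  have h1 : HasDerivAt (fun σ : ℝ => 2 * Complex.cosh σ + 2 * ζ) (2 * Complex.sinh σ) σ :=
    (((Complex.hasDerivAt_cosh (σ : ℂ)).comp_ofReal).const_mul 2).add_const _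
  have h2 : HasDerivAt (fun w : ℂ => w ^ (-1 / 2 : ℂ))
      ((-1 / 2) * (2 * Complex.cosh σ + 2 * ζ) ^ (-1 / 2 - 1 : ℂ)) (2 * Complex.cosh σ + 2 * ζ) := by
    simpa using (hasDerivAt_id' (2 * Complex.cosh (σ : ℂ) + 2 * ζ)).cpow_const
      (c := (-1 / 2 : ℂ)) h
  refine (h2.comp_of_eq σ h1 rfl).congr_deriv ?_
  rw [invSqrtCosh, ← Complex.cpow_nat_mul,
    show ((3 : ℕ) : ℂ) * (-1 / 2) = -1 / 2 - 1 by norm_num]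
  ring

lemma tendsto_sinh_mul_invSqrtCosh :
    Tendsto (fun σ : ℝ => Complex.sinh (σ / 2 : ℝ) * invSqrtCosh ζ σ) atTop (𝓝 (1 / 2)) := by
  have he : Tendsto (fun σ : ℝ => ((Real.exp (-σ) : ℝ) : ℂ)) atTop (𝓝 0) := by
    exact_mod_cast (Complex.continuous_ofReal.tendsto 0).comp
      (Real.tendsto_exp_atBot.comp tendsto_neg_atTop_atBot)
  have hQ : Tendsto (fun σ : ℝ => (1 : ℂ) + (Real.exp (-σ) : ℝ) * (Real.exp (-σ) : ℝ) +
      2 * ζ * (Real.exp (-σ) : ℝ)) atTop (𝓝 1) := by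
    have := ((tendsto_const_nhds (x := (1 : ℂ))).add (he.mul he)).add (he.const_mul (2 * ζ))
    simpa using this
  have hP : Tendsto (fun σ : ℝ => ((1 : ℂ) + (Real.exp (-σ) : ℝ) * (Real.exp (-σ) : ℝ) +
      2 * ζ * (Real.exp (-σ) : ℝ)) ^ (-1 / 2 : ℂ)) atTop (𝓝 1) := by
    have hc : ContinuousAt (fun w : ℂ => w ^ (-1 / 2 : ℂ)) 1 :=
      continuousAt_cpow_const (by simp)
    have := hc.tendsto.comp hQ
    rwa [Complex.one_cpow] at this
  have h := (((tendsto_const_nhds (x := (1 : ℂ))).sub he).div_const 2).mul hP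
  rw [sub_zero, mul_one] at h
  refine h.congr' ?_
  filter_upwards [hQ.eventually_ne one_ne_zero] with σ hσ
  have h1 : 2 * Complex.cosh σ + 2 * ζ = (Real.exp σ : ℂ) * ((1 : ℂ) +
      (Real.exp (-σ) : ℝ) * (Real.exp (-σ) : ℝ) + 2 * ζ * (Real.exp (-σ) : ℝ)) := by
    have h2 : (Real.exp σ : ℂ) * (Real.exp (-σ) : ℝ) = 1 := by
      rw [← Complex.ofReal_mul, ← Real.exp_add]; simp
    rw [Complex.cosh, ← Complex.ofReal_neg, ← Complex.ofReal_exp, ← Complex.ofReal_exp]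
    linear_combination (-(Real.exp (-σ) : ℂ) - 2 * ζ) * h2
  rw [invSqrtCosh, h1, ofReal_mul_cpow (Real.exp_pos σ) hσ, ← mul_assoc]
  congr 1
  have h3 : ((Real.exp σ : ℝ) : ℂ) ^ (-1 / 2 : ℂ) = (Real.exp (-(σ / 2)) : ℝ) := by
    rw [show (-1 / 2 : ℂ) = ((-1 / 2 : ℝ) : ℂ) by push_cast; ring,
      ← Complex.ofReal_cpow (Real.exp_pos _).le, ← Real.exp_mul]
    congr 2; ring
  rw [h3, ← Complex.ofReal_sinh, Real.sinh_eq]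
  have h4 : Real.exp (σ / 2) * Real.exp (-(σ / 2)) = 1 := by rw [← Real.exp_add]; simp
  have h5 : Real.exp (-σ) = Real.exp (-(σ / 2)) * Real.exp (-(σ / 2)) := by
    rw [← Real.exp_add]; congr 1; ring
  rw [h5, ← Complex.ofReal_mul]
  have h6 : (Real.exp (σ / 2) - Real.exp (-(σ / 2))) / 2 * Real.exp (-(σ / 2)) =
      (1 - Real.exp (-(σ / 2)) * Real.exp (-(σ / 2))) / 2 := by linear_combination h4 / 2
  rw [h6]
  push_cast
  ring

/-- `∫ cosh (σ/2) (2 cosh σ + 2 ζ)^{-3/2} dσ`, by the explicit primitive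
`(1 + ζ)⁻¹ sinh (σ/2) (2 cosh σ + 2 ζ)^{-1/2}`. -/
lemma integral_cosh_mul_invSqrtCosh
    (h : ∀ σ : ℝ, 2 * Complex.cosh σ + 2 * ζ ∈ Complex.slitPlane)
    (hint : IntegrableOn (fun σ : ℝ => Complex.cosh (σ / 2 : ℝ) * invSqrtCosh ζ σ ^ 3) (Ioi 0)) :
    ∫ σ in Ioi (0 : ℝ), Complex.cosh (σ / 2 : ℝ) * invSqrtCosh ζ σ ^ 3 = 1 / (2 * (1 + ζ)) := by
  have h1 : 1 + ζ ≠ 0 := fun h0 => by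
    have := Complex.slitPlane_ne_zero (h 0)
    apply this
    simp only [Complex.ofReal_zero, Complex.cosh_zero]
    linear_combination 2 * h0
  have hd : ∀ σ ∈ Ici (0 : ℝ), HasDerivAt
      (fun σ : ℝ => (1 + ζ)⁻¹ * (Complex.sinh (σ / 2 : ℝ) * invSqrtCosh ζ σ))
      (Complex.cosh (σ / 2 : ℝ) * invSqrtCosh ζ σ ^ 3) σ := fun σ _ => by
    have hs : HasDerivAt (fun σ : ℝ => Complex.sinh (σ / 2 : ℝ))
        (Complex.cosh (σ / 2 : ℝ) * (1 / 2 : ℝ)) σ := by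
      have := ((Complex.hasDerivAt_sinh ((σ / 2 : ℝ) : ℂ)).comp_ofReal).scomp σ
        ((hasDerivAt_id' σ).div_const 2)
      refine this.congr_deriv ?_
      rw [Complex.real_smul]; ring
    refine ((hs.mul (hasDerivAt_invSqrtCosh (h σ))).const_mul _).congr_deriv ?_
    have h2 : Complex.sinh (σ : ℂ) = 2 * Complex.sinh (σ / 2 : ℝ) * Complex.cosh (σ / 2 : ℝ) := by
      rw [← Complex.sinh_two_mul]; congr 1; push_cast; ring
    have h3 : Complex.cosh (σ : ℂ) = 2 * Complex.sinh (σ / 2 : ℝ) ^ 2 + 1 := by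
      have := Complex.cosh_two_mul ((σ / 2 : ℝ) : ℂ)
      rw [Complex.cosh_sq] at this
      rw [show (σ : ℂ) = 2 * ((σ / 2 : ℝ) : ℂ) by push_cast; ring, this]; ring
    have h4 := sq_invSqrtCosh_mul (h σ)
    rw [h3] at h4
    rw [h2]
    set v := invSqrtCosh ζ σ
    set S := Complex.sinh (σ / 2 : ℝ)
    set K := Complex.cosh (σ / 2 : ℝ)
    rw [inv_mul_eq_iff_eq_mul₀ h1]
    push_cast
    linear_combination (-K * v / 2) * h4
  have := integral_Ioi_of_hasDerivAt_of_tendsto' hd hint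
    (tendsto_sinh_mul_invSqrtCosh.const_mul (1 + ζ)⁻¹)
  rw [this]
  simp

lemma norm_sinh_mul_invSqrtCosh_le {C : ℝ}
    (hC : ∀ σ, ‖invSqrtCosh ζ σ‖ ≤ C * Real.exp (-(1 / 2 * |σ|))) (σ : ℝ) :
    ‖Complex.sinh σ * invSqrtCosh ζ σ ^ 3‖ ≤ C ^ 3 * Real.exp (-(1 / 2 * |σ|)) := by
  have h1 : ‖Complex.sinh σ‖ ≤ Real.exp |σ| := by
    rw [← Complex.ofReal_sinh, Complex.norm_real, Real.norm_eq_abs, Real.abs_sinh, Real.sinh_eq]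
    have := Real.exp_pos (-|σ|)
    have := Real.exp_pos |σ|
    linarith
  rw [norm_mul, norm_pow]
  calc ‖Complex.sinh σ‖ * ‖invSqrtCosh ζ σ‖ ^ 3
      ≤ Real.exp |σ| * (C * Real.exp (-(1 / 2 * |σ|))) ^ 3 := by
        gcongr
        exact hC σ
    _ = C ^ 3 * Real.exp (-(1 / 2 * |σ|)) := by
        rw [mul_pow, ← Real.exp_nat_mul, mul_left_comm, ← Real.exp_add]
        congr 2; push_cast; ring

/-- The derivative of `(2 cosh σ + 2 ζ)^{-1/2}` is recovered from its Fourier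
transform. As `E` is even, the inversion integral is a sine integral over the half-line. -/
lemma integral_sin_mul_fourier {E : ℝ → ℂ}
    (h : ∀ σ : ℝ, 2 * Complex.cosh σ + 2 * ζ ∈ Complex.slitPlane)
    {C κ C' : ℝ} (hC : ∀ σ, ‖invSqrtCosh ζ σ‖ ≤ C * Real.exp (-(1 / 2 * |σ|)))
    (hE : ∀ ν : ℝ, E ν = ∫ σ : ℝ, Complex.exp (-(Complex.I * ν * σ)) * invSqrtCosh ζ σ)
    (hEm : Continuous E)
    (hκ : 0 < κ) (hC' : ∀ ν, ‖E ν‖ ≤ C' * Real.exp (-(κ * |ν|))) (σ : ℝ) :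
    ∫ ν in Ioi (0 : ℝ), (ν : ℂ) * E ν * Real.sin (ν * σ) =
      Real.pi * (Complex.sinh σ * invSqrtCosh ζ σ ^ 3) := by
  set v := invSqrtCosh ζ with hv
  have hd : ∀ σ : ℝ, HasDerivAt v (-(Complex.sinh σ * v σ ^ 3)) σ := fun σ =>
    hasDerivAt_invSqrtCosh (h σ)
  have hvc : Continuous v := continuous_iff_continuousAt.2 fun x => (hd x).continuousAt
  have hderiv : deriv v = fun σ : ℝ => -(Complex.sinh σ * v σ ^ 3) := funext fun σ => (hd σ).deriv
  have hdc : Continuous (deriv v) := by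
    rw [hderiv]
    have : Continuous fun σ : ℝ => Complex.sinh σ :=
      Complex.continuous_sinh.comp Complex.continuous_ofReal
    fun_prop
  have hvi : Integrable v := Integrable.mono'
    ((integrable_exp_neg_mul_abs one_half_pos).const_mul C) hvc.aestronglyMeasurable
    (Eventually.of_forall hC)
  have hdi : Integrable (deriv v) := by
    refine Integrable.mono' ((integrable_exp_neg_mul_abs one_half_pos).const_mul (C ^ 3))
      hdc.aestronglyMeasurable (Eventually.of_forall fun σ => ?_)
    rw [hderiv, norm_neg]
    exact norm_sinh_mul_invSqrtCosh_le hC σ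
  have hF : ∀ w, 𝓕 v w = E (2 * Real.pi * w) := fun w => by
    rw [hE, Real.fourier_real_eq_integral_exp_smul]
    refine integral_congr_ae (Eventually.of_forall fun σ => ?_)
    dsimp only
    rw [smul_eq_mul]
    congr 2
    push_cast; ring
  set G : ℝ → ℂ := fun ν => Complex.exp (Complex.I * ν * σ) * (Complex.I * ν * E ν) with hG
  have hFd : 𝓕 (deriv v) = fun w : ℝ =>
      Complex.I * (2 * Real.pi * w : ℝ) * E (2 * Real.pi * w) := by
    rw [Real.fourier_deriv hvi (fun x => (hd x).differentiableAt) hdi]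
    funext w
    rw [hF, smul_eq_mul]; push_cast; ring
  have hIE : Integrable fun ν : ℝ => Complex.I * ν * E ν := by
    refine Integrable.mono' ((integrable_abs_mul_exp hκ).const_mul C')
      (by have := Complex.continuous_ofReal
          exact Continuous.aestronglyMeasurable (by fun_prop)) (Eventually.of_forall fun ν => ?_)
    rw [norm_mul, norm_mul, Complex.norm_I, one_mul, Complex.norm_real, Real.norm_eq_abs]
    nlinarith [mul_le_mul_of_nonneg_left (hC' ν) (abs_nonneg ν)]
  have h2π : (2 * Real.pi) ≠ 0 := by positivity
  have hinv := congrFun (hdc.fourierInv_fourier_eq hdi (by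
    rw [hFd]; exact hIE.comp_mul_left' h2π)) σ
  have hGi : Integrable G := by
    refine hIE.bdd_mul (c := 1) (by
      have := Complex.continuous_ofReal
      exact Continuous.aestronglyMeasurable (by fun_prop)) (Eventually.of_forall fun ν => ?_)
    rw [Complex.norm_exp]; simp
  have h1 : 𝓕⁻ (𝓕 (deriv v)) σ = ((2 * Real.pi)⁻¹ : ℝ) * ∫ ν, G ν := by
    rw [Real.fourierInv_eq', hFd]
    have := Measure.integral_comp_mul_left G (2 * Real.pi)
    rw [abs_of_pos (by positivity), Complex.real_smul] at this
    rw [← this]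
    refine integral_congr_ae (Eventually.of_forall fun w => ?_)
    dsimp only [G]
    rw [smul_eq_mul]
    congr 2
    simp
    ring
  rw [h1, integral_eq_integral_Ioi_add hGi, hderiv] at hinv
  have hEeven : ∀ ν, E (-ν) = E ν := fun ν => by
    rw [hE, hE, ← integral_neg_eq_self]
    refine integral_congr_ae (Eventually.of_forall fun w => ?_)
    dsimp only
    rw [hv, invSqrtCosh_neg]
    congr 2
    push_cast; ring
  have hGs : ∀ ν : ℝ, G ν + G (-ν) = -2 * ((ν : ℂ) * E ν * Real.sin (ν * σ)) := fun ν => by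
    simp only [hG]
    rw [hEeven, Complex.ofReal_sin, Complex.sin]
    push_cast
    rw [show Complex.I * -(ν : ℂ) * σ = -(ν * σ) * Complex.I by ring,
      show Complex.I * (ν : ℂ) * σ = (ν * σ) * Complex.I by ring]
    ring
  simp_rw [hGs] at hinv
  rw [integral_const_mul] at hinv
  have hpi : (Real.pi : ℂ) ≠ 0 := by exact_mod_cast Real.pi_ne_zero
  push_cast at hinv ⊢
  field_simp at hinv
  linear_combination -hinv

/-- The Fourier transform `E` of `(2 cosh σ + 2 ζ)^{-1/2}`, integrated against `ν tanh (π ν)`.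
As `π tanh (π ν)` is the sine transform of `1 / sinh (σ/2)`, exchanging the two integrals leaves
`1 / sinh (σ/2)` against the derivative of `(2 cosh σ + 2 ζ)^{-1/2}`, which has a primitive. -/
theorem integral_tanh_mul_fourier {E : ℝ → ℂ}
    (h : ∀ σ : ℝ, 2 * Complex.cosh σ + 2 * ζ ∈ Complex.slitPlane)
    {C κ C' : ℝ} (hC : ∀ σ, ‖invSqrtCosh ζ σ‖ ≤ C * Real.exp (-(1 / 2 * |σ|)))
    (hE : ∀ ν : ℝ, E ν = ∫ σ : ℝ, Complex.exp (-(Complex.I * ν * σ)) * invSqrtCosh ζ σ)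
    (hEm : Continuous E)
    (hκ : 0 < κ) (hC' : ∀ ν, ‖E ν‖ ≤ C' * Real.exp (-(κ * |ν|))) :
    ∫ ν in Ioi (0 : ℝ), (ν : ℂ) * Real.tanh (Real.pi * ν) * E ν = 1 / (1 + ζ) := by
  set μ := volume.restrict (Ioi (0 : ℝ)) with hμ
  set Φ : ℝ → ℝ → ℂ := fun ν σ =>
    (ν : ℂ) * E ν * ((Real.sin (ν * σ) / Real.sinh (σ / 2) : ℝ) : ℂ) with hΦ
  have hpi : (Real.pi : ℂ) ≠ 0 := by exact_mod_cast Real.pi_ne_zero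
  have h1 : ∀ ν : ℝ, ∫ σ, Φ ν σ ∂μ =
      Real.pi * ((ν : ℂ) * Real.tanh (Real.pi * ν) * E ν) := fun ν => by
    simp only [hΦ]
    rw [integral_const_mul, integral_complex_ofReal, integral_sin_div_sinh]
    push_cast; ring
  have h2 : ∀ σ ∈ Ioi (0 : ℝ), ∫ ν, Φ ν σ ∂μ =
      2 * Real.pi * (Complex.cosh (σ / 2 : ℝ) * invSqrtCosh ζ σ ^ 3) := fun σ hσ => by
    have hσ' : (0 : ℝ) < σ := hσ
    have e1 : ∀ ν : ℝ, Φ ν σ = ((ν : ℂ) * E ν * Real.sin (ν * σ)) *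
        ((Real.sinh (σ / 2) : ℝ) : ℂ)⁻¹ := fun ν => by
      simp only [hΦ]; push_cast; ring
    have e2 : Complex.sinh (σ : ℂ) = 2 * Complex.sinh (σ / 2 : ℝ) * Complex.cosh (σ / 2 : ℝ) := by
      rw [← Complex.sinh_two_mul]; congr 1; push_cast; ring
    have e3 : ((Real.sinh (σ / 2) : ℝ) : ℂ) ≠ 0 := by
      exact_mod_cast (Real.sinh_pos_iff.2 (by linarith : 0 < σ / 2)).ne'
    simp_rw [e1]
    rw [integral_mul_const, integral_sin_mul_fourier h hC hE hEm hκ hC', e2,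
      ← Complex.ofReal_sinh]
    field_simp
  have hint : Integrable (Function.uncurry Φ) (μ.prod μ) := by
    have hb : Integrable (fun q : ℝ × ℝ => (C' * (|q.1| * (|q.1| * Real.exp (-(κ * |q.1|))))) *
        (4 * Real.exp (-(1 / 4) * q.2))) (μ.prod μ) := by
      refine Integrable.mul_prod (f := fun x => C' * (|x| * (|x| * Real.exp (-(κ * |x|)))))
        (g := fun y => 4 * Real.exp (-(1 / 4) * y)) ?_ ?_
      · refine Integrable.const_mul ?_ _
        refine Integrable.mono' (((integrable_abs_mul_exp (half_pos hκ)).const_mul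
          (2 / κ)).restrict) (by fun_prop) (Eventually.of_forall fun x => ?_)
        rw [Real.norm_of_nonneg (by positivity)]
        refine (mul_le_mul_of_nonneg_left (abs_mul_exp_le hκ x) (abs_nonneg x)).trans (le_of_eq ?_)
        ring
      · exact (integrableOn_exp_mul_Ioi (by norm_num) 0).const_mul _
    refine hb.mono' ?_ ?_
    · have h3 := Complex.measurable_ofReal
      have h4 := hEm.measurable
      refine Measurable.aestronglyMeasurable ?_
      simp only [hΦ, Function.uncurry_def]
      refine ((h3.comp measurable_fst).mul (h4.comp measurable_fst)).mul (h3.comp ?_)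
      exact (by fun_prop : Measurable fun q : ℝ × ℝ => Real.sin (q.1 * q.2)).div
        (Real.measurable_sinh.comp (by fun_prop))
    · have hmem : ∀ᵐ q ∂(μ.prod μ), q ∈ Ioi (0 : ℝ) ×ˢ Ioi (0 : ℝ) := by
        rw [hμ, Measure.prod_restrict]
        exact ae_restrict_mem (measurableSet_Ioi.prod measurableSet_Ioi)
      filter_upwards [hmem] with q hq
      have h2 : 0 < q.2 := hq.2
      simp only [hΦ, Function.uncurry_def]
      rw [norm_mul, norm_mul, Complex.norm_real, Complex.norm_real, Real.norm_eq_abs,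
        Real.norm_eq_abs, abs_div, abs_of_pos (Real.sinh_pos_iff.2 (half_pos h2))]
      calc _ ≤ |q.1| * (C' * Real.exp (-(κ * |q.1|))) *
            (4 * |q.1| * Real.exp (-(1 / 4) * q.2)) := by
            have := abs_sin_div_sinh_le q.1 h2
            have h5 := hC' q.1
            have h6 := Real.sinh_pos_iff.2 (half_pos h2)
            refine mul_le_mul (mul_le_mul_of_nonneg_left h5 (abs_nonneg _)) this (by positivity) ?_
            exact mul_nonneg (abs_nonneg _) ((norm_nonneg _).trans h5)
        _ = _ := by ring
  have hswap := integral_integral_swap hint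
  simp_rw [h1] at hswap
  rw [setIntegral_congr_fun measurableSet_Ioi h2, integral_const_mul, integral_const_mul,
    integral_cosh_mul_invSqrtCosh h] at hswap
  · have := mul_left_cancel₀ hpi (hswap.trans (by ring :
      2 * (Real.pi : ℂ) * (1 / (2 * (1 + ζ))) = Real.pi * (2 * (1 / (2 * (1 + ζ))))))
    rw [this, one_div, one_div, mul_inv]
    ring
  · have := hint.integral_prod_right
    have h3 := (integrable_congr (ae_restrict_of_forall_mem measurableSet_Ioi h2)).1 this
    have h4 := h3.const_mul (2 * (Real.pi : ℂ))⁻¹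
    refine h4.congr (Eventually.of_forall fun σ => ?_)
    field_simp

end

/-! ### The kernel of the inversion formula -/

lemma exists_im_le {z : Fin 3 → ℂ} (hz : ∀ ξ ∈ futureCone, (mink z (toC ξ)).im < 0) :
    ∃ δ > 0, ∀ α ∈ Icc (-Real.pi) Real.pi,
      (mink z (toC ![1, Real.cos α, Real.sin α])).im ≤ -δ := by
  obtain ⟨β, -, hβ⟩ := isCompact_Icc.exists_isMaxOn
    (nonempty_Icc.2 (by linarith [Real.pi_pos] : -Real.pi ≤ Real.pi))
    (Complex.continuous_im.comp (continuous_mink_circle z)).continuousOn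
  refine ⟨-(mink z (toC ![1, Real.cos β, Real.sin β])).im,
    neg_pos.2 (hz _ (circle_mem_futureCone β)), fun α hα => ?_⟩
  rw [neg_neg]
  exact hβ hα

lemma arg_mem_Ioo {w : ℂ} (hw : w.im < 0) : w.arg ∈ Ioo (-Real.pi) 0 :=
  ⟨Complex.neg_pi_lt_arg w, Complex.arg_neg_iff.2 hw⟩

/-- On the circle, the arguments of two forms with values in the lower half-plane differ by less
than `π`, uniformly. -/
lemma exists_arg_sub_le {z y : Fin 3 → ℂ} (hz : ∀ ξ ∈ futureCone, (mink z (toC ξ)).im < 0)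
    (hy : ∀ ξ ∈ futureCone, (mink y (toC ξ)).im < 0) :
    ∃ κ > 0, ∀ α ∈ Icc (-Real.pi) Real.pi,
      |(mink z (toC ![1, Real.cos α, Real.sin α])).arg -
        (mink y (toC ![1, Real.cos α, Real.sin α])).arg| ≤ Real.pi - κ := by
  have hc : ∀ {z : Fin 3 → ℂ}, (∀ ξ ∈ futureCone, (mink z (toC ξ)).im < 0) →
      Continuous fun α : ℝ => (mink z (toC ![1, Real.cos α, Real.sin α])).arg := fun {z} hz =>
    continuous_iff_continuousAt.2 fun α =>
      ContinuousAt.comp (g := Complex.arg)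
        (f := fun α : ℝ => mink z (toC ![1, Real.cos α, Real.sin α]))
        (Complex.continuousAt_arg (Complex.mem_slitPlane_iff.2
          (Or.inr (hz _ (circle_mem_futureCone α)).ne))) (continuous_mink_circle z).continuousAt
  obtain ⟨β, -, hβ⟩ := isCompact_Icc.exists_isMaxOn
    (nonempty_Icc.2 (by linarith [Real.pi_pos] : -Real.pi ≤ Real.pi))
    ((hc hz).sub (hc hy)).abs.continuousOn
  refine ⟨Real.pi - |(mink z (toC ![1, Real.cos β, Real.sin β])).arg -
        (mink y (toC ![1, Real.cos β, Real.sin β])).arg|, ?_, fun α hα => ?_⟩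
  · have h1 := arg_mem_Ioo (hz _ (circle_mem_futureCone β))
    have h2 := arg_mem_Ioo (hy _ (circle_mem_futureCone β))
    rw [gt_iff_lt, sub_pos, abs_lt]
    constructor <;> linarith [h1.1, h1.2, h2.1, h2.2]
  · rw [sub_sub_cancel]
    exact hβ hα

lemma norm_cpow_half_add_eq {w : ℂ} (hw : w ≠ 0) (ν : ℝ) :
    ‖w ^ (-1 / 2 + Complex.I * ν : ℂ)‖ = ‖w‖ ^ (-(1 / 2) : ℝ) * Real.exp (-ν * w.arg) := by
  rw [← norm_cpow_half_eq hw (-ν)]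
  congr 2
  push_cast; ring

lemma le_norm_of_im_le {w : ℂ} {δ : ℝ} (h : w.im ≤ -δ) : δ ≤ ‖w‖ :=
  (le_trans (by linarith) (neg_le_abs _)).trans (Complex.abs_im_le_norm w)

/-- The product `[z·ξ]^{-1/2+iν} [y·ξ]^{-1/2-iν}` of two plane waves, at `ξ = (1, cos α, sin α)`. -/
def angularKernel (z y : Fin 3 → ℂ) (ν α : ℝ) : ℂ :=
  mink z (toC ![1, Real.cos α, Real.sin α]) ^ (-1 / 2 + Complex.I * ν : ℂ) *
    mink y (toC ![1, Real.cos α, Real.sin α]) ^ (-1 / 2 - Complex.I * ν : ℂ)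

section

variable {z y : Fin 3 → ℂ}

lemma exists_norm_angularKernel_le (hz : ∀ ξ ∈ futureCone, (mink z (toC ξ)).im < 0)
    (hy : ∀ ξ ∈ futureCone, (mink y (toC ξ)).im < 0) :
    ∃ M κ : ℝ, 0 ≤ M ∧ 0 < κ ∧ ∀ ν, ∀ α ∈ Icc (-Real.pi) Real.pi,
      ‖angularKernel z y ν α‖ ≤ M * Real.exp ((Real.pi - κ) * |ν|) := by
  obtain ⟨δ, hδ, h1⟩ := exists_im_le hz
  obtain ⟨δ', hδ', h2⟩ := exists_im_le hy
  obtain ⟨κ, hκ, h3⟩ := exists_arg_sub_le hz hy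
  refine ⟨δ ^ (-(1 / 2) : ℝ) * δ' ^ (-(1 / 2) : ℝ), κ, by positivity, hκ, fun ν α hα => ?_⟩
  have e1 := le_norm_of_im_le (h1 α hα)
  have e2 := le_norm_of_im_le (h2 α hα)
  rw [angularKernel, norm_mul, norm_cpow_half_add_eq (norm_pos_iff.1 (hδ.trans_le e1)),
    norm_cpow_half_eq (norm_pos_iff.1 (hδ'.trans_le e2)), mul_mul_mul_comm, ← Real.exp_add]
  gcongr ?_ * ?_ * Real.exp ?_
  · exact Real.rpow_le_rpow_of_nonpos hδ e1 (by norm_num)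
  · exact Real.rpow_le_rpow_of_nonpos hδ' e2 (by norm_num)
  · rw [mul_comm (Real.pi - κ)]
    refine le_trans ?_ (mul_le_mul_of_nonneg_left (h3 α hα) (abs_nonneg ν))
    rw [← abs_mul]
    refine le_trans (le_of_eq ?_) (neg_le_abs _)
    ring

lemma im_mink_comb_neg (hz : ∀ ξ ∈ futureCone, (mink z (toC ξ)).im < 0)
    (hy : ∀ ξ ∈ futureCone, (mink y (toC ξ)).im < 0) (σ : ℝ) :
    ∀ ξ ∈ futureCone, (mink ((Real.exp (-(σ / 2)) : ℂ) • y + (Real.exp (σ / 2) : ℂ) • z)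
      (toC ξ)).im < 0 := fun ξ hξ => by
  have h : mink ((Real.exp (-(σ / 2)) : ℂ) • y + (Real.exp (σ / 2) : ℂ) • z) (toC ξ) =
      (Real.exp (-(σ / 2)) : ℂ) * mink y (toC ξ) + (Real.exp (σ / 2) : ℂ) * mink z (toC ξ) := by
    simp only [mink, Pi.add_apply, Pi.smul_apply, smul_eq_mul]; ring
  rw [h, Complex.add_im, Complex.im_ofReal_mul, Complex.im_ofReal_mul]
  have h1 := mul_neg_of_pos_of_neg (Real.exp_pos (-(σ / 2))) (hy ξ hξ)
  have h2 := mul_neg_of_pos_of_neg (Real.exp_pos (σ / 2)) (hz ξ hξ)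
  linarith

/-- The circle integral of `1 / [W·ξ]` for `W = e^{-σ/2} y + e^{σ/2} z`: here
`-[W·W] = 2 cosh σ - 2 [z·y]`. -/
lemma circle_integral_comb (hz : ∀ ξ ∈ futureCone, (mink z (toC ξ)).im < 0)
    (hy : ∀ ξ ∈ futureCone, (mink y (toC ξ)).im < 0) (hzz : mink z z = -1) (hyy : mink y y = -1)
    (σ : ℝ) :
    2 * Complex.cosh σ + 2 * -mink z y ∈ Complex.slitPlane ∧
      invSqrtCosh (-mink z y) σ = (2 * Real.pi * Complex.I)⁻¹ *
        ∫ α in (-Real.pi)..Real.pi,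
          ((Real.exp (-(σ / 2)) : ℂ) * mink y (toC ![1, Real.cos α, Real.sin α]) +
            (Real.exp (σ / 2) : ℂ) * mink z (toC ![1, Real.cos α, Real.sin α]))⁻¹ := by
  obtain ⟨D, hD, hre, hint⟩ := exists_integral_inv_mink (im_mink_comb_neg hz hy σ)
  have hprod : (Real.exp (-(σ / 2)) : ℂ) * Real.exp (σ / 2) = 1 := by
    rw [← Complex.ofReal_mul, ← Real.exp_add]; simp
  have h1 : Complex.exp (σ : ℂ) = (Real.exp (σ / 2) : ℂ) ^ 2 := by
    rw [← Complex.ofReal_exp, ← Complex.ofReal_pow, ← Real.exp_nat_mul]; congr 2; push_cast; ring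
  have h2 : Complex.exp (-σ : ℂ) = (Real.exp (-(σ / 2)) : ℂ) ^ 2 := by
    rw [← Complex.ofReal_neg, ← Complex.ofReal_exp, ← Complex.ofReal_pow, ← Real.exp_nat_mul]
    congr 2; push_cast; ring
  have hD2 : D ^ 2 = 2 * Complex.cosh σ + 2 * -mink z y := by
    rw [hD, Complex.cosh, h1, h2]
    simp only [mink, Pi.add_apply, Pi.smul_apply, smul_eq_mul] at hzz hyy ⊢
    set a := (Real.exp (-(σ / 2)) : ℂ)
    set b := (Real.exp (σ / 2) : ℂ)
    linear_combination (-a ^ 2) * hyy - b ^ 2 * hzz -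
      2 * (y 0 * z 0 - y 1 * z 1 - y 2 * z 2) * hprod
  refine ⟨hD2 ▸ sq_mem_slitPlane hre, ?_⟩
  rw [invSqrtCosh_eq_inv hD2 hre]
  have h3 : ∀ α : ℝ, mink ((Real.exp (-(σ / 2)) : ℂ) • y + (Real.exp (σ / 2) : ℂ) • z)
      (toC ![1, Real.cos α, Real.sin α]) =
      (Real.exp (-(σ / 2)) : ℂ) * mink y (toC ![1, Real.cos α, Real.sin α]) +
        (Real.exp (σ / 2) : ℂ) * mink z (toC ![1, Real.cos α, Real.sin α]) := fun α => by
    simp only [mink, Pi.add_apply, Pi.smul_apply, smul_eq_mul]; ring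
  simp_rw [h3] at hint
  rw [hint, div_eq_mul_inv, inv_mul_cancel_left₀]
  exact Complex.two_pi_I_ne_zero

/-- The transform, in the hyperbolic angle, of `(2 cosh σ + 2 ζ)^{-1/2}`, `ζ = -[z·y]`, as an
integral over the circle. The left side is a double integral, by the previous lemma; its integral in
`σ` first is a product of powers. -/
lemma fourier_invSqrtCosh (hz : ∀ ξ ∈ futureCone, (mink z (toC ξ)).im < 0)
    (hy : ∀ ξ ∈ futureCone, (mink y (toC ξ)).im < 0) (hzz : mink z z = -1) (hyy : mink y y = -1)
    (ν : ℝ) :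
    ∫ σ : ℝ, Complex.exp (-(Complex.I * ν * σ)) * invSqrtCosh (-mink z y) σ =
      (2 * Complex.I)⁻¹ * ((Complex.cosh (Real.pi * ν))⁻¹ *
        ∫ α in (-Real.pi)..Real.pi, angularKernel z y ν α) := by
  obtain ⟨δ₁, hδ₁, h1⟩ := exists_im_le hz
  obtain ⟨δ₂, hδ₂, h2⟩ := exists_im_le hy
  have hpi : -Real.pi ≤ Real.pi := by linarith [Real.pi_pos]
  set Φ : ℝ → ℝ → ℂ := fun σ α => Complex.exp (-(Complex.I * ν * σ)) *
    ((Real.exp (-(σ / 2)) : ℂ) * mink y (toC ![1, Real.cos α, Real.sin α]) +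
      (Real.exp (σ / 2) : ℂ) * mink z (toC ![1, Real.cos α, Real.sin α]))⁻¹ with hΦ
  set μ := volume.restrict (Ioc (-Real.pi) Real.pi) with hμ
  have hint : Integrable (Function.uncurry Φ) ((volume : Measure ℝ).prod μ) := by
    have hb : Integrable (fun q : ℝ × ℝ => ((min δ₁ δ₂)⁻¹ * Real.exp (-(1 / 2 * |q.1|))) * 1)
        ((volume : Measure ℝ).prod μ) :=
      Integrable.mul_prod ((integrable_exp_neg_mul_abs one_half_pos).const_mul _)
        (integrable_const _)
    refine hb.mono' ?_ ?_
    · have hcz := (continuous_mink_circle z).measurable.comp (measurable_snd : Measurable (Prod.snd : ℝ × ℝ → ℝ))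
      have hcy := (continuous_mink_circle y).measurable.comp (measurable_snd : Measurable (Prod.snd : ℝ × ℝ → ℝ))
      have := Complex.measurable_ofReal
      refine Measurable.aestronglyMeasurable ?_
      simp only [hΦ, Function.uncurry_def]
      exact (by fun_prop : Measurable fun q : ℝ × ℝ => Complex.exp (-(Complex.I * ν * q.1))).mul
        (((by fun_prop : Measurable fun q : ℝ × ℝ => (Real.exp (-(q.1 / 2)) : ℂ)).mul hcy).add
        ((by fun_prop : Measurable fun q : ℝ × ℝ => (Real.exp (q.1 / 2) : ℂ)).mul hcz)).inv
    · have hmem : ∀ᵐ q ∂((volume : Measure ℝ).prod μ), q ∈ univ ×ˢ Ioc (-Real.pi) Real.pi := by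
        rw [hμ, ← Measure.restrict_univ (μ := (volume : Measure ℝ)), Measure.prod_restrict,
          Measure.restrict_univ]
        exact ae_restrict_mem (MeasurableSet.univ.prod measurableSet_Ioc)
      filter_upwards [hmem] with q hq
      have hα : q.2 ∈ Icc (-Real.pi) Real.pi := Ioc_subset_Icc_self hq.2
      simp only [hΦ, Function.uncurry_def]
      rw [norm_mul, mul_one]
      have e1 : ‖Complex.exp (-(Complex.I * ν * q.1))‖ = 1 := by rw [Complex.norm_exp]; simp
      rw [e1, one_mul]
      exact norm_inv_exp_le (lt_min hδ₁ hδ₂)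
        ((h2 _ hα).trans (neg_le_neg (min_le_right _ _)))
        ((h1 _ hα).trans (neg_le_neg (min_le_left _ _))) q.1
  have hswap := integral_integral_swap hint
  have e1 : ∀ σ : ℝ, Complex.exp (-(Complex.I * ν * σ)) * invSqrtCosh (-mink z y) σ =
      (2 * Real.pi * Complex.I)⁻¹ * ∫ α, Φ σ α ∂μ := fun σ => by
    rw [(circle_integral_comb hz hy hzz hyy σ).2, intervalIntegral.integral_of_le hpi]
    simp only [hΦ]
    rw [integral_const_mul]
    ring
  have e2 : ∀ α : ℝ, ∫ σ, Φ σ α = Real.pi / Complex.cosh (Real.pi * ν) *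
      angularKernel z y ν α := fun α => by
    simp only [hΦ]
    rw [fourier_inv_exp (hy _ (circle_mem_futureCone α)) (hz _ (circle_mem_futureCone α)),
      angularKernel]
    ring
  simp_rw [e1]
  rw [integral_const_mul, hswap]
  simp_rw [e2]
  rw [integral_const_mul, intervalIntegral.integral_of_le hpi]
  have : (Real.pi : ℂ) ≠ 0 := by exact_mod_cast Real.pi_ne_zero
  have := Complex.I_ne_zero
  field_simp
  rw [hμ]

/-- **The kernel of the inversion formula**: for points of the quadric whose pairings with the
cone have negative imaginary parts, the composition of plane waves in the variables `ξ` and `ν`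
reproduces the Cauchy type kernel `1 / (1 - [z·y])`. -/
theorem integral_weight_angularKernel (hz : ∀ ξ ∈ futureCone, (mink z (toC ξ)).im < 0)
    (hy : ∀ ξ ∈ futureCone, (mink y (toC ξ)).im < 0) (hzz : mink z z = -1)
    (hyy : mink y y = -1) :
    ∫ ν in Ioi (0 : ℝ), ((ν * Real.tanh (Real.pi * ν) / Real.cosh (Real.pi * ν) : ℝ) : ℂ) *
      ∫ α in (-Real.pi)..Real.pi, angularKernel z y ν α =
        2 * Complex.I / (1 - mink z y) := by
  set E : ℝ → ℂ := fun ν =>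
    ∫ σ : ℝ, Complex.exp (-(Complex.I * ν * σ)) * invSqrtCosh (-mink z y) σ with hE
  obtain ⟨δ₁, hδ₁, h1⟩ := exists_im_le hz
  obtain ⟨δ₂, hδ₂, h2⟩ := exists_im_le hy
  obtain ⟨M, κ, hM, hκ, hMκ⟩ := exists_norm_angularKernel_le hz hy
  have hpi : -Real.pi ≤ Real.pi := by linarith [Real.pi_pos]
  have hsub : uIoc (-Real.pi) Real.pi ⊆ Icc (-Real.pi) Real.pi := by
    rw [uIoc_of_le hpi]; exact Ioc_subset_Icc_self
  have hslit := fun σ => (circle_integral_comb hz hy hzz hyy σ).1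
  have hC : ∀ σ, ‖invSqrtCosh (-mink z y) σ‖ ≤
      (min δ₁ δ₂)⁻¹ * Real.exp (-(1 / 2 * |σ|)) := fun σ => by
    rw [(circle_integral_comb hz hy hzz hyy σ).2, norm_mul]
    have := intervalIntegral.norm_integral_le_of_norm_le_const
      (a := -Real.pi) (b := Real.pi) (C := (min δ₁ δ₂)⁻¹ * Real.exp (-(1 / 2 * |σ|)))
      (f := fun α => ((Real.exp (-(σ / 2)) : ℂ) * mink y (toC ![1, Real.cos α, Real.sin α]) +
        (Real.exp (σ / 2) : ℂ) * mink z (toC ![1, Real.cos α, Real.sin α]))⁻¹) fun α hα =>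
        norm_inv_exp_le (lt_min hδ₁ hδ₂)
          ((h2 _ (hsub hα)).trans (neg_le_neg (min_le_right _ _)))
          ((h1 _ (hsub hα)).trans (neg_le_neg (min_le_left _ _))) σ
    have e1 : ‖(2 * Real.pi * Complex.I : ℂ)⁻¹‖ = (2 * Real.pi)⁻¹ := by
      rw [norm_inv, norm_mul, norm_mul, Complex.norm_I, Complex.norm_real,
        Real.norm_of_nonneg Real.pi_pos.le]; simp
    rw [e1, inv_mul_le_iff₀ (by positivity)]
    refine this.trans (le_of_eq ?_)
    rw [show Real.pi - -Real.pi = 2 * Real.pi by ring,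
      abs_of_pos (by positivity : 0 < 2 * Real.pi)]
    ring
  have hvc : Continuous (invSqrtCosh (-mink z y)) := continuous_iff_continuousAt.2 fun σ =>
    (hasDerivAt_invSqrtCosh (hslit σ)).continuousAt
  have hEc : Continuous E := by
    refine continuous_of_dominated (bound := fun σ =>
      (min δ₁ δ₂)⁻¹ * Real.exp (-(1 / 2 * |σ|))) (fun ν => ?_) (fun ν => ?_)
      ((integrable_exp_neg_mul_abs one_half_pos).const_mul _)
      (Eventually.of_forall fun σ => by fun_prop)
    · have := Complex.continuous_ofReal
      exact Continuous.aestronglyMeasurable (by fun_prop)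
    · refine Eventually.of_forall fun σ => ?_
      rw [norm_mul, Complex.norm_exp]
      simpa using hC σ
  have hL : ∀ ν : ℝ, (Complex.cosh (Real.pi * ν))⁻¹ *
      ∫ α in (-Real.pi)..Real.pi, angularKernel z y ν α = 2 * Complex.I * E ν := fun ν => by
    rw [hE]; dsimp only
    rw [fourier_invSqrtCosh hz hy hzz hyy, mul_inv_cancel_left₀]
    exact mul_ne_zero two_ne_zero Complex.I_ne_zero
  have hEb : ∀ ν, ‖E ν‖ ≤ (2 * Real.pi * M) * Real.exp (-(κ * |ν|)) := fun ν => by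
    have e1 := hL ν
    have e2 : ‖∫ α in (-Real.pi)..Real.pi, angularKernel z y ν α‖ ≤
        M * Real.exp ((Real.pi - κ) * |ν|) * (2 * Real.pi) := by
      have := intervalIntegral.norm_integral_le_of_norm_le_const
        (a := -Real.pi) (b := Real.pi) (f := angularKernel z y ν) fun α hα => hMκ ν α (hsub hα)
      rwa [show Real.pi - -Real.pi = 2 * Real.pi by ring,
        abs_of_pos (by positivity : 0 < 2 * Real.pi)] at this
    have e3 : ‖(Complex.cosh (Real.pi * ν))⁻¹‖ ≤ 2 * Real.exp (-(Real.pi * |ν|)) := by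
      rw [← Complex.ofReal_mul, ← Complex.ofReal_cosh, norm_inv, Complex.norm_real,
        Real.norm_of_nonneg (Real.cosh_pos _).le, ← Real.cosh_abs, abs_mul,
        abs_of_pos Real.pi_pos, Real.exp_neg, ← div_eq_mul_inv, inv_eq_one_div,
        div_le_div_iff₀ (Real.cosh_pos _) (Real.exp_pos _), Real.cosh_eq]
      linarith [Real.exp_pos (-(Real.pi * |ν|))]
    have e4 : 2 * ‖E ν‖ = ‖(Complex.cosh (Real.pi * ν))⁻¹ *
      ∫ α in (-Real.pi)..Real.pi, angularKernel z y ν α‖ := by rw [e1]; simp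
    have e5 : Real.exp ((Real.pi - κ) * |ν|) * Real.exp (-(Real.pi * |ν|)) =
        Real.exp (-(κ * |ν|)) := by rw [← Real.exp_add]; congr 1; ring
    rw [norm_mul] at e4
    have e6 := mul_le_mul e3 e2 (norm_nonneg _) (by positivity)
    rw [← e5]
    linarith
  have key := integral_tanh_mul_fourier hslit hC (fun ν => rfl) hEc hκ hEb
  have e : ∀ ν : ℝ, ((ν * Real.tanh (Real.pi * ν) / Real.cosh (Real.pi * ν) : ℝ) : ℂ) *
      ∫ α in (-Real.pi)..Real.pi, angularKernel z y ν α =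
      2 * Complex.I * ((ν : ℂ) * Real.tanh (Real.pi * ν) * E ν) := fun ν => by
    have := hL ν
    rw [mul_left_comm, ← this]
    push_cast
    ring
  simp_rw [e]
  rw [integral_const_mul, key, sub_eq_add_neg, mul_one_div]

end

/-! ### The regularised inversion formula -/

lemma abs_weight_one_le {ν : ℝ} (hν : 0 < ν) :
    |weight 1 ν| ≤ 2 * ν * Real.exp (-(2 * Real.pi * ν)) := by
  have hx : 0 < Real.pi * ν := mul_pos Real.pi_pos hν
  have h1 : |Real.tanh (Real.pi * ν)| ≤ 1 := (Real.abs_tanh_lt_one _).le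
  have h2 : Real.exp (Real.pi * ν) ≤ 2 * Real.cosh (Real.pi * ν) := by
    rw [Real.cosh_eq]; linarith [Real.exp_pos (-(Real.pi * ν))]
  have h3 : Real.exp (-(2 * Real.pi * ν)) * (Real.exp (Real.pi * ν) * Real.exp (Real.pi * ν)) = 1 := by
    rw [← Real.exp_add, ← Real.exp_add]; ring_nf; simp
  have hc := Real.cosh_pos (Real.pi * ν)
  have he := Real.exp_pos (Real.pi * ν)
  have he2 := Real.exp_pos (-(2 * Real.pi * ν))
  rw [weight, one_mul, abs_div, abs_mul, abs_of_pos hν, abs_of_pos (mul_pos he hc),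
    div_le_iff₀ (mul_pos he hc)]
  calc ν * |Real.tanh (Real.pi * ν)| ≤ ν * 1 := by gcongr
    _ = ν * (Real.exp (-(2 * Real.pi * ν)) * (Real.exp (Real.pi * ν) * Real.exp (Real.pi * ν))) := by
      rw [h3]
    _ ≤ ν * (Real.exp (-(2 * Real.pi * ν)) *
        (Real.exp (Real.pi * ν) * (2 * Real.cosh (Real.pi * ν)))) := by gcongr
    _ = _ := by ring

lemma weight_one_mul_exp (ν : ℝ) : weight 1 ν * Real.exp (Real.pi * ν) =
    ν * Real.tanh (Real.pi * ν) / Real.cosh (Real.pi * ν) := by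
  have := (Real.exp_pos (Real.pi * ν)).ne'
  rw [weight, one_mul]
  field_simp

lemma measurable_weight (ε : ℝ) : Measurable (weight ε) := by
  unfold weight
  have h1 : Measurable Real.tanh := by
    have : Real.tanh = fun x => Real.sinh x / Real.cosh x :=
      funext Real.tanh_eq_sinh_div_cosh
    rw [this]
    exact Real.measurable_sinh.div Real.measurable_cosh
  exact (measurable_id.mul (h1.comp (by fun_prop))).div
    ((by fun_prop : Measurable fun ν => Real.exp (ε * (Real.pi * ν))).mul
      (Real.measurable_cosh.comp (by fun_prop)))

lemma mem_slitPlane_of_im_neg {w : ℂ} (hw : w.im < 0) : w ∈ Complex.slitPlane :=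
  Complex.mem_slitPlane_iff.2 (Or.inr hw.ne)

lemma continuous_mink_comp (z : Fin 3 → ℂ) {c : ℝ → Fin 3 → ℝ} (hc : Continuous c) :
    Continuous fun t => mink z (toC (c t)) :=
  continuous_mink_toC.comp (continuous_const.prodMk hc)

/-- Along a compact arc of the cone the growth in `ν` of the plane waves `[z·ξ]^{-1/2+iν}` is
uniformly below `e^{πν}`. -/
lemma exists_norm_planeWave_le {z : Fin 3 → ℂ} (hz : ∀ ξ ∈ futureCone, (mink z (toC ξ)).im < 0)
    {c : ℝ → Fin 3 → ℝ} (hc : Continuous c) (hmem : ∀ t, c t ∈ futureCone) {a b : ℝ}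
    (hab : a ≤ b) :
    ∃ M κ : ℝ, 0 ≤ M ∧ 0 < κ ∧ ∀ ν : ℝ, 0 ≤ ν → ∀ t ∈ Icc a b,
      ‖mink z (toC (c t)) ^ (-1 / 2 + Complex.I * ν : ℂ)‖ ≤ M * Real.exp ((Real.pi - κ) * ν) := by
  have hcz := continuous_mink_comp z hc
  have harg : Continuous fun t => (mink z (toC (c t))).arg :=
    continuous_iff_continuousAt.2 fun t =>
      ContinuousAt.comp (g := Complex.arg) (f := fun t => mink z (toC (c t)))
        (Complex.continuousAt_arg (mem_slitPlane_of_im_neg (hz _ (hmem t)))) hcz.continuousAt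
  obtain ⟨s, -, hs⟩ := isCompact_Icc.exists_isMinOn (nonempty_Icc.2 hab) harg.continuousOn
  obtain ⟨s', -, hs'⟩ := isCompact_Icc.exists_isMinOn (nonempty_Icc.2 hab) hcz.norm.continuousOn
  have hpos : ∀ t, 0 < ‖mink z (toC (c t))‖ := fun t => norm_pos_iff.2 fun h => by
    have := hz _ (hmem t)
    simp [h] at this
  refine ⟨‖mink z (toC (c s'))‖ ^ (-(1 / 2) : ℝ), Real.pi + (mink z (toC (c s))).arg,
    by positivity, by linarith [(arg_mem_Ioo (hz _ (hmem s))).1], fun ν hν t ht => ?_⟩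
  rw [norm_cpow_half_add_eq (norm_pos_iff.1 (hpos t))]
  have h1 : (mink z (toC (c s))).arg ≤ (mink z (toC (c t))).arg := hs ht
  have h2 : ‖mink z (toC (c s'))‖ ≤ ‖mink z (toC (c t))‖ := hs' ht
  refine mul_le_mul (rpow_neg_half_le_of_le (hpos s') h2) (Real.exp_le_exp.2 ?_)
    (Real.exp_pos _).le (by positivity)
  nlinarith [mul_le_mul_of_nonneg_left h1 hν]

/-- The weight against the growth in `ν` of a plane wave and of the transform: what is left is
integrable. -/
lemma abs_weight_one_mul_exp_le {ν κ : ℝ} (hν : 0 < ν) :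
    |weight 1 ν| * (Real.exp ((Real.pi - κ) * ν) * Real.exp (Real.pi * |ν|)) ≤
      2 * (|ν| * Real.exp (-(κ * |ν|))) := by
  rw [abs_of_pos hν]
  refine (mul_le_mul_of_nonneg_right (abs_weight_one_le hν) (by positivity)).trans (le_of_eq ?_)
  have e : Real.exp (-(2 * Real.pi * ν)) * (Real.exp ((Real.pi - κ) * ν) *
      Real.exp (Real.pi * ν)) = Real.exp (-(κ * ν)) := by
    rw [← Real.exp_add, ← Real.exp_add]; ring_nf
  rw [← e]; ring

section

variable {τ : ℝ} {g : ℝ × ℝ → ℂ} {c : ℝ} {z : Fin 3 → ℂ}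

lemma regKernel_smul (hτ : 0 < τ) (ν : ℝ) {r : ℝ} (hr : 0 < r) {ξ : Fin 3 → ℝ}
    (hξ : ξ ∈ futureCone) (p : ℝ × ℝ) :
    regKernel τ ν (r • ξ) p = (r : ℂ) ^ (-1 / 2 - Complex.I * ν : ℂ) * regKernel τ ν ξ p := by
  have h := im_mink_regParam_pos hτ p hξ
  have h0 : mink (regParam τ p) (toC ξ) ≠ 0 := fun h0 => by simp [h0] at h
  rw [regKernel, regKernel, mink_smul_toC_right, ofReal_mul_cpow hr h0, mul_div_assoc]

lemma regTransform_smul (hτ : 0 < τ) (ν : ℝ) {r : ℝ} (hr : 0 < r) {ξ : Fin 3 → ℝ}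
    (hξ : ξ ∈ futureCone) :
    regTransform τ g ν (r • ξ) = (r : ℂ) ^ (-1 / 2 - Complex.I * ν : ℂ) * regTransform τ g ν ξ := by
  rw [regTransform, regTransform, ← integral_const_mul]
  simp_rw [regKernel_smul hτ ν hr hξ, mul_assoc]

lemma curveIntegral_regTransform (hz : ∀ ξ ∈ futureCone, (mink z (toC ξ)).im < 0)
    (hτ : 0 < τ) (hτ1 : τ ≤ 1) (hc : 0 ≤ c) (hg : AEStronglyMeasurable g)
    (hb : ∀ᵐ p : ℝ × ℝ, ‖g p‖ ≤ c * (1 + |p.1|)⁻¹ * (1 + |p.2|)⁻¹)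
    {p : Fin 3 → ℝ} {γ : Path p p} (hγ : IsCycle γ) (ν : ℝ) :
    curveIntegral (fun ξ => (coneForm ξ).smulRight
      (mink z (toC ξ) ^ (-1 / 2 + Complex.I * ν : ℂ) * regTransform τ g ν ξ)) γ =
      1 / 2 * ∫ α in (-Real.pi)..Real.pi,
        mink z (toC ![1, Real.cos α, Real.sin α]) ^ (-1 / 2 + Complex.I * ν : ℂ) *
          regTransform τ g ν ![1, Real.cos α, Real.sin α] := by
  have hT : ContinuousOn (fun ξ => regTransform τ g ν ξ) futureCone :=
    ContinuousOn.comp (g := fun q : ℝ × (Fin 3 → ℝ) => regTransform τ g q.1 q.2)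
      (f := fun ξ => (ν, ξ)) (t := univ ×ˢ futureCone) (continuousOn_regTransform hτ hτ1 hc hg hb)
      (Continuous.continuousOn (by fun_prop)) fun ξ hξ => ⟨mem_univ _, hξ⟩
  have hM : Continuous fun ξ : Fin 3 → ℝ => mink z (toC ξ) :=
    continuous_mink_toC.comp (continuous_const.prodMk continuous_id)
  refine hγ.curveIntegral_eq (φ := fun ξ => mink z (toC ξ) ^ (-1 / 2 + Complex.I * ν : ℂ) *
    regTransform τ g ν ξ) ?_ ?_
  · exact (hM.continuousOn.cpow continuousOn_const fun ξ hξ =>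
      mem_slitPlane_of_im_neg (hz ξ hξ)).mul hT
  · intro r hr ξ hξ
    have h0 : mink z (toC ξ) ≠ 0 := fun h0 => by
      have := hz ξ hξ
      simp [h0] at this
    have hr' : (r : ℂ) ≠ 0 := by exact_mod_cast hr.ne'
    have hpow : (r : ℂ) ^ (-1 / 2 + Complex.I * ν : ℂ) * (r : ℂ) ^ (-1 / 2 - Complex.I * ν : ℂ) =
        (r : ℂ)⁻¹ := by
      rw [← Complex.cpow_add _ _ hr', ← Complex.cpow_neg_one]
      congr 1; ring
    rw [mink_smul_toC_right, ofReal_mul_cpow hr h0, regTransform_smul hτ ν hr hξ, ← hpow]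
    ring

/-- The product of the plane wave and the regularised kernel in terms of the point `-z'` of `𝒯⁻`, where
`z'` is the regularised point: `[z'·ξ]^s = e^{iπs} [-z'·ξ]^s`. -/
lemma regKernel_circle (hτ : 0 < τ) (ν α : ℝ) (p : ℝ × ℝ) :
    mink z (toC ![1, Real.cos α, Real.sin α]) ^ (-1 / 2 + Complex.I * ν : ℂ) *
      regKernel τ ν ![1, Real.cos α, Real.sin α] p =
    -Complex.I * Real.exp (Real.pi * ν) / regDen τ p * angularKernel z (-regParam τ p) ν α := by
  have h := im_mink_regParam_pos hτ p (circle_mem_futureCone α)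
  have hneg : mink (-regParam τ p) (toC ![1, Real.cos α, Real.sin α]) =
      -mink (regParam τ p) (toC ![1, Real.cos α, Real.sin α]) := by
    simp only [mink, Pi.neg_apply]; ring
  set w := mink (regParam τ p) (toC ![1, Real.cos α, Real.sin α]) with hw
  have h1 := neg_cpow_of_im_neg (w := -w) (by simpa using h) (-1 / 2 - Complex.I * ν)
  rw [neg_neg] at h1
  rw [angularKernel, regKernel, hneg, ← hw, h1]
  have h2 : -Complex.I * (Real.exp (Real.pi * ν) : ℂ) *
      Complex.exp (-(Real.pi * Complex.I * (-1 / 2 - Complex.I * ν))) = 1 := by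
    rw [Complex.ofReal_exp, show -(Real.pi * Complex.I * (-1 / 2 - Complex.I * (ν : ℂ))) =
      Real.pi / 2 * Complex.I - ((Real.pi * ν : ℝ) : ℂ) by
        push_cast; linear_combination (Real.pi * ν : ℂ) * Complex.I_sq, Complex.exp_sub,
      Complex.exp_pi_div_two_mul_I]
    have := Complex.exp_ne_zero ((Real.pi * ν : ℝ) : ℂ)
    field_simp
    rw [Complex.I_sq]; norm_num
  linear_combination (-(mink z (toC ![1, Real.cos α, Real.sin α]) ^ (-1 / 2 + Complex.I * ν : ℂ) *
    w ^ (-1 / 2 - Complex.I * ν : ℂ) / regDen τ p)) * h2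

end

section

variable {τ : ℝ} {g : ℝ × ℝ → ℂ} {c : ℝ} {z : Fin 3 → ℂ}

lemma mink_param_self {l m : ℂ} (h : l ≠ m) : mink (param l m) (param l m) = -1 := by
  have h' : l - m ≠ 0 := sub_ne_zero.2 h
  simp only [mink, param_zero, param_one, param_two]
  field_simp
  ring

lemma mink_neg_neg {K : Type*} [CommRing K] (x y : Fin 3 → K) : mink (-x) (-y) = mink x y := by
  simp only [mink, Pi.neg_apply]; ring

lemma mink_neg_right {K : Type*} [CommRing K] (x y : Fin 3 → K) : mink x (-y) = -mink x y := by
  simp only [mink, Pi.neg_apply]; ring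

lemma regPoint_ne (hτ : 0 < τ) (p : ℝ × ℝ) : regPoint τ p.1 ≠ regPoint (-τ) p.2 := fun h0 => by
  have h2 := im_regPoint_neg hτ p.1
  rw [h0] at h2
  exact absurd (im_regPoint_pos hτ p.2) (not_lt.2 h2.le)

/-- Absolute convergence of the triple integral over `ν`, the circle and the real points. -/
lemma integrable_triple (hz : ∀ ξ ∈ futureCone, (mink z (toC ξ)).im < 0)
    (hτ : 0 < τ) (hτ1 : τ ≤ 1) (hc : 0 ≤ c) (hg : AEStronglyMeasurable g)
    (hb : ∀ᵐ p : ℝ × ℝ, ‖g p‖ ≤ c * (1 + |p.1|)⁻¹ * (1 + |p.2|)⁻¹) :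
    Integrable (fun x : (ℝ × ℝ) × (ℝ × ℝ) => (weight 1 x.1.1 : ℂ) *
      (mink z (toC ![1, Real.cos x.1.2, Real.sin x.1.2]) ^ (-1 / 2 + Complex.I * x.1.1 : ℂ) *
        (regKernel τ x.1.1 ![1, Real.cos x.1.2, Real.sin x.1.2] x.2 * g x.2)))
      (((volume.restrict (Ioi 0)).prod (volume.restrict (Ioc (-Real.pi) Real.pi))).prod
        volume) := by
  have hpi : -Real.pi ≤ Real.pi := by linarith [Real.pi_pos]
  obtain ⟨M, κ, hM, hκ, hMκ⟩ := exists_norm_planeWave_le hz continuous_circle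
    circle_mem_futureCone hpi
  set C : ℝ := M * (c * (4 * τ ^ 3 * 1) ^ (-(1 / 2) : ℝ)) * 2 with hC
  have hC0 : 0 ≤ C := by positivity
  have h1 : Integrable (fun q : ℝ × ℝ => |q.1| * Real.exp (-(κ * |q.1|)) * 1)
      ((volume.restrict (Ioi 0)).prod (volume.restrict (Ioc (-Real.pi) Real.pi))) :=
    ((integrable_abs_mul_exp hκ).restrict (s := Ioi 0)).mul_prod (g := fun _ : ℝ => (1 : ℝ))
      (integrable_const _)
  have hdom := (h1.mul_prod integrable_inv_one_add_sq_prod).const_mul C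
  refine hdom.mono' ?_ ?_
  · refine AEStronglyMeasurable.mul ?_ (AEStronglyMeasurable.mul ?_ (AEStronglyMeasurable.mul ?_ ?_))
    · exact (Complex.measurable_ofReal.comp ((measurable_weight 1).comp
        (measurable_fst.comp measurable_fst))).aestronglyMeasurable
    · refine Continuous.aestronglyMeasurable ?_
      exact ((continuous_mink_circle z).comp (continuous_snd.comp continuous_fst)).cpow
        (by fun_prop) fun x => mem_slitPlane_of_im_neg (hz _ (circle_mem_futureCone _))
    · refine Continuous.aestronglyMeasurable ?_
      unfold regKernel
      refine Continuous.div ?_ ((continuous_regDen τ).comp continuous_snd)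
        fun x => regDen_ne_zero hτ x.2
      refine Continuous.cpow ?_ (by fun_prop) fun x =>
        Or.inr (im_mink_regParam_pos hτ x.2 (circle_mem_futureCone _)).ne'
      exact continuous_mink_toC.comp (((continuous_regParam hτ).comp continuous_snd).prodMk
        (continuous_circle.comp (continuous_snd.comp continuous_fst)))
    · exact hg.comp_snd
  · have hq : ∀ᵐ q : ℝ × ℝ ∂((volume.restrict (Ioi 0)).prod
        (volume.restrict (Ioc (-Real.pi) Real.pi))), 0 < q.1 ∧ q.2 ∈ Icc (-Real.pi) Real.pi := by
      rw [Measure.prod_restrict]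
      filter_upwards [ae_restrict_mem (measurableSet_Ioi.prod measurableSet_Ioc)] with q hq
      exact ⟨hq.1, Ioc_subset_Icc_self hq.2⟩
    filter_upwards [Measure.quasiMeasurePreserving_fst.ae hq,
      Measure.quasiMeasurePreserving_snd.ae hb] with x hx hbx
    have e1 := hMκ x.1.1 hx.1.le x.1.2 hx.2
    have e2 := norm_regKernel_mul_le_of_pos hτ hτ1 x.1.1 (circle_mem_futureCone x.1.2) one_pos
      (by simp) hc hbx
    have e3 := abs_weight_one_mul_exp_le (κ := κ) hx.1
    rw [norm_mul, norm_mul, Complex.norm_real, Real.norm_eq_abs]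
    calc _ ≤ |weight 1 x.1.1| * ((M * Real.exp ((Real.pi - κ) * x.1.1)) *
          (c * (4 * τ ^ 3 * 1) ^ (-(1 / 2) : ℝ) * Real.exp (Real.pi * |x.1.1|) *
            ((1 + x.2.1 ^ 2)⁻¹ * (1 + x.2.2 ^ 2)⁻¹))) :=
          mul_le_mul_of_nonneg_left (mul_le_mul e1 e2 (norm_nonneg _) (by positivity))
            (abs_nonneg _)
      _ = M * (c * (4 * τ ^ 3 * 1) ^ (-(1 / 2) : ℝ)) *
          ((1 + x.2.1 ^ 2)⁻¹ * (1 + x.2.2 ^ 2)⁻¹) *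
          (|weight 1 x.1.1| * (Real.exp ((Real.pi - κ) * x.1.1) *
            Real.exp (Real.pi * |x.1.1|))) := by ring
      _ ≤ M * (c * (4 * τ ^ 3 * 1) ^ (-(1 / 2) : ℝ)) *
          ((1 + x.2.1 ^ 2)⁻¹ * (1 + x.2.2 ^ 2)⁻¹) *
          (2 * (|x.1.1| * Real.exp (-(κ * |x.1.1|)))) :=
          mul_le_mul_of_nonneg_left e3 (by positivity)
      _ = _ := by rw [hC]; ring

/-- Integrating the plane waves first turns the regularised inversion integral into an integral
against the Cauchy-type kernel `1 / (1 + [z·z'])`. -/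
theorem integral_weight_regTransform (hz : ∀ ξ ∈ futureCone, (mink z (toC ξ)).im < 0)
    (hzz : mink z z = -1)
    (hτ : 0 < τ) (hτ1 : τ ≤ 1) (hc : 0 ≤ c) (hg : AEStronglyMeasurable g)
    (hb : ∀ᵐ p : ℝ × ℝ, ‖g p‖ ≤ c * (1 + |p.1|)⁻¹ * (1 + |p.2|)⁻¹) :
    ∫ ν in Ioi (0 : ℝ), (weight 1 ν : ℂ) * (1 / 2 * ∫ α in (-Real.pi)..Real.pi,
        mink z (toC ![1, Real.cos α, Real.sin α]) ^ (-1 / 2 + Complex.I * ν : ℂ) *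
          regTransform τ g ν ![1, Real.cos α, Real.sin α]) =
      ∫ p, g p / (regDen τ p * (1 + mink z (regParam τ p))) := by
  have hpi : -Real.pi ≤ Real.pi := by linarith [Real.pi_pos]
  have hint := integrable_triple hz hτ hτ1 hc hg hb
  have hleft := integral_prod _ hint.integral_prod_left
  have hswap := integral_integral_swap (f := fun (q p : ℝ × ℝ) => (weight 1 q.1 : ℂ) *
    (mink z (toC ![1, Real.cos q.2, Real.sin q.2]) ^ (-1 / 2 + Complex.I * q.1 : ℂ) *
      (regKernel τ q.1 ![1, Real.cos q.2, Real.sin q.2] p * g p))) hint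
  have hpt : ∀ᵐ p : ℝ × ℝ, ∫ q : ℝ × ℝ, (weight 1 q.1 : ℂ) *
      (mink z (toC ![1, Real.cos q.2, Real.sin q.2]) ^ (-1 / 2 + Complex.I * q.1 : ℂ) *
        (regKernel τ q.1 ![1, Real.cos q.2, Real.sin q.2] p * g p))
        ∂((volume.restrict (Ioi 0)).prod (volume.restrict (Ioc (-Real.pi) Real.pi))) =
      2 * (g p / (regDen τ p * (1 + mink z (regParam τ p)))) := by
    filter_upwards [hint.prod_left_ae] with p hp
    rw [integral_prod _ hp]
    have hy : ∀ ξ ∈ futureCone, (mink (-regParam τ p) (toC ξ)).im < 0 := fun ξ hξ => by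
      rw [mink_neg_left, Complex.neg_im, neg_lt_zero]
      exact im_mink_regParam_pos hτ p hξ
    have hyy : mink (-regParam τ p) (-regParam τ p) = -1 := by
      rw [mink_neg_neg]; exact mink_param_self (regPoint_ne hτ p)
    have key := integral_weight_angularKernel hz hy hzz hyy
    have e : ∀ ν : ℝ, ∫ α in Ioc (-Real.pi) Real.pi, (weight 1 ν : ℂ) *
        (mink z (toC ![1, Real.cos α, Real.sin α]) ^ (-1 / 2 + Complex.I * ν : ℂ) *
          (regKernel τ ν ![1, Real.cos α, Real.sin α] p * g p)) =
        (-Complex.I * g p / regDen τ p) *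
          (((ν * Real.tanh (Real.pi * ν) / Real.cosh (Real.pi * ν) : ℝ) : ℂ) *
            ∫ α in (-Real.pi)..Real.pi, angularKernel z (-regParam τ p) ν α) := fun ν => by
      rw [← weight_one_mul_exp, intervalIntegral.integral_of_le hpi, ← integral_const_mul,
        ← integral_const_mul]
      refine integral_congr_ae (Eventually.of_forall fun α => ?_)
      dsimp only
      rw [← mul_assoc (_ ^ _), regKernel_circle hτ]
      push_cast
      ring
    simp_rw [e]
    rw [integral_const_mul, key, mink_neg_right, sub_neg_eq_add, ← div_div]
    linear_combination (-2 * g p / regDen τ p / (1 + mink z (regParam τ p))) * Complex.I_mul_I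
  have e : ∀ ν : ℝ, (weight 1 ν : ℂ) * (1 / 2 * ∫ α in (-Real.pi)..Real.pi,
        mink z (toC ![1, Real.cos α, Real.sin α]) ^ (-1 / 2 + Complex.I * ν : ℂ) *
          regTransform τ g ν ![1, Real.cos α, Real.sin α]) =
      1 / 2 * ∫ α in Ioc (-Real.pi) Real.pi, ∫ p : ℝ × ℝ, (weight 1 ν : ℂ) *
        (mink z (toC ![1, Real.cos α, Real.sin α]) ^ (-1 / 2 + Complex.I * ν : ℂ) *
          (regKernel τ ν ![1, Real.cos α, Real.sin α] p * g p)) := fun ν => by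
    simp_rw [integral_const_mul]
    rw [intervalIntegral.integral_of_le hpi]
    simp only [regTransform]
    ring
  simp_rw [e]
  rw [integral_const_mul, ← hleft]
  dsimp only at hswap ⊢
  rw [hswap, integral_congr_ae hpt, integral_const_mul]
  ring

lemma one_add_mink_param {l m l' m' : ℂ} (h : l ≠ m) (h' : l' ≠ m') :
    1 + mink (param l m) (param l' m') = 2 * (l - l') * (m - m') / ((l - m) * (l' - m')) := by
  have h1 : l - m ≠ 0 := sub_ne_zero.2 h
  have h2 : l' - m' ≠ 0 := sub_ne_zero.2 h'
  simp only [mink, param_zero, param_one, param_two]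
  field_simp
  ring

/-- The kernel `1 / (1 + [z·z'])` is a product of two Cauchy kernels. -/
lemma regDen_mul_one_add_mink {l m : ℂ} (h : l ≠ m) (hτ : 0 < τ)
    (hl : 1 - Complex.I * τ * l ≠ 0) (hm : 1 + Complex.I * τ * m ≠ 0) (p : ℝ × ℝ) :
    regDen τ p * (1 + mink (param l m) (regParam τ p)) =
      2 * (1 - Complex.I * τ * l) * (1 + Complex.I * τ * m) / (l - m) *
        ((p.1 - (l + Complex.I * τ) / (1 - Complex.I * τ * l)) *
          (p.2 - (m - Complex.I * τ) / (1 + Complex.I * τ * m))) := by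
  have h1 : l - m ≠ 0 := sub_ne_zero.2 h
  have h2 := regDen_ne_zero hτ p
  have h3 := one_add_I_mul_ne_zero τ p.1
  have h4 : 1 - Complex.I * τ * (p.2 : ℂ) ≠ 0 := by
    have := one_add_I_mul_ne_zero (-τ) p.2
    convert this using 1; push_cast; ring
  have e1 : (l - regPoint τ p.1) * (1 + Complex.I * τ * p.1) =
      -((1 - Complex.I * τ * l) * (p.1 - (l + Complex.I * τ) / (1 - Complex.I * τ * l))) := by
    rw [regPoint, sub_mul, div_mul_cancel₀ _ h3, mul_sub, mul_div_cancel₀ _ hl]; ring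
  have e2 : (m - regPoint (-τ) p.2) * (1 - Complex.I * τ * p.2) =
      -((1 + Complex.I * τ * m) * (p.2 - (m - Complex.I * τ) / (1 + Complex.I * τ * m))) := by
    have h5 : regPoint (-τ) p.2 = (p.2 + Complex.I * τ) / (1 - Complex.I * τ * p.2) := by
      rw [regPoint]; push_cast; ring_nf
    rw [h5, sub_mul, div_mul_cancel₀ _ h4, mul_sub (1 + Complex.I * τ * m), mul_div_cancel₀ _ hm]; ring
  rw [regParam, one_add_mink_param h (regPoint_ne hτ p), regPoint_sub]
  calc _ = 2 / (l - m) * (((l - regPoint τ p.1) * (1 + Complex.I * τ * p.1)) *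
        ((m - regPoint (-τ) p.2) * (1 - Complex.I * τ * p.2))) := by field_simp
    _ = _ := by rw [e1, e2]; ring

/-- The Cauchy formula evaluates the regularised inversion integral. -/
lemma BoundaryPair.integral_regDen {G : ℂ × ℂ → ℂ} (hG : BoundaryPair G g c) {l m : ℂ}
    (h : l ≠ m) (hτ : 0 < τ)
    (hl : 1 - Complex.I * τ * l ≠ 0) (hm : 1 + Complex.I * τ * m ≠ 0)
    (hl' : 0 < ((l + Complex.I * τ) / (1 - Complex.I * τ * l)).im)
    (hm' : ((m - Complex.I * τ) / (1 + Complex.I * τ * m)).im < 0) :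
    ∫ p, g p / (regDen τ p * (1 + mink (param l m) (regParam τ p))) =
      2 * Real.pi ^ 2 * (l - m) / ((1 - Complex.I * τ * l) * (1 + Complex.I * τ * m)) *
        G ((l + Complex.I * τ) / (1 - Complex.I * τ * l),
          (m - Complex.I * τ) / (1 + Complex.I * τ * m)) := by
  have h1 : l - m ≠ 0 := sub_ne_zero.2 h
  have e : ∀ p : ℝ × ℝ, g p / (regDen τ p * (1 + mink (param l m) (regParam τ p))) =
      ((l - m) / (2 * ((1 - Complex.I * τ * l) * (1 + Complex.I * τ * m)))) *
        (g p / ((p.1 - (l + Complex.I * τ) / (1 - Complex.I * τ * l)) *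
          (p.2 - (m - Complex.I * τ) / (1 + Complex.I * τ * m)))) := fun p => by
    rw [regDen_mul_one_add_mink h hτ hl hm, div_mul_eq_mul_div, div_div_eq_mul_div,
      div_mul_div_comm]
    ring
  simp_rw [e]
  rw [integral_const_mul, hG.cauchy hl' hm']
  field_simp
  ring

/-- As `τ → 0⁺` the regularised inversion integral tends to the value of the function. -/
lemma BoundaryPair.tendsto_integral_regDen {G : ℂ × ℂ → ℂ} (hG : BoundaryPair G g c) {l m : ℂ}
    (hl : 0 < l.im) (hm : m.im < 0) :
    Tendsto (fun τ : ℝ => ∫ p, g p / (regDen τ p * (1 + mink (param l m) (regParam τ p))))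
      (𝓝[>] 0) (𝓝 (2 * Real.pi ^ 2 * ((l - m) * G (l, m)))) := by
  have h : l ≠ m := fun h => by rw [h] at hl; linarith
  have hd1 : Continuous fun τ : ℝ => 1 - Complex.I * τ * l := by fun_prop
  have hd2 : Continuous fun τ : ℝ => 1 + Complex.I * τ * m := by fun_prop
  have hn1 : Continuous fun τ : ℝ => l + Complex.I * τ := by fun_prop
  have hn2 : Continuous fun τ : ℝ => m - Complex.I * τ := by fun_prop
  have z1 : (1 : ℂ) - Complex.I * ((0 : ℝ) : ℂ) * l ≠ 0 := by simp
  have z2 : (1 : ℂ) + Complex.I * ((0 : ℝ) : ℂ) * m ≠ 0 := by simp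
  have hc1 : ContinuousAt (fun τ : ℝ => (l + Complex.I * τ) / (1 - Complex.I * τ * l)) 0 :=
    hn1.continuousAt.div hd1.continuousAt z1
  have hc2 : ContinuousAt (fun τ : ℝ => (m - Complex.I * τ) / (1 + Complex.I * τ * m)) 0 :=
    hn2.continuousAt.div hd2.continuousAt z2
  have v1 : (l + Complex.I * ((0 : ℝ) : ℂ)) / (1 - Complex.I * ((0 : ℝ) : ℂ) * l) = l := by simp
  have v2 : (m - Complex.I * ((0 : ℝ) : ℂ)) / (1 + Complex.I * ((0 : ℝ) : ℂ) * m) = m := by simp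
  have ht1 : Tendsto (fun τ : ℝ => (l + Complex.I * τ) / (1 - Complex.I * τ * l)) (𝓝 0) (𝓝 l) := by
    have := hc1.tendsto; rwa [v1] at this
  have ht2 : Tendsto (fun τ : ℝ => (m - Complex.I * τ) / (1 + Complex.I * τ * m)) (𝓝 0) (𝓝 m) := by
    have := hc2.tendsto; rwa [v2] at this
  have hGc : ContinuousAt G (l, m) :=
    (hG.holo.differentiableAt (isOpen_tube.mem_nhds
      (mem_tube_iff.2 ⟨hl, hm⟩))).continuousAt
  have hlim : Tendsto (fun τ : ℝ => 2 * Real.pi ^ 2 * (l - m) /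
      ((1 - Complex.I * τ * l) * (1 + Complex.I * τ * m)) *
        G ((l + Complex.I * τ) / (1 - Complex.I * τ * l),
          (m - Complex.I * τ) / (1 + Complex.I * τ * m))) (𝓝 0)
      (𝓝 (2 * Real.pi ^ 2 * ((l - m) * G (l, m)))) := by
    have a1 : Tendsto (fun τ : ℝ => 2 * (Real.pi : ℂ) ^ 2 * (l - m) /
        ((1 - Complex.I * τ * l) * (1 + Complex.I * τ * m))) (𝓝 0)
        (𝓝 (2 * Real.pi ^ 2 * (l - m))) := by
      have : ContinuousAt (fun τ : ℝ => 2 * (Real.pi : ℂ) ^ 2 * (l - m) /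
          ((1 - Complex.I * τ * l) * (1 + Complex.I * τ * m))) 0 :=
        continuous_const.continuousAt.div (hd1.mul hd2).continuousAt (mul_ne_zero z1 z2)
      simpa [ContinuousAt] using this
    have := a1.mul (hGc.tendsto.comp (ht1.prodMk_nhds ht2))
    rw [← mul_assoc]
    exact this
  refine (hlim.mono_left nhdsWithin_le_nhds).congr' ?_
  have o1 : ∀ᶠ τ : ℝ in 𝓝 0, 0 < ((l + Complex.I * τ) / (1 - Complex.I * τ * l)).im :=
    (Complex.continuous_im.continuousAt.tendsto.comp ht1).eventually (lt_mem_nhds hl)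
  have o2 : ∀ᶠ τ : ℝ in 𝓝 0, ((m - Complex.I * τ) / (1 + Complex.I * τ * m)).im < 0 :=
    (Complex.continuous_im.continuousAt.tendsto.comp ht2).eventually (gt_mem_nhds hm)
  filter_upwards [self_mem_nhdsWithin, nhdsWithin_le_nhds o1, nhdsWithin_le_nhds o2,
    nhdsWithin_le_nhds (hd1.continuousAt.eventually_ne z1),
    nhdsWithin_le_nhds (hd2.continuousAt.eventually_ne z2)] with τ hτ q1 q2 q3 q4
  exact (hG.integral_regDen h hτ q3 q4 q1 q2).symm

end

/-! ### The inversion formula for boundary pairs -/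

section

variable {g : ℝ × ℝ → ℂ} {c : ℝ} {z : Fin 3 → ℂ}

/-- The double integral of the inversion formula, for an arbitrary function `T` in the place of the
transform. -/
def inversionIntegrand (z : Fin 3 → ℂ) (T : ℝ → (Fin 3 → ℝ) → ℂ) {p : Fin 3 → ℝ} (γ : Path p p)
    (q : ℝ × ℝ) : ℂ :=
  (weight 1 q.1 : ℂ) * curveIntegralFun (fun ξ => (coneForm ξ).smulRight
    (mink z (toC ξ) ^ (-1 / 2 + Complex.I * q.1 : ℂ) * T q.1 ξ)) γ q.2

lemma inversionIntegrand_eq (T : ℝ → (Fin 3 → ℝ) → ℂ) {p : Fin 3 → ℝ} (γ : Path p p) (q : ℝ × ℝ) :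
    inversionIntegrand z T γ q = (weight 1 q.1 : ℂ) * ((formSpeed γ q.2 : ℂ) *
      (mink z (toC (γ.extend q.2)) ^ (-1 / 2 + Complex.I * q.1 : ℂ) * T q.1 (γ.extend q.2))) := by
  rw [inversionIntegrand, curveIntegralFun_coneForm _
    (fun ξ => mink z (toC ξ) ^ (-1 / 2 + Complex.I * q.1 : ℂ) * T q.1 ξ)]

lemma aestronglyMeasurable_inversionIntegrand
    (hz : ∀ ξ ∈ futureCone, (mink z (toC ξ)).im < 0) {T : ℝ → (Fin 3 → ℝ) → ℂ}
    (hT : ContinuousOn (fun q : ℝ × (Fin 3 → ℝ) => T q.1 q.2) (univ ×ˢ futureCone))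
    {p : Fin 3 → ℝ} {γ : Path p p} (hγ : IsCycle γ) :
    AEStronglyMeasurable (inversionIntegrand z T γ)
      ((volume.restrict (Ioi 0)).prod (volume.restrict (Icc 0 1))) := by
  have hγc : Continuous fun q : ℝ × ℝ => γ.extend q.2 := γ.continuous_extend.comp continuous_snd
  have hmem := mem_futureCone_of_path hγ
  have h : inversionIntegrand z T γ = fun q => (weight 1 q.1 : ℂ) * ((formSpeed γ q.2 : ℂ) *
      (mink z (toC (γ.extend q.2)) ^ (-1 / 2 + Complex.I * q.1 : ℂ) * T q.1 (γ.extend q.2))) :=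
    funext fun q => inversionIntegrand_eq T γ q
  rw [h]
  refine AEStronglyMeasurable.mul ?_ (AEStronglyMeasurable.mul ?_ (AEStronglyMeasurable.mul ?_ ?_))
  · exact (Complex.measurable_ofReal.comp
      ((measurable_weight 1).comp measurable_fst)).aestronglyMeasurable
  · exact Complex.continuous_ofReal.comp_aestronglyMeasurable
      (aestronglyMeasurable_formSpeed γ).comp_snd
  · refine Continuous.aestronglyMeasurable ?_
    exact ((continuous_mink_comp z γ.continuous_extend).comp continuous_snd).cpow
      (by fun_prop) fun q => mem_slitPlane_of_im_neg (hz _ (hmem _))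
  · refine Continuous.aestronglyMeasurable ?_
    exact hT.comp_continuous (f := fun q : ℝ × ℝ => (q.1, γ.extend q.2))
      (continuous_fst.prodMk hγc) fun q => ⟨mem_univ _, hmem _⟩

/-- A bound, integrable in `(ν, t)`, that does not depend on the regularisation. -/
lemma exists_norm_inversionIntegrand_le
    (hz : ∀ ξ ∈ futureCone, (mink z (toC ξ)).im < 0) (hc : 0 ≤ c)
    (hb : ∀ᵐ p : ℝ × ℝ, ‖g p‖ ≤ c * (1 + |p.1|)⁻¹ * (1 + |p.2|)⁻¹)
    {p : Fin 3 → ℝ} {γ : Path p p} (hγ : IsCycle γ) :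
    ∃ C κ : ℝ, 0 < κ ∧ ∀ᵐ q ∂((volume.restrict (Ioi (0 : ℝ))).prod (volume.restrict (Icc 0 1))),
      ∀ τ, ‖inversionIntegrand z (regTransform τ g) γ q‖ ≤
        C * (|q.1| * Real.exp (-(κ * |q.1|)) * 1) := by
  have hmem := mem_futureCone_of_path hγ
  obtain ⟨K, hK0, hK⟩ := hγ.exists_formSpeed_bound
  obtain ⟨M, κ, hM, hκ, hMκ⟩ := exists_norm_planeWave_le hz γ.continuous_extend hmem zero_le_one
  obtain ⟨s, -, hs⟩ := isCompact_Icc.exists_isMinOn (nonempty_Icc.2 (zero_le_one (α := ℝ)))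
    ((continuous_apply 0).comp γ.continuous_extend).continuousOn
  obtain ⟨B, hB, hBT⟩ := exists_norm_regTransform_le hc
    (zero_lt_of_mem_futureCone (hmem s)) hb
  refine ⟨K * M * B * 2, κ, hκ, ?_⟩
  have hq : ∀ᵐ q : ℝ × ℝ ∂((volume.restrict (Ioi 0)).prod (volume.restrict (Icc 0 1))),
      0 < q.1 ∧ q.2 ∈ Icc (0 : ℝ) 1 := by
    rw [Measure.prod_restrict]
    exact ae_restrict_mem (measurableSet_Ioi.prod measurableSet_Icc)
  filter_upwards [hq, Measure.quasiMeasurePreserving_snd.ae hK] with q hq hKq τ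
  have e1 := hMκ q.1 hq.1.le q.2 hq.2
  have e2 := hBT τ q.1 _ (hmem q.2) (hs hq.2)
  have e3 := abs_weight_one_mul_exp_le (κ := κ) hq.1
  rw [inversionIntegrand_eq, norm_mul, norm_mul, norm_mul, Complex.norm_real, Complex.norm_real,
    Real.norm_eq_abs, Real.norm_eq_abs]
  calc _ ≤ |weight 1 q.1| * (K * ((M * Real.exp ((Real.pi - κ) * q.1)) *
          (B * Real.exp (Real.pi * |q.1|)))) := by gcongr
    _ = K * M * B * (|weight 1 q.1| * (Real.exp ((Real.pi - κ) * q.1) *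
          Real.exp (Real.pi * |q.1|))) := by ring
    _ ≤ K * M * B * (2 * (|q.1| * Real.exp (-(κ * |q.1|)))) :=
        mul_le_mul_of_nonneg_left e3 (by positivity)
    _ = _ := by ring

lemma curveIntegral_eq_setIntegral {p : Fin 3 → ℝ} (ω : (Fin 3 → ℝ) → (Fin 3 → ℝ) →L[ℝ] ℂ)
    (γ : Path p p) : curveIntegral ω γ = ∫ t in Icc (0 : ℝ) 1, curveIntegralFun ω γ t := by
  rw [curveIntegral_def, intervalIntegral.integral_of_le zero_le_one, integral_Icc_eq_integral_Ioc]

lemma integral_inversionIntegrand {T : ℝ → (Fin 3 → ℝ) → ℂ} {p : Fin 3 → ℝ} {γ : Path p p}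
    (h : Integrable (inversionIntegrand z T γ)
      ((volume.restrict (Ioi 0)).prod (volume.restrict (Icc 0 1)))) :
    ∫ q, inversionIntegrand z T γ q ∂((volume.restrict (Ioi 0)).prod (volume.restrict (Icc 0 1))) =
      ∫ ν in Ioi (0 : ℝ), (weight 1 ν : ℂ) * curveIntegral (fun ξ => (coneForm ξ).smulRight
        (mink z (toC ξ) ^ (-1 / 2 + Complex.I * ν : ℂ) * T ν ξ)) γ := by
  rw [integral_prod _ h]
  simp_rw [inversionIntegrand, integral_const_mul, curveIntegral_eq_setIntegral]

/-- The inversion formula, in the coordinates of the tube. The regularised formula is passed to the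
limit `τ → 0⁺` on both sides. -/
theorem BoundaryPair.inversion {G : ℂ × ℂ → ℂ} (hG : BoundaryPair G g c) {l m : ℂ}
    (hl : 0 < l.im) (hm : m.im < 0) {p : Fin 3 → ℝ} {γ : Path p p} (hγ : IsCycle γ) :
    Integrable (inversionIntegrand (param l m)
        (fun ν ξ => ∫ p, chartKernel 1 ν ξ p * g p) γ)
      ((volume.restrict (Ioi 0)).prod (volume.restrict (Icc 0 1))) ∧
    ∫ ν in Ioi (0 : ℝ), (weight 1 ν : ℂ) * curveIntegral (fun ξ => (coneForm ξ).smulRight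
        (mink (param l m) (toC ξ) ^ (-1 / 2 + Complex.I * ν : ℂ) *
          ∫ p, chartKernel 1 ν ξ p * g p)) γ =
      2 * Real.pi ^ 2 * ((l - m) * G (l, m)) := by
  have hlm : l ≠ m := fun h => by rw [h] at hl; linarith
  have hz : ∀ ξ ∈ futureCone, (mink (param l m) (toC ξ)).im < 0 := fun ξ hξ =>
    im_mink_param_neg hl hm hξ
  have hc := hG.const_nonneg
  have hg := hG.meas
  have hb := hG.bound_real
  have hmem := mem_futureCone_of_path hγ
  obtain ⟨C, κ, hκ, hCκ⟩ := exists_norm_inversionIntegrand_le hz hc hb hγ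
  have hdom : Integrable (fun q : ℝ × ℝ => C * (|q.1| * Real.exp (-(κ * |q.1|)) * 1))
      ((volume.restrict (Ioi 0)).prod (volume.restrict (Icc 0 1))) :=
    (((integrable_abs_mul_exp hκ).restrict (s := Ioi 0)).mul_prod (g := fun _ : ℝ => (1 : ℝ))
      (integrable_const _)).const_mul C
  have hev : ∀ᶠ τ : ℝ in 𝓝[>] 0, 0 < τ ∧ τ ≤ 1 :=
    Ioc_mem_nhdsGT zero_lt_one
  have hmeas : ∀ τ : ℝ, 0 < τ ∧ τ ≤ 1 → AEStronglyMeasurable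
      (inversionIntegrand (param l m) (regTransform τ g) γ)
      ((volume.restrict (Ioi 0)).prod (volume.restrict (Icc 0 1))) := fun τ hτ =>
    aestronglyMeasurable_inversionIntegrand hz (continuousOn_regTransform hτ.1 hτ.2 hc hg hb) hγ
  have hlim : ∀ q, Tendsto (fun τ => inversionIntegrand (param l m) (regTransform τ g) γ q)
      (𝓝[>] 0) (𝓝 (inversionIntegrand (param l m)
        (fun ν ξ => ∫ p, chartKernel 1 ν ξ p * g p) γ q)) := fun q => by
    simp_rw [inversionIntegrand_eq]
    exact ((tendsto_regTransform hg hb q.1 (hmem q.2)).const_mul _).const_mul _ |>.const_mul _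
  have hDCT := tendsto_integral_filter_of_dominated_convergence _
    (hev.mono hmeas) (Eventually.of_forall fun τ => hCκ.mono fun q hq => hq τ) hdom
    (Eventually.of_forall hlim)
  have hint : Integrable (inversionIntegrand (param l m)
      (fun ν ξ => ∫ p, chartKernel 1 ν ξ p * g p) γ)
      ((volume.restrict (Ioi 0)).prod (volume.restrict (Icc 0 1))) := by
    obtain ⟨τ, -, hτ0, hτlim⟩ := exists_seq_strictAnti_tendsto' (zero_lt_one (α := ℝ))
    refine hdom.mono' (aestronglyMeasurable_of_tendsto_ae atTop
      (fun n => hmeas (τ n) ⟨(hτ0 n).1, (hτ0 n).2.le⟩) (Eventually.of_forall fun q => ?_)) ?_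
    · exact (hlim q).comp (tendsto_nhdsWithin_iff.2 ⟨hτlim, Eventually.of_forall fun n =>
        (hτ0 n).1⟩)
    · filter_upwards [hCκ] with q hq
      exact le_of_tendsto (hlim q).norm (Eventually.of_forall hq)
  refine ⟨hint, ?_⟩
  rw [← integral_inversionIntegrand hint]
  refine tendsto_nhds_unique hDCT ((hG.tendsto_integral_regDen hl hm).congr' ?_)
  filter_upwards [hev] with τ hτ
  rw [integral_inversionIntegrand (hdom.mono' (hmeas τ hτ) (hCκ.mono fun q hq => hq τ)),
    ← integral_weight_regTransform hz (mink_param_self hlm) hτ.1 hτ.2 hc hg hb]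
  simp_rw [curveIntegral_regTransform hz hτ.1 hτ.2 hc hg hb hγ]

end

/-! ### From the quadric to the tube -/

/-- `𝒯⁻` is covered by the coordinates `(λ, μ)` with `Im μ < 0 < Im λ`: the product
`Im λ · Im μ` is negative because `[y·y] > 0`, and `Im (λ - μ) > 0` because `y₀ + y₁ < 0`. -/
lemma exists_param_of_mem_tuboid {z : Fin 3 → ℂ} (hz : z ∈ tuboid (-1)) :
    ∃ l m : ℂ, 0 < l.im ∧ m.im < 0 ∧ z = param l m := by
  obtain ⟨hzz, hyy, hy0⟩ := hz
  have hneg : (z 0).im + (z 1).im < 0 := by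
    simp only [mink, imPart] at hyy hy0
    nlinarith [sq_nonneg (z 2).im, sq_nonneg ((z 0).im + (z 1).im)]
  have hs : z 0 + z 1 ≠ 0 := fun h => by
    have := congrArg Complex.im h
    simp only [Complex.add_im, Complex.zero_im] at this
    linarith
  set l := (z 2 + 1) / (z 0 + z 1) with hl
  set m := (z 2 - 1) / (z 0 + z 1) with hm
  have hlm : l - m = 2 / (z 0 + z 1) := by rw [hl, hm]; ring
  have hlm0 : l - m ≠ 0 := by rw [hlm]; exact div_ne_zero two_ne_zero hs
  have hprod : l * m = (z 0 - z 1) / (z 0 + z 1) := by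
    rw [hl, hm, div_mul_div_comm, div_eq_div_iff (mul_ne_zero hs hs) hs]
    simp only [mink] at hzz
    linear_combination (-(z 0 + z 1)) * hzz
  have hparam : z = param l m := by
    ext i
    fin_cases i
    · change z 0 = (1 + l * m) / (l - m)
      rw [hprod, hlm]; field_simp; ring
    · change z 1 = (1 - l * m) / (l - m)
      rw [hprod, hlm]; field_simp; ring
    · change z 2 = (l + m) / (l - m)
      rw [hlm, hl, hm]; field_simp; ring
  have hN : 0 < Complex.normSq (l - m) := Complex.normSq_pos.2 hlm0
  have h1 : m.im < l.im := by
    have e : z 0 + z 1 = 2 / (l - m) := by rw [hlm, div_div_cancel₀ two_ne_zero]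
    have := congrArg Complex.im e
    rw [Complex.add_im, Complex.div_im] at this
    simp only [Complex.re_ofNat, Complex.im_ofNat, Complex.sub_im, zero_mul, zero_div, zero_sub]
      at this
    have h2 : 0 < 2 * (l.im - m.im) / Complex.normSq (l - m) := by linarith
    have h3 := (div_pos_iff_of_pos_right hN).1 h2
    linarith
  have h2 : l.im * m.im < 0 := by
    have hconj : (starRingEnd ℂ) l - (starRingEnd ℂ) m ≠ 0 := by
      rw [← map_sub]; exact (map_ne_zero _).2 hlm0
    have e := one_add_mink_param (sub_ne_zero.1 hlm0) (sub_ne_zero.1 hconj)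
    have e0 : mink (param l m) (param ((starRingEnd ℂ) l) ((starRingEnd ℂ) m)) =
        mink z (fun i => (starRingEnd ℂ) (z i)) := by
      have : param ((starRingEnd ℂ) l) ((starRingEnd ℂ) m) = fun i => (starRingEnd ℂ) (z i) := by
        rw [hparam]
        ext i
        fin_cases i <;> simp [param]
      rw [this, ← hparam]
    rw [e0, ← map_sub, Complex.mul_conj, Complex.sub_conj, Complex.sub_conj] at e
    have er : mink z (fun i => (starRingEnd ℂ) (z i)) =
        ((2 * mink (imPart z) (imPart z) - 1 : ℝ) : ℂ) := by
      have hre := congrArg Complex.re hzz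
      simp only [mink, Complex.sub_re, Complex.mul_re, Complex.neg_re, Complex.one_re] at hre
      simp only [mink, imPart, Complex.mul_conj, Complex.normSq_apply]
      rw [← Complex.ofReal_sub, ← Complex.ofReal_sub]
      congr 1
      linarith
    have e' : mink (imPart z) (imPart z) = -(4 * (l.im * m.im) / Complex.normSq (l - m)) := by
      have : ((mink (imPart z) (imPart z) : ℝ) : ℂ) =
          ((-(4 * (l.im * m.im) / Complex.normSq (l - m)) : ℝ) : ℂ) := by
        rw [er] at e
        push_cast at e ⊢
        linear_combination (1 / 2) * e +
          (4 * (l.im : ℂ) * m.im / (Complex.normSq (l - m) : ℂ)) * Complex.I_sq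
      exact_mod_cast this
    rw [e', ← neg_div] at hyy
    have := (div_pos_iff_of_pos_right hN).1 hyy
    linarith
  refine ⟨l, m, ?_, ?_, hparam⟩ <;> nlinarith

lemma neg_mem_tuboid {z : Fin 3 → ℂ} (hz : z ∈ tuboid 1) : -z ∈ tuboid (-1) := by
  obtain ⟨h1, h2, h3⟩ := hz
  have h : imPart (-z) = -imPart z := by ext i; simp [imPart]
  refine ⟨by rw [mink_neg_neg, h1], by rw [h, mink_neg_neg]; exact h2, ?_⟩
  rw [h]
  simpa using h3

/-! ### Regular Hardy functions as boundary pairs -/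

section

variable {F : (Fin 3 → ℂ) → ℂ} {f : (Fin 3 → ℝ) → ℂ}

/-- Mean-square boundary values are almost everywhere limits along a sequence of heights. -/
lemma MemHardyReg.exists_tendsto_ae {δ : ℝ} (hδ : δ = 1 ∨ δ = -1) (h : MemHardyReg δ F f) :
    ∃ η : ℕ → ℝ, (∀ n, 0 < η n) ∧ Tendsto η atTop (𝓝 0) ∧
      ∀ᵐ p : ℝ × ℝ, Tendsto (fun n => reduced F ((p.1 : ℂ) + (-δ * η n : ℝ) * Complex.I,
        (p.2 : ℂ) + (δ * η n : ℝ) * Complex.I)) atTop (𝓝 (reducedReal f p)) := by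
  obtain ⟨η, -, hη0, hη⟩ := exists_seq_strictAnti_tendsto' (zero_lt_one (α := ℝ))
  have hδ2 : δ * δ = 1 := by rcases hδ with rfl | rfl <;> norm_num
  have hηt : Tendsto η atTop (𝓝[>] 0) :=
    tendsto_nhdsWithin_iff.2 ⟨hη, Eventually.of_forall fun n => (hη0 n).1⟩
  have hL := h.boundary.comp (hηt.prodMk hηt)
  have hm : ∀ n, AEStronglyMeasurable (fun p : ℝ × ℝ =>
      reduced F ((p.1 : ℂ) + (-δ * η n : ℝ) * Complex.I,
        (p.2 : ℂ) + (δ * η n : ℝ) * Complex.I)) := fun n => by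
    refine (h.hardy.differentiableOn.continuousOn.comp_continuous (by fun_prop)
      fun p => ?_).aestronglyMeasurable
    have := (hη0 n).1
    constructor
    · simp; nlinarith
    · simp; nlinarith
  obtain ⟨ns, hns, hlim⟩ := (tendstoInMeasure_of_tendsto_eLpNorm (p := 2) two_ne_zero hm
    (aestronglyMeasurable_reducedReal h.memLp.1) hL).exists_seq_tendsto_ae
  exact ⟨η ∘ ns, fun n => (hη0 _).1, hη.comp hns.tendsto_atTop, hlim⟩

lemma MemHardyReg.boundaryPair_lower (h : MemHardyReg (-1) F f) :
    ∃ c, BoundaryPair (reduced F) (reducedReal f) c := by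
  obtain ⟨c, hc, hcr⟩ := h.regular
  obtain ⟨η, hη, hη0, hlim⟩ := h.exists_tendsto_ae (Or.inr rfl)
  have hol := h.hardy.differentiableOn
  rw [neg_neg] at hc hol
  refine ⟨c, hol, aestronglyMeasurable_reducedReal h.memLp.1, hc, hcr, η, hη, hη0, ?_⟩
  filter_upwards [hlim] with p hp
  refine hp.congr fun n => ?_
  rw [lift]
  congr 2
  · push_cast; ring
  · push_cast; ring

lemma ae_swap {P : ℝ × ℝ → Prop} (h : ∀ᵐ p, P p) : ∀ᵐ p : ℝ × ℝ, P p.swap :=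
  (Measure.measurePreserving_swap (μ := (volume : Measure ℝ))
    (ν := (volume : Measure ℝ))).quasiMeasurePreserving.ae h

/-- The symmetry `z ↦ -z`, which exchanges the two tuboids, exchanges `λ` and `μ`. -/
lemma MemHardyReg.boundaryPair_upper (h : MemHardyReg 1 F f) :
    ∃ c, BoundaryPair (fun q => -reduced F q.swap) (fun p => -reducedReal f p.swap) c := by
  obtain ⟨c, hc, hcr⟩ := h.regular
  obtain ⟨η, hη, hη0, hlim⟩ := h.exists_tendsto_ae (Or.inl rfl)
  have hswap : ∀ q ∈ tube 1 (-1), q.swap ∈ tube (-1) 1 := fun q hq => ⟨hq.2, hq.1⟩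
  refine ⟨c, ?_, ?_, fun q hq => ?_, ?_, η, hη, hη0, ?_⟩
  · refine DifferentiableOn.neg ?_
    exact h.hardy.differentiableOn.comp
      (differentiable_snd.prodMk differentiable_fst).differentiableOn hswap
  · exact ((aestronglyMeasurable_reducedReal h.memLp.1).comp_quasiMeasurePreserving
      (Measure.measurePreserving_swap (μ := (volume : Measure ℝ))
        (ν := (volume : Measure ℝ))).quasiMeasurePreserving).neg
  · rw [norm_neg]
    refine (hc _ (hswap q hq)).trans (le_of_eq ?_)
    simp only [Prod.fst_swap, Prod.snd_swap]
    ring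
  · filter_upwards [ae_swap hcr] with p hp
    rw [norm_neg]
    refine hp.trans (le_of_eq ?_)
    simp only [Prod.fst_swap, Prod.snd_swap]
    ring
  · filter_upwards [ae_swap hlim] with p hp
    refine hp.neg.congr fun n => ?_
    simp only [lift, Prod.fst_swap, Prod.snd_swap, Prod.swap_prod_mk]
    congr 3
    · push_cast; ring
    · push_cast; ring

end

/-! ### The symmetry between the two tuboids -/

section

variable {f : (Fin 3 → ℝ) → ℂ}

lemma chartKernel_neg_swap (ε ν : ℝ) (hε : ε = 1 ∨ ε = -1) (ξ : Fin 3 → ℝ) (p : ℝ × ℝ) :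
    chartKernel (-ε) ν ξ p.swap =
      -Complex.exp (-(ε * Real.pi * Complex.I * (-1 / 2 - Complex.I * ν))) *
        chartKernel ε ν ξ p := by
  have h1 : mink (param p.2 p.1) ξ = -mink (param p.1 p.2) ξ := by
    rw [param_swap, mink_neg_left]
  have h2 : ((p.2 - p.1 : ℝ) : ℂ) = -((p.1 - p.2 : ℝ) : ℂ) := by push_cast; ring
  rw [chartKernel, chartKernel, Prod.fst_swap, Prod.snd_swap, h1, h2, div_neg]
  rcases hε with rfl | rfl
  · rw [bvPow_neg_one_neg]
    push_cast; rw [one_mul]; ring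
  · rw [neg_neg, bvPow_one_neg]
    push_cast; ring_nf

lemma integral_swap (u : ℝ × ℝ → ℂ) : ∫ p : ℝ × ℝ, u p.swap = ∫ p, u p :=
  integral_prod_swap (μ := (volume : Measure ℝ)) (ν := (volume : Measure ℝ)) u

/-- Up to a constant, `f̃_{-ε,ν}` is the transform `f̃_{ε,ν}` of `x ↦ f(-x)`. -/
lemma fh_neg_eq (ε ν : ℝ) (hε : ε = 1 ∨ ε = -1) (ξ : Fin 3 → ℝ) (hf : AEStronglyMeasurable f sigma) :
    fh (-ε) f ν ξ = Complex.exp (-(ε * Real.pi * Complex.I * (-1 / 2 - Complex.I * ν))) *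
      ∫ p, chartKernel ε ν ξ p * (-reducedReal f p.swap) := by
  rw [fh_eq _ _ _ hf, ← integral_swap, ← integral_const_mul]
  refine integral_congr_ae (Eventually.of_forall fun p => ?_)
  dsimp only
  rw [chartKernel_neg_swap ε ν hε]
  ring

lemma weight_neg_one_mul_exp (ν : ℝ) :
    weight (-1) ν * Real.exp (-(2 * (Real.pi * ν))) = weight 1 ν := by
  have h : Real.exp (-(2 * (Real.pi * ν))) = Real.exp (-(Real.pi * ν)) / Real.exp (Real.pi * ν) := by
    rw [← Real.exp_sub]; ring_nf
  have h1 := (Real.exp_pos (-(Real.pi * ν))).ne'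
  have h2 := (Real.exp_pos (Real.pi * ν)).ne'
  have h3 := (Real.cosh_pos (Real.pi * ν)).ne'
  rw [weight, weight, neg_one_mul, one_mul, h]
  field_simp

/-- The symmetry `z ↦ -z` at the level of the integrand of the inversion formula. -/
lemma weight_neg_one_planeWave (ν : ℝ) {z : Fin 3 → ℂ} {ξ : Fin 3 → ℝ}
    (hz : (mink z (toC ξ)).im < 0) (hf : AEStronglyMeasurable f sigma) :
    (weight (-1) ν : ℂ) * (mink (-z) (toC ξ) ^ (-1 / 2 + Complex.I * ν : ℂ) * fh (-1) f ν ξ) =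
      (weight 1 ν : ℂ) * (mink z (toC ξ) ^ (-1 / 2 + Complex.I * ν : ℂ) *
        ∫ p, chartKernel 1 ν ξ p * (-reducedReal f p.swap)) := by
  rw [fh_neg_eq 1 ν (Or.inl rfl) ξ hf, neg_cpow_of_im_neg hz, mink_neg_left,
    ← weight_neg_one_mul_exp]
  have h : ((Real.exp (-(2 * (Real.pi * ν))) : ℝ) : ℂ) *
      Complex.exp (-(Real.pi * Complex.I * (-1 / 2 + Complex.I * ν))) =
      Complex.exp (-(((1 : ℝ) : ℂ) * Real.pi * Complex.I * (-1 / 2 - Complex.I * ν))) := by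
    rw [Complex.ofReal_exp, ← Complex.exp_add]
    congr 1
    push_cast
    linear_combination (-2 * Real.pi * ν : ℂ) * Complex.I_sq
  rw [← h]
  push_cast
  ring

end

/-! ### The inversion formula on the quadric -/

/-- The inversion formula on the quadric, given a boundary pair that represents `F` and `f`. -/
lemma BoundaryPair.inversion_quadric {G : ℂ × ℂ → ℂ} {g : ℝ × ℝ → ℂ} {c : ℝ}
    (hG : BoundaryPair G g c) {l m : ℂ} (hl : 0 < l.im) (hm : m.im < 0)
    {ε : ℝ} {f : (Fin 3 → ℝ) → ℂ} {z : Fin 3 → ℂ}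
    (hzf : ∀ ν : ℝ, ∀ ξ ∈ futureCone,
      (weight ε ν : ℂ) * (mink z (toC ξ) ^ (-1 / 2 + Complex.I * ν : ℂ) * fh ε f ν ξ) =
        (weight 1 ν : ℂ) * (mink (param l m) (toC ξ) ^ (-1 / 2 + Complex.I * ν : ℂ) *
          ∫ p, chartKernel 1 ν ξ p * g p))
    {p : Fin 3 → ℝ} {γ : Path p p} (hγ : IsCycle γ) :
    Integrable (fun q : ℝ × ℝ => (weight ε q.1 : ℂ) *
        curveIntegralFun (inversionForm ε f z q.1) γ q.2)
      ((volume.restrict (Ioi 0)).prod (volume.restrict (Icc 0 1))) ∧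
    (l - m) * G (l, m) = 1 / (2 * (Real.pi : ℂ) ^ 2) *
      ∫ ν in Ioi (0 : ℝ), (weight ε ν : ℂ) * curveIntegral (inversionForm ε f z ν) γ := by
  obtain ⟨hint, hval⟩ := hG.inversion hl hm hγ
  have hpt : ∀ q : ℝ × ℝ, inversionIntegrand (param l m)
      (fun ν ξ => ∫ p, chartKernel 1 ν ξ p * g p) γ q =
      (weight ε q.1 : ℂ) * curveIntegralFun (inversionForm ε f z q.1) γ q.2 := fun q => by
    have e : curveIntegralFun (inversionForm ε f z q.1) γ q.2 = (formSpeed γ q.2 : ℂ) *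
        (mink z (toC (γ.extend q.2)) ^ (-1 / 2 + Complex.I * q.1 : ℂ) *
          fh ε f q.1 (γ.extend q.2)) :=
      curveIntegralFun_coneForm γ
        (fun ξ => mink z (toC ξ) ^ (-1 / 2 + Complex.I * q.1 : ℂ) * fh ε f q.1 ξ) q.2
    rw [inversionIntegrand_eq, e]
    linear_combination (-(formSpeed γ q.2 : ℂ)) * hzf q.1 _ (mem_futureCone_of_path hγ q.2)
  refine ⟨hint.congr (Eventually.of_forall hpt), ?_⟩
  have e : ∀ ν : ℝ, (weight ε ν : ℂ) * curveIntegral (inversionForm ε f z ν) γ =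
      (weight 1 ν : ℂ) * curveIntegral (fun ξ => (coneForm ξ).smulRight
        (mink (param l m) (toC ξ) ^ (-1 / 2 + Complex.I * ν : ℂ) *
          ∫ p, chartKernel 1 ν ξ p * g p)) γ := fun ν => by
    rw [curveIntegral_eq_setIntegral, curveIntegral_eq_setIntegral, ← integral_const_mul,
      ← integral_const_mul]
    exact integral_congr_ae (Eventually.of_forall fun t => (hpt (ν, t)).symm)
  simp_rw [e]
  have : (Real.pi : ℂ) ≠ 0 := by exact_mod_cast Real.pi_ne_zero
  rw [hval]
  field_simp

end OneSheeted

end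

open OneSheeted

/-- The upper signs of the statement are `ε = 1` (functions on `𝒯⁻`, transform `f̃_{+,ν}`), the
lower signs are `ε = -1` (functions on `𝒯⁺`, transform `f̃_{-,ν}`). -/
theorem theorem2 (ε : ℝ) (hε : ε = 1 ∨ ε = -1)
    (F : (Fin 3 → ℂ) → ℂ) (f : (Fin 3 → ℝ) → ℂ) (hF : OneSheeted.MemHardyReg (-ε) F f) :
    -- both transforms are given by convergent integrals
    (∀ δ : ℝ, δ = 1 ∨ δ = -1 → ∀ ν : ℝ, ∀ ξ ∈ OneSheeted.futureCone,
      Integrable (OneSheeted.fhIntegrand δ f ν ξ) OneSheeted.sigma) ∧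
    -- only one of the two transforms does not vanish identically
    (∀ ν : ℝ, ∀ ξ ∈ OneSheeted.futureCone, OneSheeted.fh (-ε) f ν ξ = 0) ∧
    -- the inversion formula, with an absolutely convergent double integral
    (∀ z ∈ OneSheeted.tuboid (-ε), ∀ (p : Fin 3 → ℝ) (γ : Path p p), OneSheeted.IsCycle γ →
      Integrable
        (fun q : ℝ × ℝ => (OneSheeted.weight ε q.1 : ℂ) *
          curveIntegralFun (OneSheeted.inversionForm ε f z q.1) γ q.2)
        ((volume.restrict (Ioi 0)).prod (volume.restrict (Icc 0 1))) ∧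
      F z = 1 / (2 * (Real.pi : ℂ) ^ 2) *
        ∫ ν in Ioi (0 : ℝ), (OneSheeted.weight ε ν : ℂ) *
          curveIntegral (OneSheeted.inversionForm ε f z ν) γ) := by
  have hm := aestronglyMeasurable_reducedReal hF.memLp.1
  obtain ⟨c, -, hcr⟩ := hF.regular
  refine ⟨fun δ hδ ν ξ hξ => (integrable_fhIntegrand_iff δ ν ξ hF.memLp.1).2
    (integrable_chartKernel_mul hδ ν hξ hm hcr), ?_⟩
  rcases hε with rfl | rfl
  · obtain ⟨c, hG⟩ := hF.boundaryPair_lower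
    refine ⟨fun ν ξ hξ => ?_, fun z hz p γ hγ => ?_⟩
    · rw [fh_eq _ _ _ hF.memLp.1, hG.integral_chartKernel_neg_one ν hξ]
    · obtain ⟨l, m, hl, hm, rfl⟩ := exists_param_of_mem_tuboid hz
      have hlm : l - m ≠ 0 := sub_ne_zero.2 fun h => by rw [h] at hl; linarith
      have h := hG.inversion_quadric hl hm (ε := 1) (f := f) (z := param l m)
        (fun ν ξ _ => by rw [fh_eq _ _ _ hF.memLp.1]) hγ
      rwa [reduced, mul_div_cancel₀ _ hlm] at h
  · rw [neg_neg] at hF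
    obtain ⟨c, hG⟩ := hF.boundaryPair_upper
    rw [neg_neg]
    refine ⟨fun ν ξ hξ => ?_, fun z hz p γ hγ => ?_⟩
    · have h := fh_neg_eq (-1) ν (Or.inr rfl) ξ hF.memLp.1
      rw [neg_neg, hG.integral_chartKernel_neg_one ν hξ, mul_zero] at h
      exact h
    · obtain ⟨l, m, hl, hm, hzlm⟩ := exists_param_of_mem_tuboid (neg_mem_tuboid hz)
      have hml : m - l ≠ 0 := sub_ne_zero.2 fun h => by rw [h] at hm; linarith
      obtain rfl : z = -param l m := by rw [← hzlm, neg_neg]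
      have h := hG.inversion_quadric hl hm (ε := -1) (f := f) (z := -param l m)
        (fun ν ξ hξ => weight_neg_one_planeWave ν (im_mink_param_neg hl hm hξ) hF.memLp.1) hγ
      have e : (l - m) * -reduced F (m, l) = F (-param l m) := by
        rw [reduced, ← param_swap]
        dsimp only
        field_simp
        ring
      rw [Prod.swap_prod_mk, e] at h
      exact h
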